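/- Let $R$ be a commutative ring, $(X,\star)$ a spindle (a set with an operation satisfying $x\star x=x$ and $(x\star y)\star z=(x\star z)\star(y\star z)$), and $M$ an $R$-module with an action of $X$, i.e. a map $\star\colon M\times X\to M$, linear in $M$, with $(m\star x)\star y=(m\star y)\star(x\star y)$. Chain complexes. For $n\ge 0$ let $C_n(M;X)=M\otimes R\langle X^{n+1}\rangle$ and $d^\star_i(m\otimes(x_n,\dots,x_0))=(m\star x_i)\otimes(x_n\star x_i,\dots,x_{i+1}\star x_i,x_{i-1},\dots,x_0)$, and let $d_i^{\rm triv}$ be given by the same formula with $m$ and the $x_j$ acted on trivially. Put $\partial^\star=\sum_{i=0}^n(-1)^{n-i}d_i^\star$, likewise $\partial^{\rm triv}$, and $\partial=\partial^R=\partial^{\rm triv}-\partial^\star$. Let $\widehat C(M;X)$ be $C(M;X)$ augmented by $\widehat C_{-1}=M$ through $m\otimes x\mapsto m-m\star x$. Let $CD(M;X)\subset C(M;X)$ be the subcomplex spanned by the $m\otimes(x_n,\dots,x_0)$ with $x_i=x_{i+1}$ for some $i$, filtered by the subcomplexes $\mathcal F^p$ spanned by those with $x_i=x_{i+1}$ for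 some $i\le p$. Let $CN(X)=C(R;X)/CD(R;X)$, with the trivial action of $X$ on $R$. Write $\widehat H$, $HD$, $HN$ for the homology of $\widehat C$, $CD$, $CN$. The bicomplex. Let $B_{pq}=\widehat C_{q-2}(M;X)\otimes_R CN_p(X)$ for $p\ge 0$, $q\ge 1$. Fix a sign $\sigma\in\{1,-1\}$, and let ${\rm Tot}(B)_n=\bigoplus_{p+q=n}B_{pq}$, with differential $a\otimes b\mapsto\partial a\otimes b+\sigma(-1)^q\,a\otimes\partial b$ on $B_{pq}$ and with the filtration by columns $\mathcal F^p{\rm Tot}(B)=\bigoplus_{p'\le p}B_{p',\bullet}$. The map. Let $\alpha_p\colon CN_p(X)\to C_p(X)$ be the splitting $(x_p,\dots,x_0)\mapsto(x_p,\,x_{p-1}-x_p,\,\dots,\,x_0-x_1)$ (multilinear notation). Let $\delta(x_p,\dots,x_0)=(x_p,x_p,x_{p-1},\dots,x_0)$. Let $u^p\colon C_{p+1}(X)\to C_{p+1}(X)$ be given by $u^0={\rm id}$ and, for $p\ge1$, $u^p(w,y)=(u^{p-1}(w),y)+(-1)^p(y,u^{p-1}(w\star y))$, where $y\in X$ is the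 last entry, $w\in X^{p+1}$, and $w\star y$ is taken entrywise. Define $$\mathcal E\colon {\rm Tot}(B)_n\to CD_n(M;X),\qquad \mathcal E(a\otimes b)=\bigl(a,\ \sigma^p\,u^p\,\delta\,\alpha_p(b)\bigr)\quad\text{on }B_{pq},$$ where $(\cdot,\cdot)$ denotes concatenation of sequences. Theorem. (1) $\mathcal E$ is an isomorphism of filtered chain complexes: it is an isomorphism of chain complexes and $\mathcal E(\mathcal F^p{\rm Tot}(B))=\mathcal F^p$ for all $p$. (2) If $R$ is a principal ideal domain, then for every $n$ there is a short exact sequence $$0\to\bigoplus_{p+q=n}\widehat H_{q-2}(M;X,\partial^R)\otimes HN_p(X,\partial^R)\to HD_n(M;X,\partial^R)\to\bigoplus_{p+q=n-1}{\rm Tor}_1\bigl(\widehat H_{q-2}(M;X,\partial^R),HN_p(X,\partial^R)\bigr)\to0$$ which splits, and whose first map sends $[a]\otimes[b]$ to $[\mathcal E(a\otimes b)]$. -/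

import Mathlib

universe u

open scoped TensorProduct

/-- A spindle: a set with an idempotent, right self-distributive operation `x ⋆ y = op x y`. -/
class Spindle (X : Type*) where
  op : X → X → X
  op_self : ∀ x, op x x = x
  op_distrib : ∀ x y z, op (op x y) z = op (op x z) (op y z)

/-- An action of a spindle `X` on an `R`-module `M`; `act x m` is `m ⋆ x`. -/
structure SpindleAction (R X M : Type*) [CommRing R] [Spindle X] [AddCommGroup M] [Module R M] where
  act : X → M →ₗ[R] M
  act_act : ∀ x y m, act y (act x m) = act (Spindle.op x y) (act y m)

/-- The trivial action `r ⋆ x = r` of `X` on the ground ring `R`. -/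
def SpindleAction.trivial (R X : Type*) [CommRing R] [Spindle X] : SpindleAction R X R where
  act _ := LinearMap.id
  act_act _ _ _ := rfl

namespace SpindleHomology

open TensorProduct

/-- The module `M ⊗ R⟨X^L⟩`, as finite formal sums `∑ m ⊗ x`. A sequence
`(x_{L-1}, …, x_1, x_0)`, numbered from right to left, is the function `i ↦ x_i`.
Thus `C_n(M;X)` is `Chain X M (n + 1)`, and `Ĉ_{k-1}(M;X)` is `Chain X M k` for every `k ≥ 0`
(in particular `Ĉ_{-1}(M;X) = M`, with one generator for the empty sequence). -/
abbrev Chain (X M : Type*) [AddCommGroup M] (L : ℕ) : Type _ := (Fin L → X) →₀ M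

section Differential

variable {R X M : Type*} [CommRing R] [AddCommGroup M] [Module R M]

/-- `d_i (x_n, …, x_0) = (x_n ⋆ x_i, …, x_{i+1} ⋆ x_i, x_{i-1}, …, x_0)`. -/
def faceSeq (op : X → X → X) {n : ℕ} (i : Fin (n + 1)) (x : Fin (n + 1) → X) : Fin n → X :=
  fun j => if (j : ℕ) < i then x j.castSucc else op (x j.succ) (x i)

/-- `d_i (m ⊗ x) = (m ⋆ x_i) ⊗ d_i x`. -/
noncomputable def face (op : X → X → X) (act : X → M →ₗ[R] M) {n : ℕ} (i : Fin (n + 1)) :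
    Chain X M (n + 1) →ₗ[R] Chain X M n :=
  Finsupp.lsum R fun x => Finsupp.lsingle (faceSeq op i x) ∘ₗ act (x i)

/-- The one-term distributive differential `∂^⋆ = ∑_{i=0}^n (-1)^{n-i} d_i`. For `n = 0` it is
the linearized action map `M ⊗ R⟨X⟩ → M`. -/
noncomputable def oneTermD (op : X → X → X) (act : X → M →ₗ[R] M) (n : ℕ) :
    Chain X M (n + 1) →ₗ[R] Chain X M n :=
  ∑ i : Fin (n + 1), (-1 : R) ^ (n - (i : ℕ)) • face op act i

/-- The rack differential `∂^R = ∂^triv - ∂^⋆`, where `x triv y = x` and `m triv x = m`. -/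
noncomputable def rackD [Spindle X] (A : SpindleAction R X M) (n : ℕ) :
    Chain X M (n + 1) →ₗ[R] Chain X M n :=
  oneTermD (fun x _ => x) (fun _ => LinearMap.id) n - oneTermD Spindle.op A.act n

/-- Diagonal action of `y` on chains, used only to verify `∂² = 0`. -/
noncomputable def diagAct [Spindle X] (A : SpindleAction R X M) (y : X) (L : ℕ) :
    Chain X M L →ₗ[R] Chain X M L :=
  Finsupp.lsum R fun x => Finsupp.lsingle (fun i => Spindle.op (x i) y) ∘ₗ A.act y

/-- Appending `y` at the right end of a sequence. -/
noncomputable def consL (R : Type*) {X M : Type*} [CommRing R] [AddCommGroup M] [Module R M]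
    (y : X) (L : ℕ) : Chain X M L →ₗ[R] Chain X M (L + 1) :=
  Finsupp.lmapDomain M R (Fin.cons (α := fun _ => X) y)


lemma faceSeq_succ_cons (op : X → X → X) {n : ℕ} (i : Fin (n + 1)) (y : X)
    (x : Fin (n + 1) → X) :
    faceSeq op i.succ (Fin.cons y x : Fin (n + 2) → X) = Fin.cons y (faceSeq op i x) := by
  funext j
  refine Fin.cases ?_ (fun j => ?_) j
  · simp [faceSeq]
  · simp [faceSeq]

lemma face_succ_consL (op : X → X → X) (act : X → M →ₗ[R] M) {n : ℕ} (i : Fin (n + 1)) (y : X)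
    (c : Chain X M (n + 1)) :
    face op act i.succ (consL R y _ c) = consL R y _ (face op act i c) := by
  induction c using Finsupp.induction_linear with
  | zero => simp
  | add f g hf hg => simp only [map_add, hf, hg]
  | single x m => simp [face, consL, Finsupp.mapDomain_single, faceSeq_succ_cons]

lemma face_zero_consL_triv {n : ℕ} (y : X) (c : Chain X M n) :
    face (fun x _ => x) (fun _ => (LinearMap.id : M →ₗ[R] M)) 0 (consL R y _ c) = c := by
  induction c using Finsupp.induction_linear with
  | zero => simp
  | add f g hf hg => simp only [map_add, hf, hg]
  | single x m =>
    have : faceSeq (fun x _ => x) 0 (Fin.cons y x : Fin (n + 1) → X) = x := by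
      funext j; simp [faceSeq]
    simp [face, consL, Finsupp.mapDomain_single, this]

lemma chain_cons_induction {L : ℕ} {P : Chain X M (L + 1) → Prop} (h0 : P 0)
    (ha : ∀ c d, P c → P d → P (c + d)) (hc : ∀ y c, P (consL R y L c)) (c) : P c := by
  induction c using Finsupp.induction_linear with
  | zero => exact h0
  | add f g hf hg => exact ha _ _ hf hg
  | single x m =>
    have := hc (x 0) (Finsupp.single (Fin.tail x) m)
    simpa [consL, Finsupp.mapDomain_single] using this

variable [Spindle X]

lemma face_zero_consL (A : SpindleAction R X M) {n : ℕ} (y : X) (c : Chain X M n) :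
    face Spindle.op A.act 0 (consL R y _ c) = diagAct A y n c := by
  induction c using Finsupp.induction_linear with
  | zero => simp
  | add f g hf hg => simp only [map_add, hf, hg]
  | single x m =>
    have : faceSeq Spindle.op 0 (Fin.cons y x : Fin (n + 1) → X)
        = fun i => Spindle.op (x i) y := by
      funext j; simp [faceSeq]
    simp [face, diagAct, consL, Finsupp.mapDomain_single, this]

lemma rackD_zero_consL (A : SpindleAction R X M) (y : X) (c : Chain X M 0) :
    rackD A 0 (consL R y _ c) = c - diagAct A y 0 c := by
  simp [rackD, oneTermD, face_zero_consL_triv, face_zero_consL]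

lemma rackD_succ_consL (A : SpindleAction R X M) (n : ℕ) (y : X) (c : Chain X M (n + 1)) :
    rackD A (n + 1) (consL R y _ c)
      = consL R y _ (rackD A n c) + (-1 : R) ^ (n + 1) • (c - diagAct A y _ c) := by
  have key : ∀ (op : X → X → X) (act : X → M →ₗ[R] M),
      oneTermD op act (n + 1) (consL R y _ c)
        = (-1 : R) ^ (n + 1) • face op act 0 (consL R y _ c)
          + consL R y _ (oneTermD op act n c) := by
    intro op act
    rw [oneTermD, Fin.sum_univ_succ, oneTermD]
    simp only [LinearMap.add_apply, LinearMap.sum_apply, LinearMap.smul_apply, face_succ_consL,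
      map_sum, map_smul, Fin.val_zero, Fin.val_succ, Nat.sub_zero, Nat.add_sub_add_right]
  simp only [rackD, LinearMap.sub_apply, key, face_zero_consL_triv, face_zero_consL, map_sub,
    smul_sub]
  abel

lemma diagAct_consL (A : SpindleAction R X M) (y z : X) (L : ℕ) (c : Chain X M L) :
    diagAct A z _ (consL R y _ c) = consL R (Spindle.op y z) _ (diagAct A z _ c) := by
  induction c using Finsupp.induction_linear with
  | zero => simp
  | add f g hf hg => simp only [map_add, hf, hg]
  | single x m =>
    have : (fun i => Spindle.op ((Fin.cons y x : Fin (L + 1) → X) i) z)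
        = Fin.cons (Spindle.op y z) (fun i => Spindle.op (x i) z) := by
      funext j
      refine Fin.cases ?_ (fun j => ?_) j <;> simp
    simp [diagAct, consL, Finsupp.mapDomain_single, this]

lemma diagAct_diagAct (A : SpindleAction R X M) (y z : X) (L : ℕ) (c : Chain X M L) :
    diagAct A z _ (diagAct A y _ c) = diagAct A (Spindle.op y z) _ (diagAct A z _ c) := by
  induction c using Finsupp.induction_linear with
  | zero => simp
  | add f g hf hg => simp only [map_add, hf, hg]
  | single x m =>
    simp [diagAct, A.act_act y z m, fun i => Spindle.op_distrib (x i) y z]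

lemma rackD_diagAct (A : SpindleAction R X M) (z : X) (L : ℕ) (c : Chain X M (L + 1)) :
    rackD A L (diagAct A z _ c) = diagAct A z _ (rackD A L c) := by
  induction L with
  | zero =>
    revert c
    refine chain_cons_induction (R := R) ?_ (fun c d hc hd => ?_) (fun y c => ?_)
    · simp
    · simp only [map_add, hc, hd]
    rw [diagAct_consL, rackD_zero_consL, rackD_zero_consL, map_sub, diagAct_diagAct A y z]
  | succ L ih =>
    revert c
    refine chain_cons_induction (R := R) ?_ (fun c d hc hd => ?_) (fun y c => ?_)
    · simp
    · simp only [map_add, hc, hd]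
    rw [diagAct_consL, rackD_succ_consL, rackD_succ_consL, map_add, diagAct_consL, ih,
      map_smul, map_sub, diagAct_diagAct A y z]

lemma rackD_rackD (A : SpindleAction R X M) (L : ℕ) (c : Chain X M (L + 2)) :
    rackD A L (rackD A (L + 1) c) = 0 := by
  induction L with
  | zero =>
    revert c
    refine chain_cons_induction (R := R) ?_ (fun c d hc hd => ?_) (fun y c => ?_)
    · simp
    · simp only [map_add, hc, hd, add_zero]
    rw [rackD_succ_consL, map_add, rackD_zero_consL, map_smul, map_sub, rackD_diagAct]
    simp
  | succ L ih =>
    revert c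
    refine chain_cons_induction (R := R) ?_ (fun c d hc hd => ?_) (fun y c => ?_)
    · simp
    · simp only [map_add, hc, hd, add_zero]
    rw [rackD_succ_consL, map_add, rackD_succ_consL, ih, map_smul, map_sub, rackD_diagAct,
      pow_succ (-1 : R) (L + 1)]
    simp

end Differential

section Degenerate

/-- `x` has a repetition `x_i = x_{i+1}` for some `i`. -/
def IsRep {X : Type*} {L : ℕ} (x : Fin L → X) : Prop :=
  ∃ i j : Fin L, (j : ℕ) = i + 1 ∧ x i = x j

/-- `x` has a repetition `x_i = x_{i+1}` for some `i ≤ p`. -/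
def IsRepLE {X : Type*} {L : ℕ} (p : ℕ) (x : Fin L → X) : Prop :=
  ∃ i j : Fin L, (j : ℕ) = i + 1 ∧ (i : ℕ) ≤ p ∧ x i = x j

variable (R X M : Type*) [CommRing R] [AddCommGroup M] [Module R M]

/-- The span of all `m ⊗ x` with `x` a sequence of length `L` that has a repetition;
`CD_n(M;X)` is `degen R X M (n + 1)`. -/
noncomputable def degen (L : ℕ) : Submodule R (Chain X M L) :=
  Finsupp.supported M R {x | IsRep x}

/-- The span of all `m ⊗ x` with `x` a sequence of length `L` that has a repetition
`x_i = x_{i+1}` with `i ≤ p`; `F^p_n` is `filt R X M p (n + 1)`. -/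
noncomputable def filt (p L : ℕ) : Submodule R (Chain X M L) :=
  Finsupp.supported M R {x | IsRepLE p x}

variable {R X M}

lemma single_mem_filt {p L : ℕ} {x : Fin L → X} (h : IsRepLE p x) (m : M) :
    Finsupp.single x m ∈ filt R X M p L :=
  Finsupp.single_mem_supported R m h

lemma single_mem_degen {L : ℕ} {x : Fin L → X} (h : IsRep x) (m : M) :
    Finsupp.single x m ∈ degen R X M L :=
  Finsupp.single_mem_supported R m h

lemma degen_le {L : ℕ} {N : Submodule R (Chain X M L)}
    (h : ∀ x m, IsRep x → Finsupp.single x m ∈ N) : degen R X M L ≤ N := by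
  intro c hc
  rw [← Finsupp.sum_single c]
  exact Submodule.sum_mem _ fun x hx => h x _ (hc hx)

lemma filt_le {p L : ℕ} {N : Submodule R (Chain X M L)}
    (h : ∀ x m, IsRepLE p x → Finsupp.single x m ∈ N) : filt R X M p L ≤ N := by
  intro c hc
  rw [← Finsupp.sum_single c]
  exact Submodule.sum_mem _ fun x hx => h x _ (hc hx)

lemma IsRep.cons {L : ℕ} {x : Fin L → X} (h : IsRep x) (y : X) :
    IsRep (Fin.cons y x : Fin (L + 1) → X) := by
  obtain ⟨i, j, hij, hx⟩ := h
  exact ⟨i.succ, j.succ, by simp [hij], by simpa using hx⟩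

lemma IsRep.snoc {L : ℕ} {x : Fin L → X} (h : IsRep x) (y : X) :
    IsRep (Fin.snoc x y : Fin (L + 1) → X) := by
  obtain ⟨i, j, hij, hx⟩ := h
  exact ⟨i.castSucc, j.castSucc, by simp [hij], by simpa using hx⟩

lemma IsRepLE.cons {p L : ℕ} {x : Fin L → X} (h : IsRepLE p x) (y : X) :
    IsRepLE (p + 1) (Fin.cons y x : Fin (L + 1) → X) := by
  obtain ⟨i, j, hij, hp, hx⟩ := h
  exact ⟨i.succ, j.succ, by simp [hij], by simpa using hp, by simpa using hx⟩

lemma IsRepLE.mono {p q L : ℕ} {x : Fin L → X} (h : IsRepLE p x) (hpq : p ≤ q) :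
    IsRepLE q x := by
  obtain ⟨i, j, hij, hp, hx⟩ := h
  exact ⟨i, j, hij, hp.trans hpq, hx⟩

lemma isRep_iff {L : ℕ} {x : Fin L → X} : IsRep x ↔ IsRepLE L x :=
  ⟨fun ⟨i, j, h, hx⟩ => ⟨i, j, h, i.2.le, hx⟩, fun ⟨i, j, h, _, hx⟩ => ⟨i, j, h, hx⟩⟩

lemma IsRep.diag [Spindle X] {L : ℕ} {x : Fin L → X} (h : IsRep x) (y : X) :
    IsRep (fun i => Spindle.op (x i) y) := by
  obtain ⟨i, j, hij, hx⟩ := h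
  exact ⟨i, j, hij, by simp only [hx]⟩

lemma IsRepLE.diag [Spindle X] {p L : ℕ} {x : Fin L → X} (h : IsRepLE p x) (y : X) :
    IsRepLE p (fun i => Spindle.op (x i) y) := by
  obtain ⟨i, j, hij, hp, hx⟩ := h
  exact ⟨i, j, hij, hp, by simp only [hx]⟩

lemma degen_eq_filt (L : ℕ) : degen R X M L = filt R X M L L := by
  simp only [degen, filt, isRep_iff]

lemma isRepLE_cases {p L : ℕ} {x : Fin (L + 1) → X} (h : IsRepLE p x) :
    (∃ q, p = q + 1 ∧ IsRepLE q (Fin.tail x)) ∨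
      (∃ L', ∃ hL : L = L' + 1, x 0 = x ⟨1, by omega⟩) := by
  obtain ⟨i, j, hij, hp, hx⟩ := h
  rcases Nat.eq_zero_or_pos (i : ℕ) with hi | hi
  · right
    refine ⟨L - 1, by omega, ?_⟩
    have h1 : i = 0 := Fin.ext hi
    have h2 : j = ⟨1, by omega⟩ := Fin.ext (by simp [hij, hi])
    rw [← h1, ← h2, hx]
  · left
    refine ⟨p - 1, by omega, ⟨i - 1, by omega⟩, ⟨j - 1, by omega⟩, ?_, ?_, ?_⟩
    · simp only []; omega
    · simp only []; omega
    · have h1 : (⟨i - 1, by omega⟩ : Fin L).succ = i := Fin.ext (by simp; omega)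
      have h2 : (⟨j - 1, by omega⟩ : Fin L).succ = j := Fin.ext (by simp; omega)
      simp only [Fin.tail, h1, h2, hx]

lemma consL_single (y : X) {L : ℕ} (x : Fin L → X) (m : M) :
    consL R y L (Finsupp.single x m) = Finsupp.single (Fin.cons y x : Fin (L + 1) → X) m := by
  simp [consL, Finsupp.mapDomain_single]

lemma consL_mem_filt {p L : ℕ} {c : Chain X M L} (h : c ∈ filt R X M p L) (y : X) :
    consL R y L c ∈ filt R X M (p + 1) (L + 1) := by
  refine (filt_le (N := (filt R X M (p + 1) (L + 1)).comap (consL R y L)) fun x m hx => ?_) h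
  rw [Submodule.mem_comap, consL_single]
  exact single_mem_filt (hx.cons y) m

lemma consL_consL_mem_filt (p : ℕ) {L : ℕ} (c : Chain X M L) (y : X) :
    consL R y _ (consL R y _ c) ∈ filt R X M p (L + 2) := by
  induction c using Finsupp.induction_linear with
  | zero => simp
  | add f g hf hg => simp only [map_add]; exact Submodule.add_mem _ hf hg
  | single x m =>
    rw [consL_single, consL_single]
    exact single_mem_filt ⟨0, 1, by simp, by simp, by rfl⟩ m

lemma diagAct_mem_filt [Spindle X] (A : SpindleAction R X M) {p L : ℕ} {c : Chain X M L}
    (h : c ∈ filt R X M p L) (y : X) : diagAct A y L c ∈ filt R X M p L := by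
  refine (filt_le (N := (filt R X M p L).comap (diagAct A y L)) fun x m hx => ?_) h
  simpa [diagAct] using single_mem_filt (hx.diag y) _

lemma filt_mono {p q : ℕ} (h : p ≤ q) (L : ℕ) : filt R X M p L ≤ filt R X M q L :=
  filt_le fun _ m hx => single_mem_filt (hx.mono h) m

/-- The differential preserves each `F^p`. -/
lemma rackD_mem_filt [Spindle X] (A : SpindleAction R X M) {p L : ℕ} {c : Chain X M (L + 1)}
    (h : c ∈ filt R X M p (L + 1)) : rackD A L c ∈ filt R X M p L := by
  induction L generalizing p with
  | zero =>
    refine (filt_le (N := (filt R X M p 0).comap (rackD A 0)) fun x m hx => ?_) h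
    obtain ⟨i, j, hij, -⟩ := hx
    omega
  | succ L ih =>
    refine (filt_le (N := (filt R X M p (L + 1)).comap (rackD A (L + 1))) fun x m hx => ?_) h
    rw [Submodule.mem_comap]
    rcases isRepLE_cases hx with ⟨q, rfl, hq⟩ | ⟨L', hL, h01⟩
    · have h1 : Finsupp.single (Fin.tail x) m ∈ filt R X M q (L + 1) := single_mem_filt hq m
      have h2 : Finsupp.single x m = consL R (x 0) _ (Finsupp.single (Fin.tail x) m) := by
        rw [consL_single, Fin.cons_self_tail]
      rw [h2, rackD_succ_consL]
      refine Submodule.add_mem _ (consL_mem_filt (ih h1) _) (Submodule.smul_mem _ _ ?_)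
      exact filt_mono (Nat.le_succ q) _ (Submodule.sub_mem _ h1 (diagAct_mem_filt A h1 _))
    · obtain rfl : L = L' := by omega
      have h2 : Finsupp.single x m
          = consL R (x 0) _ (consL R (x 0) _ (Finsupp.single (Fin.tail (Fin.tail x)) m)) := by
        have h3 : x 0 = Fin.tail x 0 := h01
        rw [consL_single, consL_single]
        congr 1
        conv_rhs => enter [2]; rw [h3]
        rw [Fin.cons_self_tail, Fin.cons_self_tail]
      rw [h2, rackD_succ_consL, diagAct_consL, Spindle.op_self]
      cases L with
      | zero =>
        rw [rackD_zero_consL]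
        simp
      | succ L =>
        rw [rackD_succ_consL, map_add, map_smul, map_sub, pow_succ (-1 : R) (L + 1),
          mul_neg_one, neg_smul, add_neg_cancel_right]
        exact consL_consL_mem_filt p _ _

lemma rackD_mem_degen [Spindle X] (A : SpindleAction R X M) {L : ℕ} {c : Chain X M (L + 1)}
    (h : c ∈ degen R X M (L + 1)) : rackD A L c ∈ degen R X M L := by
  rw [degen_eq_filt] at h
  have := rackD_mem_filt A h
  revert this
  refine fun hc => filt_le (fun x m hx => single_mem_degen ?_ m) hc
  obtain ⟨i, j, h, -, h'⟩ := hx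
  exact ⟨i, j, h, h'⟩

end Degenerate

section Complexes

open CategoryTheory

variable {R X M : Type u} [CommRing R] [AddCommGroup M] [Module R M]

/-- The augmented complex `Ĉ(M;X, ∂^R)`, shifted so that the object of index `k` is `Ĉ_{k-1}`. -/
noncomputable def augComplex [Spindle X] (A : SpindleAction R X M) : ChainComplex (ModuleCat.{u} R) ℕ :=
  ChainComplex.of (fun k => ModuleCat.of R (Chain X M k)) (fun k => ModuleCat.ofHom (rackD A k))
    fun k => by
      ext1
      exact LinearMap.ext fun c => rackD_rackD A k c

/-- The differential of `CD(M;X)`. -/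
noncomputable def degenD [Spindle X] (A : SpindleAction R X M) (n : ℕ) :
    degen R X M (n + 2) →ₗ[R] degen R X M (n + 1) :=
  (rackD A (n + 1)).restrict fun _ h => rackD_mem_degen A h

/-- The degenerate complex `CD(M;X, ∂^R)`. -/
noncomputable def degenComplex [Spindle X] (A : SpindleAction R X M) : ChainComplex (ModuleCat.{u} R) ℕ :=
  ChainComplex.of (fun n => ModuleCat.of R (degen R X M (n + 1)))
    (fun n => ModuleCat.ofHom (degenD A n)) fun n => by
      ext1
      exact LinearMap.ext fun c => Subtype.ext (rackD_rackD A (n + 1) c.1)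

variable (R X) in
/-- `CN_p(X) = C_p(X) / CD_p(X)`. -/
abbrev Norm (p : ℕ) : Type u := Chain X R (p + 1) ⧸ degen R X R (p + 1)

variable (R X) in
/-- The differential `CN_{p+1}(X) → CN_p(X)` induced by `∂^R`. -/
noncomputable def normD [Spindle X] (p : ℕ) : Norm R X (p + 1) →ₗ[R] Norm R X p :=
  Submodule.mapQ _ _ (rackD (SpindleAction.trivial R X) (p + 1)) fun _ h => rackD_mem_degen _ h

lemma normD_normD [Spindle X] (p : ℕ) (c : Norm R X (p + 2)) : normD R X p (normD R X (p + 1) c) = 0 := by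
  obtain ⟨c, rfl⟩ := Submodule.Quotient.mk_surjective _ c
  simp only [normD, Submodule.mapQ_apply, rackD_rackD, Submodule.Quotient.mk_zero]

variable (R X) in
/-- The normalized complex `CN(X, ∂^R)`. -/
noncomputable def normComplex [Spindle X] : ChainComplex (ModuleCat.{u} R) ℕ :=
  ChainComplex.of (fun p => ModuleCat.of R (Norm R X p)) (fun p => ModuleCat.ofHom (normD R X p))
    fun p => by
      ext1
      exact LinearMap.ext fun c => normD_normD p c

/-- Pairs `(k, p)` with `p + q = n`, where `q = k + 1` (so `q - 2 = k - 1`). These index the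
summands of degree `n` of the total complex, since `Ĉ_{q-2} = 0` for `q < 1`. -/
abbrev TotIdx (n : ℕ) : Type := {a : ℕ × ℕ // a.1 + a.2 + 1 = n}

variable (R X M) in
/-- `B_{pq}(M;X) = Ĉ_{q-2}(M;X) ⊗ CN_p(X)` with `q = k + 1`. -/
abbrev Bi (k p : ℕ) : Type u := Chain X M k ⊗[R] Norm R X p

variable (R X M) in
/-- `Tot_n B = ⨁_{p+q=n} B_{pq}`. -/
abbrev TotMod (n : ℕ) : Type u := DirectSum (TotIdx n) fun i => Bi R X M i.1.1 i.1.2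

variable (R X M) in
/-- The inclusion of the summand `B_{pq}` of `Tot_n B`. -/
noncomputable abbrev totIncl {n : ℕ} (i : TotIdx n) : Bi R X M i.1.1 i.1.2 →ₗ[R] TotMod R X M n :=
  DirectSum.lof R (TotIdx n) (fun i => Bi R X M i.1.1 i.1.2) i

/-- The component `a ⊗ b ↦ ∂a ⊗ b` of the total differential on `B_{pq}`. -/
noncomputable def totD₁ [Spindle X] (A : SpindleAction R X M) {n : ℕ} :
    (k p : ℕ) → (k + p + 1 = n + 1) → (Bi R X M k p →ₗ[R] TotMod R X M n)
  | 0, _, _ => 0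
  | k + 1, p, h => totIncl R X M ⟨(k, p), by omega⟩ ∘ₗ (rackD A k).rTensor (Norm R X p)

variable (R X M) in
/-- The component `a ⊗ b ↦ a ⊗ ∂b` of the total differential on `B_{pq}`. -/
noncomputable def totD₂ [Spindle X] {n : ℕ} :
    (k p : ℕ) → (k + p + 1 = n + 1) → (Bi R X M k p →ₗ[R] TotMod R X M n)
  | _, 0, _ => 0
  | k, p + 1, h => totIncl R X M ⟨(k, p), by omega⟩ ∘ₗ (normD R X p).lTensor (Chain X M k)

/-- The total differential `a ⊗ b ↦ ∂a ⊗ b + σ (-1)^q a ⊗ ∂b` on `B_{pq}`, where `q = k + 1` and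
`σ = ±1` is a choice of sign convention. -/
noncomputable def totD [Spindle X] (A : SpindleAction R X M) (σ : ℤˣ) (n : ℕ) :
    TotMod R X M (n + 1) →ₗ[R] TotMod R X M n :=
  DirectSum.toModule R _ _ fun i =>
    totD₁ A i.1.1 i.1.2 i.2 + (σ * (-1) ^ (i.1.1 + 1)) • totD₂ R X M i.1.1 i.1.2 i.2

lemma totD_totIncl [Spindle X] (A : SpindleAction R X M) (σ : ℤˣ) {n k p : ℕ} (h : k + p + 1 = n + 1)
    (z : Bi R X M k p) :
    totD A σ n (totIncl R X M ⟨(k, p), h⟩ z)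
      = totD₁ A k p h z + (σ * (-1) ^ (k + 1)) • totD₂ R X M k p h z := by
  rw [totD, DirectSum.toModule_lof]
  rfl

lemma totD₁_rackD [Spindle X] (A : SpindleAction R X M) {n k p : ℕ} (h : k + p + 1 = n + 1)
    (a : Chain X M (k + 1)) (b : Norm R X p) : totD₁ A k p h (rackD A k a ⊗ₜ b) = 0 := by
  cases k with
  | zero => rfl
  | succ k =>
    change totIncl R X M ⟨(k, p), _⟩ (rackD A k (rackD A (k + 1) a) ⊗ₜ b) = 0
    rw [rackD_rackD, zero_tmul, map_zero]

lemma totD₂_normD [Spindle X] {n k p : ℕ} (h : k + p + 1 = n + 1)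
    (a : Chain X M k) (b : Norm R X (p + 1)) : totD₂ R X M k p h (a ⊗ₜ normD R X p b) = 0 := by
  cases p with
  | zero => rfl
  | succ p =>
    change totIncl R X M ⟨(k, p), _⟩ (a ⊗ₜ normD R X p (normD R X (p + 1) b)) = 0
    rw [normD_normD, tmul_zero, map_zero]

lemma totD₂_totD₁ [Spindle X] (A : SpindleAction R X M) {n k p : ℕ} (h : k + (p + 1) + 1 = n + 1)
    (h' : k + 1 + p + 1 = n + 1) (a : Chain X M (k + 1)) (b : Norm R X (p + 1)) :
    totD₂ R X M k (p + 1) h (rackD A k a ⊗ₜ b) = totD₁ A (k + 1) p h' (a ⊗ₜ normD R X p b) := rfl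

lemma totD_totD [Spindle X] (A : SpindleAction R X M) (σ : ℤˣ) (n : ℕ) :
    totD A σ n ∘ₗ totD A σ (n + 1) = 0 := by
  refine DirectSum.linearMap_ext R fun ⟨⟨k, p⟩, h⟩ => TensorProduct.ext' fun a b => ?_
  have h' : k + p + 1 = n + 1 + 1 := h
  change totD A σ n (totD A σ (n + 1) (totIncl R X M ⟨(k, p), h⟩ (a ⊗ₜ b))) = 0
  have hs : ∀ (s : ℤˣ) (v : TotMod R X M (n + 1)), totD A σ n (s • v) = s • totD A σ n v :=
    fun s v => by rw [Units.smul_def, map_zsmul, ← Units.smul_def]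
  rw [totD_totIncl, map_add, hs]
  have e₁ : ∀ (k : ℕ) (h : k + 1 + p + 1 = n + 1 + 1) (a : Chain X M (k + 1)) (b : Norm R X p),
      totD A σ n (totD₁ A (k + 1) p h (a ⊗ₜ b))
        = (σ * (-1) ^ (k + 1)) • totD₂ R X M k p (by omega) (rackD A k a ⊗ₜ b) :=
    fun k h a b => by
      change totD A σ n (totIncl R X M ⟨(k, p), _⟩ (rackD A k a ⊗ₜ b)) = _
      rw [totD_totIncl, totD₁_rackD, zero_add]
  have e₂ : ∀ (p : ℕ) (h : k + (p + 1) + 1 = n + 1 + 1) (a : Chain X M k) (b : Norm R X (p + 1)),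
      totD A σ n (totD₂ R X M k (p + 1) h (a ⊗ₜ b))
        = totD₁ A k p (by omega) (a ⊗ₜ normD R X p b) :=
    fun p h a b => by
      change totD A σ n (totIncl R X M ⟨(k, p), _⟩ (a ⊗ₜ normD R X p b)) = _
      rw [totD_totIncl, totD₂_normD, smul_zero, add_zero]
  have z₁ : ∀ (p : ℕ) (h : 0 + p + 1 = n + 1) (z), totD₁ A 0 p h z = 0 := fun _ _ _ => rfl
  have z₁' : ∀ (p : ℕ) (h : 0 + p + 1 = n + 1 + 1) (z), totD₁ A 0 p h z = 0 := fun _ _ _ => rfl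
  have z₂ : ∀ (k : ℕ) (h : k + 0 + 1 = n + 1) (z), totD₂ R X M k 0 h z = 0 := by
    intro k _ _; cases k <;> rfl
  have z₂' : ∀ (k : ℕ) (h : k + 0 + 1 = n + 1 + 1) (z), totD₂ R X M k 0 h z = 0 := by
    intro k _ _; cases k <;> rfl
  rcases k with _ | k <;> rcases p with _ | p
  · rw [z₁', z₂', map_zero, smul_zero, add_zero]
  · rw [z₁', e₂, z₁, map_zero, smul_zero, add_zero]
  · rw [e₁, z₂, z₂', map_zero, smul_zero, smul_zero, add_zero]
  · rw [e₁, e₂, totD₂_totD₁ A (h' := by omega), pow_succ (-1 : ℤˣ) (k + 1), mul_neg_one,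
      mul_neg, Units.neg_smul, add_neg_cancel]

/-- The total complex of `B(M;X)`. -/
noncomputable def totComplex [Spindle X] (A : SpindleAction R X M) (σ : ℤˣ) :
    ChainComplex (ModuleCat.{u} R) ℕ :=
  ChainComplex.of (fun n => ModuleCat.of R (TotMod R X M n)) (fun n => ModuleCat.ofHom (totD A σ n))
    fun n => by
      ext1
      exact totD_totD A σ n

/-- The splitting `α : CN(X) → C(X)` on sequences,
`α(x_p, …, x_0) = (x_p, x_{p-1} - x_p, …, x_0 - x_1)` in multilinear notation. -/
noncomputable def alphaSeq (R : Type*) {X : Type*} [CommRing R] :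
    (p : ℕ) → (Fin (p + 1) → X) → Chain X R (p + 1)
  | 0, x => Finsupp.single x 1
  | p + 1, x => consL R (x 0) _ (alphaSeq R p (Fin.tail x))
      - consL R (x 1) _ (alphaSeq R p (Fin.tail x))

lemma alphaSeq_eq_zero {p : ℕ} {x : Fin (p + 1) → X} (h : IsRep x) : alphaSeq R p x = 0 := by
  induction p with
  | zero =>
    obtain ⟨i, j, hij, -⟩ := h
    omega
  | succ p ih =>
    rcases isRepLE_cases (isRep_iff.1 h) with ⟨q, -, i, j, hij, -, hx⟩ | ⟨L, hL, h01⟩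
    · simp [alphaSeq, ih ⟨i, j, hij, hx⟩]
    · have h01 : x 0 = x 1 := h01
      simp [alphaSeq, h01]

variable (R X) in
/-- The splitting `α_p : CN_p(X) → C_p(X)`. -/
noncomputable def alpha (p : ℕ) : Norm R X p →ₗ[R] Chain X R (p + 1) :=
  (degen R X R (p + 1)).liftQ (Finsupp.lsum R fun x => LinearMap.toSpanSingleton R _ (alphaSeq R p x))
    (degen_le fun x r hx => by simp [alphaSeq_eq_zero hx])

/-- Doubling of the left-most element, `(x_p, …, x_0) ↦ (x_p, x_p, …, x_0)`. -/
def doubleSeq {X : Type*} {p : ℕ} (x : Fin (p + 1) → X) : Fin (p + 2) → X :=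
  Fin.snoc (α := fun _ => X) x (x (Fin.last p))

variable (R X) in
/-- The linear map `C_p(X) → C_{p+1}(X)` that doubles the left-most element. -/
noncomputable def double (p : ℕ) : Chain X R (p + 1) →ₗ[R] Chain X R (p + 2) :=
  Finsupp.lmapDomain R R doubleSeq

/-- The map `u^p` on sequences of length `p + 2`: `u^0 = id` and
`u^p(w, y) = (u^{p-1}(w), y) + (-1)^p (y, u^{p-1}(w ⋆ y))`, with `y` the right-most element. -/
noncomputable def uSeq (R : Type*) {X : Type*} [CommRing R] [Spindle X] :
    (p : ℕ) → (Fin (p + 2) → X) → Chain X R (p + 2)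
  | 0, x => Finsupp.single x 1
  | p + 1, x =>
      Finsupp.lmapDomain R R (fun w => (Fin.cons (x 0) w : Fin (p + 3) → X))
        (uSeq R p (Fin.tail x))
      + (-1 : R) ^ (p + 1) •
        Finsupp.lmapDomain R R (fun w => (Fin.snoc w (x 0) : Fin (p + 3) → X))
          (uSeq R p fun i => Spindle.op (Fin.tail x i) (x 0))

variable (R X) in
/-- The map `u^p : C_{p+1}(X) → C_{p+1}(X)`. -/
noncomputable def uMap [Spindle X] (p : ℕ) : Chain X R (p + 2) →ₗ[R] Chain X R (p + 2) :=
  Finsupp.lsum R fun x => LinearMap.toSpanSingleton R _ (uSeq R p x)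

lemma uSeq_mem [Spindle X] {p : ℕ} {x : Fin (p + 2) → X} (h : x (Fin.last p).castSucc = x (Fin.last (p + 1))) :
    uSeq R p x ∈ degen R X R (p + 2) := by
  induction p with
  | zero => exact single_mem_degen ⟨0, 1, by simp, h⟩ 1
  | succ p ih =>
    have hc : ∀ f : (Fin (p + 2) → X) → (Fin (p + 3) → X), (∀ w, IsRep w → IsRep (f w)) →
        degen R X R (p + 2) ≤ (degen R X R (p + 3)).comap (Finsupp.lmapDomain R R f) :=
      fun f hf => degen_le fun w r hw => by
        simpa [Finsupp.mapDomain_single] using single_mem_degen (hf w hw) r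
    have ht : Fin.tail x (Fin.last p).castSucc = Fin.tail x (Fin.last (p + 1)) := h
    refine Submodule.add_mem _ (hc _ (fun w hw => hw.cons _) (ih ht))
      (Submodule.smul_mem _ _ (hc _ (fun w hw => hw.snoc _) (ih ?_)))
    simp only [ht]

variable (R X) in
/-- The map `σ^p u^p ∘ double ∘ α_p : CN_p(X) → CD_{p+1}(X)`; the doubling with the sign
`(-1)^p` is the map `s_p`. -/
noncomputable def rightPart [Spindle X] (σ : ℤˣ) (p : ℕ) : Norm R X p →ₗ[R] degen R X R (p + 2) :=
  σ ^ p • LinearMap.codRestrict _ (uMap R X p ∘ₗ double R X p ∘ₗ alpha R X p) fun c => by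
    rw [LinearMap.comp_apply, LinearMap.comp_apply]
    generalize alpha R X p c = d
    induction d using Finsupp.induction_linear with
    | zero => simp
    | add f g hf hg => simp only [map_add]; exact Submodule.add_mem _ hf hg
    | single x r =>
      have h : uSeq R p (doubleSeq x) ∈ degen R X R (p + 2) := by
        refine uSeq_mem ?_
        simp [doubleSeq]
      simpa [uMap, double, Finsupp.mapDomain_single] using Submodule.smul_mem _ r h

/-- Concatenation `(a, w)` of a sequence `a` of length `k` with a sequence `w` of length `p + 2`
to its right. -/
def glueSeq {X : Type*} {k p n : ℕ} (h : k + p + 1 = n) (a : Fin k → X) (w : Fin (p + 2) → X) :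
    Fin (n + 1) → X :=
  fun i => if hi : (i : ℕ) < p + 2 then w ⟨i, hi⟩ else a ⟨i - (p + 2), by omega⟩

lemma glueSeq_isRep {X : Type*} {k p n : ℕ} (h : k + p + 1 = n) (a : Fin k → X)
    {w : Fin (p + 2) → X} (hw : IsRep w) : IsRep (glueSeq h a w) := by
  obtain ⟨i, j, hij, hx⟩ := hw
  exact ⟨⟨i, by omega⟩, ⟨j, by omega⟩, hij, by simpa [glueSeq] using hx⟩

variable (R X M) in
/-- The bilinear map `(m ⊗ a, r ⊗ w) ↦ r m ⊗ (a, w)`. -/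
noncomputable def glue {k p n : ℕ} (h : k + p + 1 = n) :
    Chain X M k →ₗ[R] Chain X R (p + 2) →ₗ[R] Chain X M (n + 1) :=
  Finsupp.lsum R fun a => LinearMap.flip <| Finsupp.lsum R fun w =>
    (LinearMap.lsmul R (Chain X M (n + 1))).compl₂ (Finsupp.lsingle (glueSeq h a w))

lemma glue_single_single {k p n : ℕ} (h : k + p + 1 = n) (a : Fin k → X) (m : M)
    (w : Fin (p + 2) → X) (r : R) :
    glue R X M h (Finsupp.single a m) (Finsupp.single w r)
      = Finsupp.single (glueSeq h a w) (r • m) := by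
  simp [glue]

lemma glue_mem {k p n : ℕ} (h : k + p + 1 = n) (c : Chain X M k) {d : Chain X R (p + 2)}
    (hd : d ∈ degen R X R (p + 2)) : glue R X M h c d ∈ degen R X M (n + 1) := by
  induction c using Finsupp.induction_linear with
  | zero => simp
  | add f g hf hg => simp only [map_add, LinearMap.add_apply]; exact Submodule.add_mem _ hf hg
  | single a m =>
    refine (degen_le (N := (degen R X M (n + 1)).comap (glue R X M h (Finsupp.single a m)))
      fun w r hw => ?_) hd
    rw [Submodule.mem_comap, glue_single_single]
    exact single_mem_degen (glueSeq_isRep h a hw) _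

variable (R X M) in
/-- The component `𝓔^p : B_{pq} → CD_{p+q}(M;X)`, `a ⊗ b ↦ (a, σ^p u^p(double(α_p b)))`. -/
noncomputable def EComp [Spindle X] (σ : ℤˣ) {n : ℕ} (i : TotIdx n) :
    Bi R X M i.1.1 i.1.2 →ₗ[R] degen R X M (n + 1) :=
  LinearMap.codRestrict _
    (TensorProduct.lift ((glue R X M i.2).compl₂
      ((degen R X R (i.1.2 + 2)).subtype ∘ₗ rightPart R X σ i.1.2)))
    fun c => by
      induction c using TensorProduct.induction_on with
      | zero => simp
      | add f g hf hg => simp only [map_add]; exact Submodule.add_mem _ hf hg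
      | tmul a b => simpa using glue_mem i.2 a (rightPart R X σ i.1.2 b).2

variable (R X M) in
/-- The map `𝓔 : Tot_n B → CD_n(M;X)`. -/
noncomputable def EMap [Spindle X] (σ : ℤˣ) (n : ℕ) : TotMod R X M n →ₗ[R] degen R X M (n + 1) :=
  DirectSum.toModule R _ _ fun i => EComp R X M σ i

variable (R X M) in
/-- The filtration of `Tot B` by columns: `F^p Tot_n B = ⨁_{p' ≤ p} B_{p',n-p'}`. -/
noncomputable def totFilt (p n : ℕ) : Submodule R (TotMod R X M n) :=
  ⨆ i : {i : TotIdx n // i.1.2 ≤ p}, LinearMap.range (totIncl R X M i.1)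

variable (R X M) in
/-- The filtration `F^p_n` of `CD_n(M;X)`, as a submodule of `CD_n(M;X)`. -/
noncomputable def degenFilt (p n : ℕ) : Submodule R (degen R X M (n + 1)) :=
  (filt R X M p (n + 1)).comap (degen R X M (n + 1)).subtype

/-- The homology `Ĥ_{q-2}(M;X, ∂^R)` with `q = k + 1`. -/
noncomputable abbrev augHomology [Spindle X] (A : SpindleAction R X M) (k : ℕ) : ModuleCat.{u} R :=
  (augComplex A).homology k

variable (R X) in
/-- The normalized homology `HN_p(X, ∂^R)`. -/
noncomputable abbrev normHomology [Spindle X] (p : ℕ) : ModuleCat.{u} R := (normComplex R X).homology p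

/-- The degenerate homology `HD_n(M;X, ∂^R)`. -/
noncomputable abbrev degenHomology [Spindle X] (A : SpindleAction R X M) (n : ℕ) : ModuleCat.{u} R :=
  (degenComplex A).homology n

/-- Pairs `(k, p)` with `p + q = n - 1`, where `q = k + 1`. -/
abbrev TorIdx (n : ℕ) : Type := {a : ℕ × ℕ // a.1 + a.2 + 1 + 1 = n}

/-- `⨁_{p+q=n} Ĥ_{q-2}(M;X) ⊗ HN_p(X)`. -/
abbrev TensorPart [Spindle X] (A : SpindleAction R X M) (n : ℕ) : Type u :=
  DirectSum (TotIdx n) fun i => augHomology A i.1.1 ⊗[R] normHomology R X i.1.2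

/-- The inclusion of a summand of `TensorPart`. -/
noncomputable abbrev tensorIncl [Spindle X] (A : SpindleAction R X M) {n : ℕ} (i : TotIdx n) :
    augHomology A i.1.1 ⊗[R] normHomology R X i.1.2 →ₗ[R] TensorPart A n :=
  DirectSum.lof R (TotIdx n) (fun i => augHomology A i.1.1 ⊗[R] normHomology R X i.1.2) i

/-- `⨁_{p+q=n-1} Tor_1(Ĥ_{q-2}(M;X), HN_p(X))`. -/
abbrev TorPart [Spindle X] (A : SpindleAction R X M) (n : ℕ) : Type u :=
  DirectSum (TorIdx n) fun i =>
    ((Tor (ModuleCat.{u} R) 1).obj (augHomology A i.1.1)).obj (normHomology R X i.1.2)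

end Complexes

end SpindleHomology

/-! Write T for the composite of `alpha`, doubling and `uMap` (`twist` below). That 𝓔 is a chain map
rests on one identity, `rackD_constCoeff_twist`: for every module with an action and every
coefficient a, ∂(a ⊗ T b) = -a ⊗ T(∂b), so the action on a leaves no trace. A single coefficient
suffices, because a chain on a concatenated sequence (v, w) is a chain on w whose coefficients are
chains on v, with X acting diagonally (`flatten`, `rackD_flatten_succ`). The identity is proved by
induction on the length. Put V_y c = (T c, y) ± (y, T(c ⋆ y)). The recursions for α and u give T(x,
y) = V_y x - V_{x_0} x. In ∂(a ⊗ V_y c) the two terms with coefficient a ⋆ y cancel, and besides -a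
⊗ V_y(∂c) only ±a ⊗ (T(c ⋆ y) - T c) survives. This remainder is absorbed by the relation T(∂(x,
x_0)) = 0, which holds because (x, x_0) is degenerate.

Bijectivity and compatibility with the filtrations hold because 𝓔 is triangular. T b equals the
doubling of b up to sequences with a repetition further to the right (`twist_sub_double_mem`). The
sequences with x_p = x_{p+1} and no repetition further to the right are exactly those obtained by
putting an arbitrary sequence to the left of a doubled nondegenerate one. So on the graded pieces 𝓔
is, up to sign, a bijection of bases tensored with M.

The second claim is then a Künneth theorem for Ĉ ⊗ CN, where CN is free and Ĉ is arbitrary. Over a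
principal ideal domain the cycles Z and boundaries B of CN are projective, so Tor_1(H, HN) is the
kernel of H ⊗ B → H ⊗ Z (`torEquiv`). To obtain a splitting without assumptions on Ĉ, choose a free
F mapping onto the cycles of Ĉ_k, let G be the kernel of F → H_k, and lift G → F to a map φ₁ from G
to Ĉ_{k+1}: a two-term resolution of H_k that maps to Ĉ. Pairs in G ⊗ Z and F ⊗ B that agree in F ⊗
Z surject onto Tor_1, and each of them gives an actual cycle of the total complex. Together with the
products of cycles they form a module `KunnethData.Src` that surjects both onto the total homology
and onto the sum of the tensor and Tor terms. The two kernels coincide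
(`KunnethData.mem_range_iff`), so the total homology is that direct sum, and the sequence splits. -/

namespace SpindleHomology
open TensorProduct

/-! ### Concatenation of sequences, and chains with chains as coefficients -/

section Flatten

variable {R X M : Type*} [CommRing R] [AddCommGroup M] [Module R M]

/-- Appending `y` at the left end of a sequence. -/
noncomputable def snocL (R : Type*) {X M : Type*} [CommRing R] [AddCommGroup M] [Module R M]
    (y : X) (L : ℕ) : Chain X M L →ₗ[R] Chain X M (L + 1) :=
  Finsupp.lmapDomain M R fun w => (Fin.snoc w y : Fin (L + 1) → X)

lemma snocL_single (y : X) {L : ℕ} (x : Fin L → X) (m : M) :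
    snocL R y L (Finsupp.single x m) = Finsupp.single (Fin.snoc x y : Fin (L + 1) → X) m := by
  simp [snocL, Finsupp.mapDomain_single]

/-- Applying a linear map to the coefficients of a chain. -/
noncomputable def mapCoeff {N : Type*} [AddCommGroup N] [Module R N] (f : M →ₗ[R] N) (L : ℕ) :
    Chain X M L →ₗ[R] Chain X N L :=
  Finsupp.mapRange.linearMap f

@[simp]
lemma mapCoeff_single {N : Type*} [AddCommGroup N] [Module R N] (f : M →ₗ[R] N) {L : ℕ}
    (x : Fin L → X) (m : M) :
    mapCoeff f L (Finsupp.single x m) = Finsupp.single x (f m) := by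
  simp [mapCoeff]

lemma mapCoeff_consL {N : Type*} [AddCommGroup N] [Module R N] (f : M →ₗ[R] N) {L : ℕ}
    (y : X) (c : Chain X M L) :
    mapCoeff f (L + 1) (consL R y L c) = consL R y L (mapCoeff f L c) := by
  induction c using Finsupp.induction_linear with
  | zero => simp
  | add f g hf hg => simp only [map_add, hf, hg]
  | single x m => simp [consL_single]

/-- The chain `a ⊗ w` with constant coefficient `a`. -/
noncomputable def constCoeff (R : Type*) {X M : Type*} [CommRing R] [AddCommGroup M] [Module R M]
    (a : M) (L : ℕ) : Chain X R L →ₗ[R] Chain X M L :=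
  mapCoeff (LinearMap.toSpanSingleton R M a) L

@[simp]
lemma constCoeff_single (a : M) {L : ℕ} (x : Fin L → X) (r : R) :
    constCoeff R a L (Finsupp.single x r) = Finsupp.single x (r • a) := by
  simp [constCoeff]

lemma constCoeff_consL (a : M) {L : ℕ} (y : X) (c : Chain X R L) :
    constCoeff R a (L + 1) (consL R y L c) = consL R y L (constCoeff R a L c) :=
  mapCoeff_consL _ _ _

lemma mapCoeff_constCoeff {N : Type*} [AddCommGroup N] [Module R N] (f : M →ₗ[R] N) (a : M)
    {L : ℕ} (c : Chain X R L) :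
    mapCoeff f L (constCoeff R a L c) = constCoeff R (f a) L c := by
  induction c using Finsupp.induction_linear with
  | zero => simp
  | add f g hf hg => simp only [map_add, hf, hg]
  | single x m => simp

lemma constCoeff_sub (a b : M) {L : ℕ} (c : Chain X R L) :
    constCoeff R (a - b) L c = constCoeff R a L c - constCoeff R b L c := by
  induction c using Finsupp.induction_linear with
  | zero => simp
  | add f g hf hg => simp only [map_add, hf, hg]; abel
  | single x m => simp [smul_sub]

lemma diagAct_single [Spindle X] (A : SpindleAction R X M) (y : X) {L : ℕ} (x : Fin L → X)
    (m : M) : diagAct A y L (Finsupp.single x m)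
      = Finsupp.single (fun i => Spindle.op (x i) y) (A.act y m) := by
  simp [diagAct]

lemma diagAct_trivial_single [Spindle X] (y : X) {L : ℕ} (x : Fin L → X) (r : R) :
    diagAct (SpindleAction.trivial R X) y L (Finsupp.single x r)
      = Finsupp.single (fun i => Spindle.op (x i) y) r :=
  diagAct_single _ _ _ _

lemma diagAct_constCoeff [Spindle X] (A : SpindleAction R X M) (y : X) (a : M) {L : ℕ}
    (c : Chain X R L) :
    diagAct A y L (constCoeff R a L c)
      = constCoeff R (A.act y a) L (diagAct (SpindleAction.trivial R X) y L c) := by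
  induction c using Finsupp.induction_linear with
  | zero => simp
  | add f g hf hg => simp only [map_add, hf, hg]
  | single x m => simp [diagAct_single, SpindleAction.trivial]

/-- The diagonal action of `X` on chains. -/
noncomputable def diagAction [Spindle X] (A : SpindleAction R X M) (k : ℕ) :
    SpindleAction R X (Chain X M k) where
  act y := diagAct A y k
  act_act x y m := diagAct_diagAct A x y k m

/-- Concatenation `(a, w)` of sequences of lengths `k` and `L`, with `w` on the right. -/
def concat {X : Type*} {k L n : ℕ} (h : k + L = n) (a : Fin k → X) (w : Fin L → X) : Fin n → X :=
  fun i => if hi : (i : ℕ) < L then w ⟨i, hi⟩ else a ⟨i - L, by omega⟩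

lemma concat_cons {k L n : ℕ} (h : k + (L + 1) = n + 1) (h' : k + L = n) (a : Fin k → X) (y : X)
    (w : Fin L → X) :
    concat h a (Fin.cons y w : Fin (L + 1) → X) = Fin.cons y (concat h' a w) := by
  funext i
  refine Fin.cases ?_ (fun j => ?_) i
  · simp [concat]
  · by_cases hj : (j : ℕ) < L
    · have : (⟨(j : ℕ) + 1, by omega⟩ : Fin (L + 1)) = Fin.succ ⟨j, hj⟩ := rfl
      rw [Fin.cons_succ, concat, concat, dif_pos (by simpa using hj), dif_pos hj]
      simp only [Fin.val_succ, this, Fin.cons_succ]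
    · simp [concat, hj]

lemma concat_diag [Spindle X] {k L n : ℕ} (h : k + L = n) (a : Fin k → X) (w : Fin L → X) (y : X) :
    (fun i => Spindle.op (concat h a w i) y)
      = concat h (fun i => Spindle.op (a i) y) (fun i => Spindle.op (w i) y) := by
  funext i
  simp only [concat]
  split_ifs <;> rfl

lemma concat_nil {n : ℕ} (h : n + 0 = n) (a : Fin n → X) (w : Fin 0 → X) : concat h a w = a := by
  funext i
  simp [concat]

lemma concat_zero {n : ℕ} (h : 0 + n = n) (a : Fin 0 → X) (w : Fin n → X) : concat h a w = w := by
  funext i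
  simp [concat]

lemma concat_one {n : ℕ} (h : 1 + n = n + 1) (a : Fin 1 → X) (w : Fin n → X) :
    concat h a w = Fin.snoc (α := fun _ => X) w (a 0) := by
  funext i
  refine Fin.lastCases ?_ (fun j => ?_) i
  · simp [concat]
  · simp [concat]

/-- Chains with coefficients in chains, as chains on concatenated sequences. -/
noncomputable def flatten (R X M : Type*) [CommRing R] [AddCommGroup M] [Module R M] {k L n : ℕ}
    (h : k + L = n) : Chain X (Chain X M k) L →ₗ[R] Chain X M n :=
  Finsupp.lsum R fun w => Finsupp.lmapDomain M R fun a => concat h a w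

lemma flatten_single_single {k L n : ℕ} (h : k + L = n) (a : Fin k → X) (w : Fin L → X) (m : M) :
    flatten R X M h (Finsupp.single w (Finsupp.single a m)) = Finsupp.single (concat h a w) m := by
  simp [flatten, Finsupp.mapDomain_single]

lemma chain_chain_induction {k L : ℕ} {P : Chain X (Chain X M k) L → Prop} (h0 : P 0)
    (ha : ∀ c d, P c → P d → P (c + d))
    (hs : ∀ w a m, P (Finsupp.single w (Finsupp.single a m))) (c) : P c := by
  induction c using Finsupp.induction_linear with
  | zero => exact h0
  | add f g hf hg => exact ha _ _ hf hg
  | single w c =>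
    induction c using Finsupp.induction_linear with
    | zero => simpa using h0
    | add f g hf hg => rw [Finsupp.single_add]; exact ha _ _ hf hg
    | single a m => exact hs w a m

lemma flatten_consL {k L n : ℕ} (h : k + (L + 1) = n + 1) (h' : k + L = n) (y : X)
    (c : Chain X (Chain X M k) L) :
    flatten R X M h (consL R y L c) = consL R y n (flatten R X M h' c) := by
  induction c using chain_chain_induction with
  | h0 => simp
  | ha f g hf hg => simp only [map_add, hf, hg]
  | hs w a m => rw [consL_single, flatten_single_single, flatten_single_single, consL_single,
      concat_cons h h']

lemma flatten_diagAct [Spindle X] (A : SpindleAction R X M) {k L n : ℕ} (h : k + L = n) (y : X)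
    (c : Chain X (Chain X M k) L) :
    flatten R X M h (diagAct (diagAction A k) y L c) = diagAct A y n (flatten R X M h c) := by
  induction c using chain_chain_induction with
  | h0 => simp
  | ha f g hf hg => simp only [map_add, hf, hg]
  | hs w a m =>
    rw [diagAct_single, flatten_single_single, diagAct_single, concat_diag]
    simp only [diagAction, diagAct_single, flatten_single_single]

lemma flatten_mapCoeff_nil {k l : ℕ} (f : Chain X M k →ₗ[R] Chain X M l) (h : k + 0 = k)
    (h' : l + 0 = l) (c : Chain X (Chain X M k) 0) :
    flatten R X M h' (mapCoeff f 0 c) = f (flatten R X M h c) := by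
  have hfl : ∀ {j : ℕ} (hj : j + 0 = j) (w : Fin 0 → X) (d : Chain X M j),
      flatten R X M hj (Finsupp.single w d) = d := by
    intro j hj w d
    induction d using Finsupp.induction_linear with
    | zero => simp
    | add f g hf hg => rw [Finsupp.single_add, map_add, hf, hg]
    | single a m => rw [flatten_single_single, concat_nil]
  induction c using Finsupp.induction_linear with
  | zero => simp
  | add f g hf hg => simp only [map_add, hf, hg]
  | single w d => rw [mapCoeff_single, hfl, hfl]

/-- The case of empty left-hand sequences stands apart because `Chain X M 0` has no outgoing
differential. -/
lemma rackD_flatten_zero [Spindle X] (A : SpindleAction R X M) {L n : ℕ} (h : 0 + (L + 1) = n + 1)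
    (h' : 0 + L = n) (c : Chain X (Chain X M 0) (L + 1)) :
    rackD A n (flatten R X M h c) = flatten R X M h' (rackD (diagAction A 0) L c) := by
  induction L generalizing n with
  | zero =>
    obtain rfl : n = 0 := by omega
    revert c
    refine chain_cons_induction (R := R) (by simp)
      (fun f g hf hg => by simp only [map_add, hf, hg]) fun y c => ?_
    rw [flatten_consL h h', rackD_zero_consL, rackD_zero_consL, map_sub, flatten_diagAct]
  | succ L ih =>
    obtain rfl : n = L + 1 := by omega
    revert c
    refine chain_cons_induction (R := R) (by simp)
      (fun f g hf hg => by simp only [map_add, hf, hg]) fun y c => ?_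
    rw [flatten_consL h h', rackD_succ_consL, rackD_succ_consL, map_add, map_smul, map_sub,
      flatten_diagAct, flatten_consL h' (by omega), ih h' (by omega)]

/-- A face at one of the right-most entries acts on everything to its left, the inner chain
included; hence the diagonal action on coefficients. Its sign (-1)^(n-i) differs from the one in the
shorter outer sequence by (-1)^(k+1). A face inside the left block does not touch the right block,
and its sign depends only on its distance from the left end, so it is already correct. -/
lemma rackD_flatten_succ [Spindle X] (A : SpindleAction R X M) {k L n : ℕ}
    (h : k + 1 + (L + 1) = n + 1) (h' : k + 1 + L = n) (h'' : k + (L + 1) = n)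
    (c : Chain X (Chain X M (k + 1)) (L + 1)) :
    rackD A n (flatten R X M h c) = flatten R X M h'' (mapCoeff (rackD A k) (L + 1) c)
      + (-1 : R) ^ (k + 1) • flatten R X M h' (rackD (diagAction A (k + 1)) L c) := by
  induction L generalizing n with
  | zero =>
    obtain rfl : n = k + 1 := by omega
    revert c
    refine chain_cons_induction (R := R) (by simp)
      (fun f g hf hg => by simp only [map_add, hf, hg, smul_add]; abel) fun y c => ?_
    rw [flatten_consL h h', rackD_succ_consL, rackD_zero_consL, map_sub, flatten_diagAct,
      mapCoeff_consL, flatten_consL h'' rfl, flatten_mapCoeff_nil _ h']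
  | succ L ih =>
    obtain rfl : n = k + L + 1 + 1 := by omega
    revert c
    refine chain_cons_induction (R := R) (by simp)
      (fun f g hf hg => by simp only [map_add, hf, hg, smul_add]; abel) fun y c => ?_
    rw [flatten_consL h h', rackD_succ_consL, rackD_succ_consL, map_add, map_smul, map_sub,
      flatten_diagAct, mapCoeff_consL, flatten_consL h'' (by omega),
      flatten_consL h' (by omega), ih h' (by omega) (by omega), map_add, map_smul, smul_add,
      smul_smul, ← pow_add]
    have : (-1 : R) ^ (k + L + 1 + 1) = (-1) ^ (k + 1 + (L + 1)) := by congr 1; omega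
    rw [this]
    abel

end Flatten

/-! ### The composite of α, doubling and u, and its recursion -/

section Doubling

variable {R X : Type u} [CommRing R]

lemma chain_single_one_induction {L : ℕ} {P : Chain X R L → Prop} (h0 : P 0)
    (ha : ∀ c d, P c → P d → P (c + d)) (hm : ∀ (r : R) c, P c → P (r • c))
    (hs : ∀ x, P (Finsupp.single x 1)) (c) : P c := by
  induction c using Finsupp.induction_linear with
  | zero => exact h0
  | add f g hf hg => exact ha _ _ hf hg
  | single x r => simpa using hm r _ (hs x)

variable (R X) in
/-- The endomorphism of `C_p(X)` induced by the splitting `α_p`. -/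
noncomputable def alphaLin (p : ℕ) : Chain X R (p + 1) →ₗ[R] Chain X R (p + 1) :=
  Finsupp.lsum R fun x => LinearMap.toSpanSingleton R _ (alphaSeq R p x)

lemma alphaLin_single (p : ℕ) (x : Fin (p + 1) → X) :
    alphaLin R X p (Finsupp.single x 1) = alphaSeq R p x := by
  simp [alphaLin]

lemma alpha_mk (p : ℕ) (c : Chain X R (p + 1)) :
    alpha R X p ((degen R X R (p + 1)).mkQ c) = alphaLin R X p c := rfl

lemma alphaLin_degen {p : ℕ} {c : Chain X R (p + 1)} (hc : c ∈ degen R X R (p + 1)) :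
    alphaLin R X p c = 0 := by
  rw [← alpha_mk, Submodule.mkQ_apply, (Submodule.Quotient.mk_eq_zero _).2 hc, map_zero]

lemma double_single (p : ℕ) (x : Fin (p + 1) → X) (r : R) :
    double R X p (Finsupp.single x r) = Finsupp.single (doubleSeq x) r := by
  simp [double, Finsupp.mapDomain_single]

lemma doubleSeq_cons {p : ℕ} (y : X) (x : Fin (p + 1) → X) :
    doubleSeq (Fin.cons y x : Fin (p + 2) → X) = Fin.cons y (doubleSeq x) := by
  unfold doubleSeq
  rw [Fin.cons_snoc_eq_snoc_cons, ← Fin.succ_last, Fin.cons_succ]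

lemma double_consL (p : ℕ) (y : X) (c : Chain X R (p + 1)) :
    double R X (p + 1) (consL R y _ c) = consL R y _ (double R X p c) := by
  induction c using Finsupp.induction_linear with
  | zero => simp
  | add f g hf hg => simp only [map_add, hf, hg]
  | single x r => rw [consL_single, double_single, double_single, consL_single, doubleSeq_cons]

variable [Spindle X]

variable (R X) in
/-- The diagonal action on chains with trivial coefficients. -/
noncomputable abbrev trivAct (y : X) (L : ℕ) : Chain X R L →ₗ[R] Chain X R L :=
  diagAct (SpindleAction.trivial R X) y L

lemma alphaLin_trivAct (p : ℕ) (y : X) (c : Chain X R (p + 1)) :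
    alphaLin R X p (trivAct R X y _ c) = trivAct R X y _ (alphaLin R X p c) := by
  induction c using chain_single_one_induction with
  | h0 => simp
  | ha f g hf hg => simp only [map_add, hf, hg]
  | hm r c hc => simp only [map_smul, hc]
  | hs x =>
    rw [trivAct, diagAct_trivial_single, alphaLin_single, alphaLin_single]
    induction p with
    | zero => rw [alphaSeq, alphaSeq, diagAct_trivial_single]
    | succ p ih =>
      rw [alphaSeq, alphaSeq, map_sub, diagAct_consL, diagAct_consL, ← ih]
      rfl

lemma double_trivAct (p : ℕ) (y : X) (c : Chain X R (p + 1)) :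
    double R X p (trivAct R X y _ c) = trivAct R X y _ (double R X p c) := by
  induction c using Finsupp.induction_linear with
  | zero => simp
  | add f g hf hg => simp only [map_add, hf, hg]
  | single x r =>
    rw [trivAct, diagAct_trivial_single, double_single, double_single, diagAct_trivial_single]
    congr 1
    funext i
    refine Fin.lastCases ?_ (fun j => ?_) i <;> simp [doubleSeq]

lemma uMap_single (p : ℕ) (x : Fin (p + 2) → X) :
    uMap R X p (Finsupp.single x 1) = uSeq R p x := by
  simp [uMap]

lemma uMap_consL (p : ℕ) (y : X) (w : Chain X R (p + 2)) :
    uMap R X (p + 1) (consL R y _ w) = consL R y _ (uMap R X p w)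
      + (-1 : R) ^ (p + 1) • snocL R y _ (uMap R X p (trivAct R X y _ w)) := by
  induction w using chain_single_one_induction with
  | h0 => simp
  | ha f g hf hg => simp only [map_add, hf, hg, smul_add]; abel
  | hm r c hc => simp only [map_smul, hc, smul_add, smul_comm r]
  | hs x =>
    rw [consL_single, uMap_single, trivAct, diagAct_trivial_single, uMap_single, uMap_single, uSeq]
    rfl

lemma trivAct_snocL (y z : X) (L : ℕ) (c : Chain X R L) :
    trivAct R X z _ (snocL R y _ c) = snocL R (Spindle.op y z) _ (trivAct R X z _ c) := by
  induction c using Finsupp.induction_linear with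
  | zero => simp
  | add f g hf hg => simp only [map_add, hf, hg]
  | single x r =>
    rw [snocL_single, trivAct, diagAct_trivial_single, diagAct_trivial_single, snocL_single]
    congr 1
    funext i
    refine Fin.lastCases ?_ (fun j => ?_) i <;> simp

/-- In the second term of the recursion this is self-distributivity, (c ⋆ y) ⋆ z = (c ⋆ z) ⋆ (y ⋆
z). -/
lemma uMap_trivAct (p : ℕ) (z : X) (c : Chain X R (p + 2)) :
    uMap R X p (trivAct R X z _ c) = trivAct R X z _ (uMap R X p c) := by
  induction p with
  | zero =>
    have h : ∀ d : Chain X R 2, uMap R X 0 d = d := fun d => by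
      induction d using chain_single_one_induction with
      | h0 => simp
      | ha f g hf hg => simp only [map_add, hf, hg]
      | hm r c hc => simp only [map_smul, hc]
      | hs x => rw [uMap_single, uSeq]
    rw [h, h]
  | succ p ih =>
    revert c
    refine chain_cons_induction (R := R) (by simp)
      (fun f g hf hg => by simp only [map_add, hf, hg]) fun y c => ?_
    have h := diagAct_diagAct (SpindleAction.trivial R X) y z _ c
    rw [trivAct, diagAct_consL, uMap_consL, uMap_consL, map_add, diagAct_consL, ← ih, map_smul,
      trivAct_snocL, ← ih, ← h]

variable (R X) in
/-- The map `u^p ∘ double ∘ α_p`, regarded as a map on chains of length `p + 1`; it is zero on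
chains of length `0`. -/
noncomputable def twist : (L : ℕ) → Chain X R L →ₗ[R] Chain X R (L + 1)
  | 0 => 0
  | p + 1 => uMap R X p ∘ₗ double R X p ∘ₗ alphaLin R X p

variable (R X) in
/-- The map `c ↦ (W c, y) ± (y, W (c ⋆ y))` with `W` the map `twist`. -/
noncomputable def twistCons (y : X) (L : ℕ) : Chain X R L →ₗ[R] Chain X R (L + 2) :=
  consL R y _ ∘ₗ twist R X L + (-1 : R) ^ L • (snocL R y _ ∘ₗ twist R X L ∘ₗ trivAct R X y _)

lemma twistCons_apply (y : X) (L : ℕ) (c : Chain X R L) :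
    twistCons R X y L c = consL R y _ (twist R X L c)
      + (-1 : R) ^ L • snocL R y _ (twist R X L (trivAct R X y _ c)) := rfl

lemma twist_degen {L : ℕ} {c : Chain X R L} (hc : c ∈ degen R X R L) : twist R X L c = 0 := by
  cases L with
  | zero => rfl
  | succ p => rw [twist, LinearMap.comp_apply, LinearMap.comp_apply, alphaLin_degen hc, map_zero,
      map_zero]

lemma twist_trivAct (L : ℕ) (y : X) (c : Chain X R L) :
    twist R X L (trivAct R X y _ c) = trivAct R X y _ (twist R X L c) := by
  cases L with
  | zero => simp [twist]
  | succ p =>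
    simp only [twist, LinearMap.comp_apply, alphaLin_trivAct, double_trivAct, uMap_trivAct]

/-- α replaces the last entry y by y - x_0, and the recursion for u turns each of the two terms into
a `twistCons`, since α and doubling commute with the action. -/
lemma twist_single_cons (p : ℕ) (y : X) (x : Fin (p + 1) → X) :
    twist R X (p + 2) (Finsupp.single (Fin.cons y x : Fin (p + 2) → X) 1)
      = twistCons R X y (p + 1) (Finsupp.single x 1)
        - twistCons R X (x 0) (p + 1) (Finsupp.single x 1) := by
  have h1 : alphaLin R X (p + 1) (Finsupp.single (Fin.cons y x : Fin (p + 2) → X) 1)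
      = consL R y _ (alphaLin R X p (Finsupp.single x 1))
        - consL R (x 0) _ (alphaLin R X p (Finsupp.single x 1)) := by
    rw [alphaLin_single, alphaLin_single]
    rfl
  simp only [twistCons_apply, twist, LinearMap.comp_apply, h1, map_sub, double_consL, uMap_consL,
    alphaLin_trivAct, double_trivAct]

/-- The correction term of `twist_single_cons` does not depend on the last entry, so it drops out of
differences. Positive length is needed: for the empty sequence the left side is (y, y) - (z, z),
while `twistCons` vanishes. -/
lemma twist_consL_sub (L : ℕ) (y z : X) (c : Chain X R (L + 1)) :
    twist R X (L + 2) (consL R y _ c) - twist R X (L + 2) (consL R z _ c)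
      = twistCons R X y (L + 1) c - twistCons R X z (L + 1) c := by
  induction c using chain_single_one_induction with
  | h0 => simp
  | ha f g hf hg =>
    have e := congrArg₂ (· + ·) hf hg
    simp only [map_add] at e ⊢
    rw [add_sub_add_comm, e, add_sub_add_comm]
  | hm r c hc => simp only [map_smul, ← smul_sub, hc]
  | hs x =>
    rw [consL_single, consL_single, twist_single_cons, twist_single_cons]
    abel

end Doubling

/-! ### The key identity: ∂(a ⊗ T b) = -a ⊗ T(∂b) -/

section Key

variable {R X : Type u} [CommRing R]

lemma constCoeff_snocL {M : Type*} [AddCommGroup M] [Module R M] (a : M) {L : ℕ} (y : X)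
    (h : 1 + L = L + 1) (c : Chain X R L) :
    constCoeff R a (L + 1) (snocL R y L c)
      = flatten R X M h (constCoeff R (Finsupp.single (fun _ => y) a : Chain X M 1) L c) := by
  induction c using Finsupp.induction_linear with
  | zero => simp
  | add f g hf hg => simp only [map_add, hf, hg]
  | single x r =>
    rw [snocL_single, constCoeff_single, constCoeff_single, Finsupp.smul_single,
      flatten_single_single, concat_one]

lemma flatten_constCoeff_nil {M : Type*} [AddCommGroup M] [Module R M] (a : M) {L : ℕ}
    (h : 0 + L = L) (e : Fin 0 → X) (c : Chain X R L) :
    flatten R X M h (constCoeff R (Finsupp.single e a : Chain X M 0) L c) = constCoeff R a L c := by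
  induction c using Finsupp.induction_linear with
  | zero => simp
  | add f g hf hg => simp only [map_add, hf, hg]
  | single x r =>
    rw [constCoeff_single, constCoeff_single, Finsupp.smul_single, flatten_single_single,
      concat_zero]

variable [Spindle X]

variable (R X) in
/-- The differential of chains with trivial coefficients. -/
noncomputable abbrev trivD (L : ℕ) : Chain X R (L + 1) →ₗ[R] Chain X R L :=
  rackD (SpindleAction.trivial R X) L

/-- With trivial coefficients the augmentation m - m ⋆ x is zero. -/
lemma chain_zero_of_range (c : Chain X R 1) : trivD R X 0 c = 0 := by
  revert c
  refine chain_cons_induction (R := R) (by simp) (fun f g hf hg => by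
    rw [map_add, hf, hg, add_zero]) fun y c => ?_
  rw [trivD, rackD_zero_consL, sub_eq_zero]
  induction c using Finsupp.induction_linear with
  | zero => simp
  | add f g hf hg => rw [map_add, ← hf, ← hg]
  | single x r =>
    rw [diagAct_trivial_single]
    congr 1
    exact Subsingleton.elim _ _

/-- On boundaries the restriction to positive length disappears, because boundaries of length 0
vanish. -/
lemma twist_consL_sub_trivD (L : ℕ) (y z : X) (c : Chain X R (L + 1)) :
    twist R X (L + 1) (consL R y _ (trivD R X L c))
        - twist R X (L + 1) (consL R z _ (trivD R X L c))
      = twistCons R X y L (trivD R X L c) - twistCons R X z L (trivD R X L c) := by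
  cases L with
  | zero => simp only [chain_zero_of_range, map_zero]
  | succ L => exact twist_consL_sub L y z _

/-- The differential of `a ⊗ (y, w)` with `y` on the left. -/
lemma rackD_constCoeff_snocL {M : Type u} [AddCommGroup M] [Module R M] (A : SpindleAction R X M)
    (a : M) (L : ℕ) (y : X) (h : 1 + L = L + 1) (w : Chain X R (L + 1)) :
    rackD A (L + 1) (constCoeff R a (L + 2) (snocL R y (L + 1) w))
      = constCoeff R a (L + 1) w - constCoeff R (A.act y a) (L + 1) w
        - flatten R X M h (rackD (diagAction A 1) L
            (constCoeff R (Finsupp.single (fun _ => y) a : Chain X M 1) (L + 1) w)) := by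
  -- The left-most entry y is absorbed into the coefficient, which now lies in C_0(M;X); its
  -- augmentation gives a - a ⋆ y.
  rw [constCoeff_snocL a y (by omega), rackD_flatten_succ A (k := 0) _ h (by omega),
    mapCoeff_constCoeff, show (-1 : R) ^ (0 + 1) = -1 by simp, neg_one_smul, ← sub_eq_add_neg]
  congr 1
  have h1 : (Finsupp.single (fun _ => y) a : Chain X M 1)
      = consL R y 0 (Finsupp.single Fin.elim0 a) := by
    rw [consL_single]
    congr 1
    funext i
    rw [Fin.fin_one_eq_zero i, Fin.cons_zero]
  rw [h1, rackD_zero_consL, diagAct_single, constCoeff_sub, map_sub, flatten_constCoeff_nil,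
    flatten_constCoeff_nil]

/-- If coefficients pass through the differential of `twist` in one degree, then they do so for
`twistCons` up to explicit terms. -/
lemma rackD_constCoeff_twistCons {L : ℕ}
    (ih : ∀ {M : Type u} [AddCommGroup M] [Module R M] (A : SpindleAction R X M) (a : M)
      (b : Chain X R (L + 1)), rackD A (L + 1) (constCoeff R a _ (twist R X (L + 1) b))
        = - constCoeff R a _ (twist R X L (trivD R X L b)))
    {M : Type u} [AddCommGroup M] [Module R M] (A : SpindleAction R X M) (a : M) (y : X)
    (c : Chain X R (L + 1)) :
    rackD A (L + 2) (constCoeff R a _ (twistCons R X y (L + 1) c))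
      = constCoeff R a _ (- twistCons R X y L (trivD R X L c)
        + (-1 : R) ^ (L + 1) • (twist R X (L + 1) (trivAct R X y _ c) - twist R X (L + 1) c)) := by
  have h : 1 + (L + 1) = L + 1 + 1 := by omega
  have hc : trivD R X L (trivAct R X y _ c) = trivAct R X y _ (trivD R X L c) :=
    rackD_diagAct _ _ _ _
  rw [twistCons_apply, twistCons_apply, map_add, map_add, constCoeff_consL, rackD_succ_consL, ih,
    map_smul, map_smul, rackD_constCoeff_snocL A a (L + 1) y h, ih, diagAct_constCoeff, hc,
    map_neg (flatten R X M h),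
    ← constCoeff_snocL a y]
  -- T commutes with the action, so both terms with coefficient `A.act y a` involve T(c ⋆ y); they
  -- carry opposite signs and cancel.
  rw [show diagAct (SpindleAction.trivial R X) y (L + 1 + 1) (twist R X (L + 1) c) = _ from
    (twist_trivAct _ _ _).symm]
  simp only [map_add, map_sub, map_neg, map_smul, constCoeff_consL, pow_succ, mul_neg, mul_one,
    neg_smul, smul_sub, smul_neg, neg_neg]
  abel

/-- The induction has to run over all coefficient modules at once: the step moves an entry from the
left end into the coefficient and applies the hypothesis to `Chain X M 1`. -/
theorem rackD_constCoeff_twist (L : ℕ) {M : Type u} [AddCommGroup M] [Module R M]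
    (A : SpindleAction R X M) (a : M) (b : Chain X R (L + 1)) :
    rackD A (L + 1) (constCoeff R a _ (twist R X (L + 1) b))
      = - constCoeff R a _ (twist R X L (trivD R X L b)) := by
  induction L generalizing M with
  | zero =>
    rw [chain_zero_of_range, map_zero, map_zero, neg_zero]
    induction b using chain_single_one_induction with
    | h0 => simp
    | ha f g hf hg => simp only [map_add, hf, hg, add_zero]
    | hm r c hc => simp only [map_smul, hc, smul_zero]
    | hs x =>
      -- In length one T is plain doubling, and the boundary of (x, x) vanishes because x ⋆ x = x.
      have : twist R X (0 + 1) (Finsupp.single x 1)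
          = consL R (x 0) _ (consL R (x 0) _ (Finsupp.single Fin.elim0 1)) := by
        rw [twist, LinearMap.comp_apply, LinearMap.comp_apply, alphaLin_single, alphaSeq,
          double_single, uMap_single, uSeq, consL_single, consL_single]
        congr 1
        funext i
        fin_cases i <;> rfl
      rw [this, constCoeff_consL, constCoeff_consL, rackD_succ_consL, rackD_zero_consL,
        diagAct_consL, Spindle.op_self, map_sub]
      simp
  | succ L ih =>
    induction b using chain_single_one_induction with
    | h0 => simp
    | ha f g hf hg => simp only [map_add, hf, hg, neg_add]
    | hm r c hc => simp only [map_smul, hc, smul_neg]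
    | hs x =>
      obtain ⟨y, x, rfl⟩ : ∃ y x', x = (Fin.cons y x' : Fin (L + 2) → X) :=
        ⟨x 0, Fin.tail x, (Fin.cons_self_tail x).symm⟩
      rw [twist_single_cons, map_sub, map_sub, rackD_constCoeff_twistCons ih,
        rackD_constCoeff_twistCons ih, ← map_sub, ← map_neg (constCoeff R a _)]
      refine congrArg (constCoeff R a _) ?_
      rw [← consL_single (R := R), trivD, rackD_succ_consL]
      -- The sequence (x, x_0) repeats its last entry, so T kills its boundary. This expresses T(∂x,
      -- x_0) through T(x) and T(x ⋆ x_0), which are the terms left over from the subtracted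
      -- `twistCons`.
      have hdeg : consL R (x 0) _ (Finsupp.single x (1 : R)) ∈ degen R X R (L + 2) := by
        rw [consL_single]
        exact single_mem_degen ⟨0, 1, by simp, rfl⟩ _
      have hd := twist_degen (rackD_mem_degen (SpindleAction.trivial R X) hdeg)
      rw [rackD_succ_consL] at hd
      have hs := twist_consL_sub_trivD L y (x 0) (Finsupp.single x (1 : R))
      simp only [map_add, map_sub, map_smul, trivD, trivAct] at hd hs ⊢
      rw [sub_eq_iff_eq_add] at hs
      rw [add_eq_zero_iff_eq_neg] at hd
      rw [hs, hd]
      simp only [smul_sub]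
      abel

end Key

/-! ### 𝓔 commutes with the differentials -/

section ChainMap

variable {R X M : Type u} [CommRing R] [AddCommGroup M] [Module R M]

lemma glue_eq_flatten {k p n : ℕ} (h : k + p + 1 = n) (h' : k + (p + 2) = n + 1) (a : Chain X M k)
    (w : Chain X R (p + 2)) :
    glue R X M h a w = flatten R X M h' (constCoeff R a (p + 2) w) := by
  induction w using Finsupp.induction_linear with
  | zero => simp
  | add f g hf hg => simp only [map_add, hf, hg]
  | single x r =>
    rw [constCoeff_single]
    induction a using Finsupp.induction_linear with
    | zero => simp
    | add f g hf hg =>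
      rw [map_add, LinearMap.add_apply, smul_add, Finsupp.single_add, map_add, hf, hg]
    | single a m =>
      rw [glue_single_single, Finsupp.smul_single, flatten_single_single]
      rfl

variable [Spindle X]

/-- The component of `𝓔` on representatives, without the sign. -/
noncomputable def extend {k p n : ℕ} (h : k + p + 1 = n) (a : Chain X M k) :
    Chain X R (p + 1) →ₗ[R] Chain X M (n + 1) :=
  flatten R X M (L := p + 2) (by omega) ∘ₗ constCoeff R a (p + 2) ∘ₗ twist R X (p + 1)

lemma rightPart_mkQ (σ : ℤˣ) (p : ℕ) (c : Chain X R (p + 1)) :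
    (rightPart R X σ p ((degen R X R (p + 1)).mkQ c) : Chain X R (p + 2))
      = σ ^ p • twist R X (p + 1) c := rfl

lemma coe_EMap_totIncl (σ : ℤˣ) {n k p : ℕ} (h : k + p + 1 = n) (a : Chain X M k)
    (c : Chain X R (p + 1)) :
    (EMap R X M σ n (totIncl R X M ⟨(k, p), h⟩ (a ⊗ₜ (degen R X R (p + 1)).mkQ c)) :
        Chain X M (n + 1)) = σ ^ p • extend h a c := by
  rw [EMap, DirectSum.toModule_lof]
  change glue R X M h a (rightPart R X σ p ((degen R X R (p + 1)).mkQ c)) = _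
  rw [rightPart_mkQ, glue_eq_flatten h (by omega), Units.smul_def, map_zsmul, map_zsmul,
    Units.smul_def]
  rfl

lemma rackD_extend_zero (A : SpindleAction R X M) {p n : ℕ} (h : 0 + p + 1 = n + 1)
    (a : Chain X M 0) (c : Chain X R (p + 1)) :
    rackD A (n + 1) (extend h a c) = - flatten R X M (L := p + 1) (by omega)
        (constCoeff R a (p + 1) (twist R X p (trivD R X p c))) := by
  rw [extend, LinearMap.comp_apply, LinearMap.comp_apply,
    rackD_flatten_zero A (L := p + 1) _ (by omega), rackD_constCoeff_twist, map_neg]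

/-- The key identity is applied with coefficients `Chain X M (k + 1)` under the diagonal action; its
minus sign turns (-1)^(k+1) into (-1)^k. -/
lemma rackD_extend_succ (A : SpindleAction R X M) {k p n : ℕ} (h : k + 1 + p + 1 = n + 1)
    (a : Chain X M (k + 1)) (c : Chain X R (p + 1)) :
    rackD A (n + 1) (extend h a c) = extend (by omega) (rackD A k a) c
      + (-1 : R) ^ k • flatten R X M (L := p + 1) (by omega)
        (constCoeff R a (p + 1) (twist R X p (trivD R X p c))) := by
  rw [extend, LinearMap.comp_apply, LinearMap.comp_apply,
    rackD_flatten_succ A (L := p + 1) _ (by omega) (by omega), rackD_constCoeff_twist, map_neg,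
    mapCoeff_constCoeff, pow_succ]
  simp only [mul_neg, mul_one, neg_smul, smul_neg, neg_neg]
  rfl

lemma units_smul_eq (s : ℤˣ) {V : Type*} [AddCommGroup V] [Module R V] (v : V) :
    s • v = ((s : ℤ) : R) • v := by
  rw [Units.smul_def, Int.cast_smul_eq_zsmul]

/-- Lowering p by one changes σ^p by one factor σ, which is the σ in the total differential. On the
edges p = 0 and k = 0 the missing component of `totD` matches `twist` being zero on length 0 and the
left block having no boundary. -/
lemma EMap_totD (A : SpindleAction R X M) (σ : ℤˣ) (n : ℕ) (z : TotMod R X M (n + 1)) :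
    EMap R X M σ n (totD A σ n z) = degenD A n (EMap R X M σ (n + 1) z) := by
  suffices h : EMap R X M σ n ∘ₗ totD A σ n = degenD A n ∘ₗ EMap R X M σ (n + 1) from
    LinearMap.congr_fun h z
  refine DirectSum.linearMap_ext R fun ⟨⟨k, p⟩, h⟩ => TensorProduct.ext' fun a b => Subtype.ext ?_
  obtain ⟨c, rfl⟩ := (degen R X R (p + 1)).mkQ_surjective b
  change k + p + 1 = n + 1 at h
  change (EMap R X M σ n (totD A σ n (totIncl R X M ⟨(k, p), h⟩ _)) : Chain X M (n + 1))
    = rackD A (n + 1) (EMap R X M σ (n + 1) (totIncl R X M ⟨(k, p), h⟩ _))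
  rw [totD_totIncl, coe_EMap_totIncl, map_add, units_smul_eq (R := R), units_smul_eq (R := R),
    map_smul, map_smul, Submodule.coe_add, Submodule.coe_smul]
  have e₂ : ∀ (p : ℕ) (h : k + (p + 1) + 1 = n + 1) (c : Chain X R (p + 2)),
      (EMap R X M σ n (totD₂ R X M k (p + 1) h (a ⊗ₜ (degen R X R (p + 2)).mkQ c)) :
          Chain X M (n + 1))
        = ((σ ^ p : ℤˣ) : ℤ) • flatten R X M (L := p + 2) (by omega)
          (constCoeff R a (p + 2) (twist R X (p + 1) (trivD R X (p + 1) c))) := by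
    intro p h c
    change (EMap R X M σ n (totIncl R X M ⟨(k, p), _⟩
      (a ⊗ₜ (degen R X R (p + 1)).mkQ (trivD R X (p + 1) c))) : Chain X M (n + 1)) = _
    rw [coe_EMap_totIncl]
    rfl
  have z₂ : ∀ (k : ℕ) (h : k + 0 + 1 = n + 1) (z), totD₂ R X M k 0 h z = 0 := by
    intro k _ _; cases k <;> rfl
  rcases k with _ | k
  · rw [rackD_extend_zero, show totD₁ A 0 p h = 0 from rfl, LinearMap.zero_apply, map_zero,
      Submodule.coe_zero, zero_add]
    rcases p with _ | p
    · simp [z₂, twist]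
    · rw [e₂, ← Int.cast_smul_eq_zsmul R, smul_smul]
      simp only [zero_add, Units.val_mul, Units.val_neg, Int.cast_mul, Int.cast_neg, smul_neg,
        pow_succ, pow_zero, mul_neg, mul_one, neg_mul, neg_smul]
      rw [mul_comm]
  · have e₁ : (EMap R X M σ n (totD₁ A (k + 1) p h (a ⊗ₜ (degen R X R (p + 1)).mkQ c)) :
          Chain X M (n + 1)) = ((σ ^ p : ℤˣ) : ℤ) • extend (by omega) (rackD A k a) c := by
      change (EMap R X M σ n (totIncl R X M ⟨(k, p), _⟩
        (rackD A k a ⊗ₜ (degen R X R (p + 1)).mkQ c)) : Chain X M (n + 1)) = _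
      rw [coe_EMap_totIncl]
      rfl
    rw [rackD_extend_succ, e₁, smul_add]
    refine congrArg₂ (· + ·) (Int.cast_smul_eq_zsmul R _ _).symm ?_
    rcases p with _ | p
    · simp [z₂, twist]
    · rw [e₂, ← Int.cast_smul_eq_zsmul R, smul_smul, smul_smul]
      congr 1
      push_cast
      ring

end ChainMap

/-! ### 𝓔 is triangular: bijectivity and filtrations -/

section Filtration

/-- `x` has a repetition `x_i = x_{i+1}` for some `i < p`. -/
def IsRepLT {X : Type*} {L : ℕ} (p : ℕ) (x : Fin L → X) : Prop :=
  ∃ i j : Fin L, (j : ℕ) = i + 1 ∧ (i : ℕ) < p ∧ x i = x j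

lemma isRepLT_succ_iff {X : Type*} {L p : ℕ} {x : Fin L → X} : IsRepLT (p + 1) x ↔ IsRepLE p x := by
  simp only [IsRepLT, IsRepLE, Nat.lt_succ_iff]

lemma isRepLT_iff_isRep {X : Type*} {n p : ℕ} (h : n ≤ p) {x : Fin (n + 1) → X} :
    IsRepLT p x ↔ IsRep x :=
  ⟨fun ⟨i, j, hij, _, hx⟩ => ⟨i, j, hij, hx⟩, fun ⟨i, j, hij, hx⟩ => ⟨i, j, hij, by omega, hx⟩⟩

variable (R X M : Type u) [CommRing R] [AddCommGroup M] [Module R M]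

/-- The span of all `m ⊗ x` such that `x` has a repetition `x_i = x_{i+1}` with `i < p`. -/
noncomputable def filtLT (p L : ℕ) : Submodule R (Chain X M L) :=
  Finsupp.supported M R {x | IsRepLT p x}

variable {R X M}

/-- With a strict bound the stage before F^0 exists and is zero, which gives inductions on the
filtration a starting point. -/
lemma filtLT_succ (p L : ℕ) : filtLT R X M (p + 1) L = filt R X M p L := by
  simp only [filtLT, filt, isRepLT_succ_iff]

lemma filtLT_eq_degen {n p : ℕ} (h : n ≤ p) : filtLT R X M p (n + 1) = degen R X M (n + 1) := by
  simp only [filtLT, degen, isRepLT_iff_isRep h]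

lemma filtLT_le {p L : ℕ} {N : Submodule R (Chain X M L)}
    (h : ∀ x m, IsRepLT p x → Finsupp.single x m ∈ N) : filtLT R X M p L ≤ N := by
  intro c hc
  rw [← Finsupp.sum_single c]
  exact Submodule.sum_mem _ fun x hx => h x _ (hc hx)

lemma single_mem_filtLT {p L : ℕ} {x : Fin L → X} (h : IsRepLT p x) (m : M) :
    Finsupp.single x m ∈ filtLT R X M p L :=
  Finsupp.single_mem_supported R m h

lemma filtLT_mono {p q : ℕ} (h : p ≤ q) (L : ℕ) : filtLT R X M p L ≤ filtLT R X M q L :=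
  filtLT_le fun _ m ⟨i, j, hij, hp, hx⟩ => single_mem_filtLT ⟨i, j, hij, hp.trans_le h, hx⟩ m

lemma consL_mem_filtLT {p L : ℕ} {c : Chain X M L} (h : c ∈ filtLT R X M p L) (y : X) :
    consL R y L c ∈ filtLT R X M (p + 1) (L + 1) := by
  refine (filtLT_le (N := (filtLT R X M (p + 1) (L + 1)).comap (consL R y L)) ?_) h
  rintro x m ⟨i, j, hij, hp, hx⟩
  rw [Submodule.mem_comap, consL_single]
  exact single_mem_filtLT ⟨i.succ, j.succ, by simp [hij], by simpa using hp, by simpa using hx⟩ m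

lemma snocL_mem_filtLT {p L : ℕ} {c : Chain X M L} (h : c ∈ filtLT R X M p L) (y : X) :
    snocL R y L c ∈ filtLT R X M p (L + 1) := by
  refine (filtLT_le (N := (filtLT R X M p (L + 1)).comap (snocL R y L)) ?_) h
  rintro x m ⟨i, j, hij, hp, hx⟩
  rw [Submodule.mem_comap, snocL_single]
  exact single_mem_filtLT ⟨i.castSucc, j.castSucc, by simp [hij], by simpa using hp,
    by simpa using hx⟩ m

lemma flatten_constCoeff_mem_filtLT {k p L n : ℕ} (h : k + L = n) (a : Chain X M k)
    {c : Chain X R L} (hc : c ∈ filtLT R X R p L) :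
    flatten R X M h (constCoeff R a L c) ∈ filtLT R X M p n := by
  refine (filtLT_le (N := (filtLT R X M p n).comap
    (flatten R X M h ∘ₗ constCoeff (X := X) R a L)) ?_) hc
  rintro x r ⟨i, j, hij, hp, hx⟩
  rw [Submodule.mem_comap, LinearMap.comp_apply, constCoeff_single]
  induction a using Finsupp.induction_linear with
  | zero => simp
  | add f g hf hg =>
    rw [smul_add, Finsupp.single_add, map_add]
    exact Submodule.add_mem _ hf hg
  | single a m =>
    rw [Finsupp.smul_single, flatten_single_single]
    have hrep : IsRepLT p (concat h a x) :=
      ⟨⟨i, by omega⟩, ⟨j, by omega⟩, hij, hp, by simpa [concat] using hx⟩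
    exact single_mem_filtLT hrep _

lemma double_mem_filtLT (p : ℕ) (c : Chain X R (p + 1)) :
    double R X p c ∈ filtLT R X R (p + 1) (p + 2) := by
  induction c using Finsupp.induction_linear with
  | zero => simp
  | add f g hf hg => rw [map_add]; exact Submodule.add_mem _ hf hg
  | single x r =>
    rw [double_single]
    refine single_mem_filtLT ⟨(Fin.last p).castSucc, Fin.last (p + 1), by simp, by simp, ?_⟩ r
    simp [doubleSeq]

variable (R) in
/-- Restriction of a sequence of length `k + p + 2` to its `p + 1` right-most and its `k` left-most
entries. -/
noncomputable def proj {k p n : ℕ} (h : k + p + 1 = n) : Chain X M (n + 1) →ₗ[R] Bi R X M k p :=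
  Finsupp.lsum R fun y =>
    (TensorProduct.mk R (Chain X M k) (Norm R X p)).flip
      ((degen R X R (p + 1)).mkQ
        (Finsupp.single (fun i : Fin (p + 1) => y ⟨i, by omega⟩) 1)) ∘ₗ
      Finsupp.lsingle fun i : Fin k => y ⟨i + (p + 2), by omega⟩

lemma proj_single {k p n : ℕ} (h : k + p + 1 = n) (y : Fin (n + 1) → X) (m : M) :
    proj R h (Finsupp.single y m)
      = Finsupp.single (fun i : Fin k => y ⟨i + (p + 2), by omega⟩) m ⊗ₜ
        (degen R X R (p + 1)).mkQ
          (Finsupp.single (fun i : Fin (p + 1) => y ⟨i, by omega⟩) 1) := by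
  simp [proj]

/-- A repetition at i < p lies entirely within the p + 1 right-most entries, which then vanish in
CN_p. -/
lemma proj_filtLT {k p n : ℕ} (h : k + p + 1 = n) {c : Chain X M (n + 1)}
    (hc : c ∈ filtLT R X M p (n + 1)) : proj R h c = 0 := by
  refine (filtLT_le (N := LinearMap.ker (proj R h)) ?_) hc
  rintro x m ⟨i, j, hij, hp, hx⟩
  rw [LinearMap.mem_ker, proj_single, Submodule.mkQ_apply,
    (Submodule.Quotient.mk_eq_zero _).2 (single_mem_degen _ _), tmul_zero]
  exact ⟨⟨i, by omega⟩, ⟨j, by omega⟩, hij, hx⟩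

lemma proj_flatten_double {k p n : ℕ} (h : k + p + 1 = n) (h' : k + (p + 2) = n + 1)
    (a : Chain X M k) (c : Chain X R (p + 1)) :
    proj R h (flatten R X M h' (constCoeff R a _ (double R X p c)))
      = a ⊗ₜ (degen R X R (p + 1)).mkQ c := by
  induction c using chain_single_one_induction with
  | h0 => simp
  | ha f g hf hg => simp only [map_add, hf, hg, tmul_add]
  | hm r c hc => simp only [map_smul, hc, tmul_smul]
  | hs x =>
    rw [double_single, constCoeff_single, one_smul]
    induction a using Finsupp.induction_linear with
    | zero => simp
    | add f g hf hg => rw [Finsupp.single_add, map_add, map_add, hf, hg, add_tmul]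
    | single a m =>
      rw [flatten_single_single, proj_single]
      congr 2
      · funext i
        simp [concat]
      · congr 1
        funext i
        have hi : (i : ℕ) < p + 2 := by omega
        simp only [concat, hi, dif_pos]
        exact Fin.snoc_castSucc (α := fun _ => X) _ _ i

instance (n : ℕ) : Fintype (TotIdx n) :=
  Fintype.subtype ((Finset.range (n + 1) ×ˢ Finset.range (n + 1)).filter fun a => a.1 + a.2 + 1 = n)
    fun a => by
      simp only [Finset.mem_filter, Finset.mem_product, Finset.mem_range]
      omega

lemma sum_totIncl {n : ℕ} (z : TotMod R X M n) : ∑ i, totIncl R X M i (z i) = z :=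
  DirectSum.sum_univ_of z

lemma eq_concat {k p n : ℕ} (h : k + (p + 2) = n + 1) (y : Fin (n + 1) → X)
    (hy : y ⟨p, by omega⟩ = y ⟨p + 1, by omega⟩) :
    y = concat h (fun i : Fin k => y ⟨i + (p + 2), by omega⟩)
      (doubleSeq fun i : Fin (p + 1) => y ⟨i, by omega⟩) := by
  funext i
  simp only [concat]
  split_ifs with hi
  · rcases Nat.lt_or_ge i (p + 1) with hi' | hi'
    · rw [show (⟨i, hi⟩ : Fin (p + 2)) = Fin.castSucc ⟨i, hi'⟩ from rfl, doubleSeq,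
        Fin.snoc_castSucc]
    · have e1 : i = ⟨p + 1, by omega⟩ := Fin.ext (by simp only; omega)
      have e2 : (⟨i, hi⟩ : Fin (p + 2)) = Fin.last (p + 1) :=
        Fin.ext (by simp only [Fin.val_last]; omega)
      rw [e2, doubleSeq, Fin.snoc_last, e1, ← hy]
      rfl
  · congr 1
    exact Fin.ext (by simp only; omega)

variable [Spindle X]

/-- The leading term of T is doubling. In V_y c the term (T c, y) has leading term (double c, y),
the entry on the right shifting all repetitions by one. The other term, with y on the left, shifts
nothing, so it stays at the level of T c, one step lower. -/
lemma twist_sub_double_mem (p : ℕ) (c : Chain X R (p + 1)) :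
    twist R X (p + 1) c - double R X p c ∈ filtLT R X R p (p + 2) := by
  induction p with
  | zero =>
    suffices h : twist R X 1 c = double R X 0 c by rw [h, sub_self]; exact Submodule.zero_mem _
    induction c using chain_single_one_induction with
    | h0 => simp
    | ha f g hf hg => simp only [map_add, hf, hg]
    | hm r c hc => simp only [map_smul, hc]
    | hs x =>
      rw [twist, LinearMap.comp_apply, LinearMap.comp_apply, alphaLin_single, alphaSeq,
        double_single, uMap_single, uSeq]
  | succ p ih =>
    have hT : ∀ c : Chain X R (p + 1), twist R X (p + 1) c ∈ filtLT R X R (p + 1) (p + 2) :=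
      fun c => by
        rw [← sub_add_cancel (twist R X (p + 1) c) (double R X p c)]
        exact Submodule.add_mem _ (filtLT_mono p.le_succ _ (ih c)) (double_mem_filtLT p c)
    have hV : ∀ (y : X) (c : Chain X R (p + 1)),
        twistCons R X y (p + 1) c - consL R y _ (double R X p c)
          ∈ filtLT R X R (p + 1) (p + 3) := fun y c => by
      rw [twistCons_apply, add_sub_right_comm, ← map_sub]
      exact Submodule.add_mem _ (consL_mem_filtLT (ih c) y)
        (Submodule.smul_mem _ _ (snocL_mem_filtLT (hT _) y))
    induction c using chain_single_one_induction with
    | h0 => simp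
    | ha f g hf hg => rw [map_add, map_add, add_sub_add_comm]; exact Submodule.add_mem _ hf hg
    | hm r c hc => rw [map_smul, map_smul, ← smul_sub]; exact Submodule.smul_mem _ _ hc
    | hs x =>
      obtain ⟨y, x, rfl⟩ : ∃ y x', x = (Fin.cons y x' : Fin (p + 2) → X) :=
        ⟨x 0, Fin.tail x, (Fin.cons_self_tail x).symm⟩
      -- The leading term of the subtracted `twistCons` repeats x_0 at the right end, so it lies in
      -- the smallest nonzero stage.
      have h0 : consL R (x 0) _ (double R X p (Finsupp.single x 1))
          ∈ filtLT R X R (p + 1) (p + 3) := by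
        rw [double_single, consL_single]
        refine single_mem_filtLT ⟨0, 1, by simp, by simp, ?_⟩ 1
        change x 0 = doubleSeq x 0
        exact (Fin.snoc_castSucc (α := fun _ => X) _ _ 0).symm
      have h1 := hV (x 0) (Finsupp.single x 1)
      rw [twist_single_cons, ← consL_single (R := R), double_consL, sub_right_comm]
      refine Submodule.sub_mem _ (hV _ _) ?_
      simpa using Submodule.add_mem _ h1 h0

lemma twist_mem_filtLT (p : ℕ) (c : Chain X R (p + 1)) :
    twist R X (p + 1) c ∈ filtLT R X R (p + 1) (p + 2) := by
  rw [← sub_add_cancel (twist R X (p + 1) c) (double R X p c)]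
  exact Submodule.add_mem _ (filtLT_mono p.le_succ _ (twist_sub_double_mem p c))
    (double_mem_filtLT p c)

lemma extend_mem_filtLT {k p n : ℕ} (h : k + p + 1 = n) (a : Chain X M k) (c : Chain X R (p + 1)) :
    extend h a c ∈ filtLT R X M (p + 1) (n + 1) :=
  flatten_constCoeff_mem_filtLT _ a (twist_mem_filtLT p c)

lemma proj_extend {k p n : ℕ} (h : k + p + 1 = n) (a : Chain X M k) (c : Chain X R (p + 1)) :
    proj R h (extend h a c) = a ⊗ₜ (degen R X R (p + 1)).mkQ c := by
  rw [← proj_flatten_double h (by omega), ← sub_eq_zero, ← map_sub, extend, LinearMap.comp_apply,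
    LinearMap.comp_apply, ← map_sub, ← map_sub]
  exact proj_filtLT h (flatten_constCoeff_mem_filtLT _ a (twist_sub_double_mem p c))

lemma EMap_totIncl_mem_filtLT (σ : ℤˣ) {n : ℕ} (i : TotIdx n) (b : Bi R X M i.1.1 i.1.2) :
    (EMap R X M σ n (totIncl R X M i b) : Chain X M (n + 1))
      ∈ filtLT R X M (i.1.2 + 1) (n + 1) := by
  obtain ⟨⟨k, p⟩, h⟩ := i
  induction b using TensorProduct.induction_on with
  | zero => simp
  | add f g hf hg => rw [map_add, map_add, Submodule.coe_add]; exact Submodule.add_mem _ hf hg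
  | tmul a b =>
    obtain ⟨c, rfl⟩ := (degen R X R (p + 1)).mkQ_surjective b
    rw [coe_EMap_totIncl, units_smul_eq (R := R)]
    exact Submodule.smul_mem _ _ (extend_mem_filtLT h a c)

lemma proj_EMap_totIncl (σ : ℤˣ) {n k p : ℕ} (h : k + p + 1 = n) (b : Bi R X M k p) :
    proj R h (EMap R X M σ n (totIncl R X M ⟨(k, p), h⟩ b) : Chain X M (n + 1)) = σ ^ p • b := by
  induction b using TensorProduct.induction_on with
  | zero => simp
  | add f g hf hg => rw [map_add, map_add, Submodule.coe_add, map_add, hf, hg, smul_add]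
  | tmul a b =>
    obtain ⟨c, rfl⟩ := (degen R X R (p + 1)).mkQ_surjective b
    rw [coe_EMap_totIncl, units_smul_eq (R := R), map_smul, proj_extend, units_smul_eq (R := R)]

/-- Triangularity: the component with the largest p, that is the smallest k, is recovered first by
`proj`, and the others follow in order. -/
lemma EMap_injective (σ : ℤˣ) (n : ℕ) : Function.Injective (EMap R X M σ n) := by
  rw [injective_iff_map_eq_zero]
  intro z hz
  refine DFinsupp.ext fun i => ?_
  obtain ⟨⟨k, p⟩, h⟩ := i
  change z ⟨(k, p), h⟩ = 0
  induction k using Nat.strong_induction_on generalizing p with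
  | _ k ih =>
    have h0 : proj R h (EMap R X M σ n z : Chain X M (n + 1)) = 0 := by
      rw [hz, Submodule.coe_zero, map_zero]
    rw [← sum_totIncl z, map_sum, AddSubmonoidClass.coe_finsetSum, map_sum,
      Finset.sum_eq_single (⟨(k, p), h⟩ : TotIdx n), proj_EMap_totIncl, units_smul_eq (R := R),
      ← units_smul_eq, smul_eq_zero_iff_eq] at h0
    · exact h0
    · rintro ⟨⟨k', p'⟩, h'⟩ - hne
      change k' + p' + 1 = n at h'
      -- Components with smaller k' are already known to vanish; those with larger k' have p' < p
      -- and land in a stage that `proj` kills.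
      rcases lt_trichotomy k' k with hk | hk | hk
      · rw [ih k' hk p' h', map_zero, map_zero, Submodule.coe_zero, map_zero]
      · exact absurd (Subtype.ext (Prod.ext hk (by simp only; omega))) hne
      · exact proj_filtLT h (filtLT_mono (by simp only; omega) _
          (EMap_totIncl_mem_filtLT σ ⟨(k', p'), h'⟩ _))
    · exact fun hn => absurd (Finset.mem_univ _) hn

/-- Successive approximation along the filtration. The preimage is located in every column stage q
with p ≤ q + 1, which avoids writing q = p - 1 when p = 0. -/
lemma exists_EMap_eq (σ : ℤˣ) {n : ℕ} (p : ℕ) (c : Chain X M (n + 1))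
    (hc : c ∈ filtLT R X M p (n + 1)) :
    ∃ z, (∀ q, p ≤ q + 1 → z ∈ totFilt R X M q n) ∧ (EMap R X M σ n z : Chain X M (n + 1)) = c := by
  induction p generalizing c with
  | zero =>
    refine ⟨0, fun q _ => Submodule.zero_mem _, ?_⟩
    have : c ∈ (⊥ : Submodule R (Chain X M (n + 1))) := by
      refine filtLT_le ?_ hc
      rintro x m ⟨i, j, -, hp, -⟩
      omega
    rw [(Submodule.mem_bot R).1 this, map_zero, Submodule.coe_zero]
  | succ p ih =>
    let N : Submodule R (Chain X M (n + 1)) :=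
      ((⨅ q : {q // p ≤ q}, totFilt R X M q.1 n).map (EMap R X M σ n)).map
        (degen R X M (n + 1)).subtype
    suffices hN : filtLT R X M (p + 1) (n + 1) ≤ N by
      obtain ⟨_, ⟨z, hz, rfl⟩, rfl⟩ := hN hc
      exact ⟨z, fun q hq => (Submodule.mem_iInf _).1 hz ⟨q, by omega⟩, rfl⟩
    have hlow : filtLT R X M p (n + 1) ≤ N := fun c hc => by
      obtain ⟨z, hz, rfl⟩ := ih c hc
      exact ⟨_, ⟨z, (Submodule.mem_iInf _).2 fun q => hz _ (by omega), rfl⟩, rfl⟩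
    refine filtLT_le ?_
    rintro y m ⟨i, j, hij, hp, hx⟩
    rcases Nat.lt_or_ge i p with hi | hi
    · exact hlow (single_mem_filtLT ⟨i, j, hij, hi, hx⟩ m)
    · obtain ⟨k, h⟩ : ∃ k, k + p + 1 = n := ⟨n - p - 1, by omega⟩
      have hy : y ⟨p, by omega⟩ = y ⟨p + 1, by omega⟩ := by
        rw [show (⟨p, _⟩ : Fin (n + 1)) = i from Fin.ext (by simp only; omega),
          show (⟨p + 1, _⟩ : Fin (n + 1)) = j from Fin.ext (by simp only; omega), hx]
      set a : Chain X M k := Finsupp.single (fun i : Fin k => y ⟨i + (p + 2), by omega⟩) m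
      set c : Chain X R (p + 1) := Finsupp.single (fun i : Fin (p + 1) => y ⟨i, by omega⟩) 1
      -- Since y_p = y_{p+1}, the sequence y is the left block `a` followed by the doubling of `c`.
      -- Replacing doubling by T costs only a term of the previous stage.
      have e : Finsupp.single y m
          = extend h a c - flatten R X M (L := p + 2) (by omega) (constCoeff R a (p + 2)
            (twist R X (p + 1) c - double R X p c)) := by
        rw [map_sub, map_sub, extend, LinearMap.comp_apply, LinearMap.comp_apply, sub_sub_cancel,
          double_single, constCoeff_single, one_smul, flatten_single_single, ← eq_concat _ y hy]
      rw [e]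
      refine Submodule.sub_mem _ ?_
        (hlow (flatten_constCoeff_mem_filtLT _ a (twist_sub_double_mem p c)))
      -- The factor σ^p cancels the one in 𝓔, since it squares to 1.
      refine ⟨_, ⟨totIncl R X M ⟨(k, p), h⟩ (((σ ^ p : ℤˣ) : R) • a ⊗ₜ (degen R X R (p + 1)).mkQ c),
        (Submodule.mem_iInf _).2 fun q => ?_, rfl⟩, ?_⟩
      · exact Submodule.mem_iSup_of_mem
          (⟨⟨(k, p), h⟩, q.2⟩ : {i : TotIdx n // i.1.2 ≤ q.1}) ⟨_, rfl⟩
      · rw [map_smul, map_smul, map_smul, Submodule.subtype_apply, coe_EMap_totIncl,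
          units_smul_eq (R := R), smul_smul, ← Int.cast_mul, ← Units.val_mul,
          Int.units_mul_self, Units.val_one, Int.cast_one, one_smul]

lemma EMap_surjective (σ : ℤˣ) (n : ℕ) : Function.Surjective (EMap R X M σ n) := by
  rintro ⟨c, hc⟩
  obtain ⟨z, -, hz⟩ := exists_EMap_eq σ n c (by rwa [filtLT_eq_degen (R := R) le_rfl])
  exact ⟨z, Subtype.ext hz⟩

lemma map_EMap_totFilt (σ : ℤˣ) (p n : ℕ) :
    (totFilt R X M p n).map (EMap R X M σ n) = degenFilt R X M p n := by
  refine le_antisymm ?_ fun c hc => ?_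
  · rw [Submodule.map_le_iff_le_comap]
    refine iSup_le fun i => ?_
    rintro _ ⟨b, rfl⟩
    rw [degenFilt, Submodule.mem_comap, Submodule.mem_comap, ← filtLT_succ]
    exact filtLT_mono (Nat.succ_le_succ i.2) _ (EMap_totIncl_mem_filtLT σ i.1 b)
  · rw [degenFilt, Submodule.mem_comap, ← filtLT_succ] at hc
    obtain ⟨z, hz, h⟩ := exists_EMap_eq σ _ _ hc
    exact ⟨z, hz p le_rfl, Subtype.ext h⟩

end Filtration

/-! ### The isomorphism of chain complexes -/

section Iso

open CategoryTheory

variable {R X M : Type u} [CommRing R] [AddCommGroup M] [Module R M] [Spindle X]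

/-- The isomorphism of chain complexes given by `𝓔`. -/
noncomputable def EIso (A : SpindleAction R X M) (σ : ℤˣ) : totComplex A σ ≅ degenComplex A :=
  HomologicalComplex.Hom.isoOfComponents
    (fun n => (LinearEquiv.ofBijective (EMap R X M σ n)
      ⟨EMap_injective σ n, EMap_surjective σ n⟩).toModuleIso) <| by
    rintro _ n rfl
    have h₁ : (totComplex A σ).d (n + 1) n = ModuleCat.ofHom (totD A σ n) :=
      ChainComplex.of_d (fun n => ModuleCat.of R (TotMod R X M n))
        (fun n => ModuleCat.ofHom (totD A σ n)) n
    have h₂ : (degenComplex A).d (n + 1) n = ModuleCat.ofHom (degenD A n) :=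
      ChainComplex.of_d (fun n => ModuleCat.of R (degen R X M (n + 1)))
        (fun n => ModuleCat.ofHom (degenD A n)) n
    rw [h₁, h₂]
    ext z
    exact (EMap_totD A σ n z).symm

lemma EIso_hom_f (A : SpindleAction R X M) (σ : ℤˣ) (n : ℕ) :
    (EIso A σ).hom.f n = ModuleCat.ofHom (EMap R X M σ n) := rfl

end Iso

/-! ### Cycles, boundaries and homology of sequences of modules -/

section Cycles

variable {R : Type u} [CommRing R] {C : ℕ → Type u} [∀ k, AddCommGroup (C k)]
  [∀ k, Module R (C k)]

/-- The cycles of a sequence of modules, with everything a cycle in degree `0`. -/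
def cyc (d : ∀ k, C (k + 1) →ₗ[R] C k) : ∀ k, Submodule R (C k)
  | 0 => ⊤
  | k + 1 => LinearMap.ker (d k)

/-- The homology of a sequence of modules. -/
abbrev Hmod (d : ∀ k, C (k + 1) →ₗ[R] C k) (k : ℕ) : Type u :=
  cyc d k ⧸ (LinearMap.range (d k)).comap (cyc d k).subtype

variable {d : ∀ k, C (k + 1) →ₗ[R] C k}

/-- The projection from cycles to homology. -/
abbrev toH (d : ∀ k, C (k + 1) →ₗ[R] C k) (k : ℕ) : cyc d k →ₗ[R] Hmod d k :=
  Submodule.mkQ _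

lemma comp_cyc (k : ℕ) : d k ∘ₗ (cyc d (k + 1)).subtype = 0 :=
  LinearMap.ext fun x => x.2

lemma apply_mem_cyc (hd : ∀ k, d k ∘ₗ d (k + 1) = 0) (k : ℕ) (x : C (k + 1)) :
    d k x ∈ cyc d k := by
  cases k with
  | zero => exact Submodule.mem_top
  | succ k => exact LinearMap.congr_fun (hd k) x

/-- The differential, with values in cycles. -/
def toCyc (hd : ∀ k, d k ∘ₗ d (k + 1) = 0) (k : ℕ) : C (k + 1) →ₗ[R] cyc d k :=
  (d k).codRestrict _ (apply_mem_cyc hd k)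

lemma subtype_comp_toCyc (hd : ∀ k, d k ∘ₗ d (k + 1) = 0) (k : ℕ) :
    (cyc d k).subtype ∘ₗ toCyc hd k = d k := rfl

lemma exact_toCyc (hd : ∀ k, d k ∘ₗ d (k + 1) = 0) (k : ℕ) :
    Function.Exact (toCyc hd k) (toH d k) := by
  intro x
  rw [Submodule.mkQ_apply, Submodule.Quotient.mk_eq_zero]
  exact ⟨fun ⟨y, hy⟩ => ⟨y, Subtype.ext hy⟩, fun ⟨y, hy⟩ => ⟨y, congrArg Subtype.val hy⟩⟩

/-- The inclusion of boundaries into cycles. -/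
def bdyIncl (hd : ∀ k, d k ∘ₗ d (k + 1) = 0) (k : ℕ) : LinearMap.range (d k) →ₗ[R] cyc d k :=
  Submodule.inclusion (by rintro _ ⟨x, rfl⟩; exact apply_mem_cyc hd k x)

/-- This is the presentation used for the normalized factor, whose boundaries and cycles are
projective over a principal ideal domain; `exact_toCyc` is the one used for the arbitrary factor. -/
lemma exact_bdyIncl (hd : ∀ k, d k ∘ₗ d (k + 1) = 0) (k : ℕ) :
    Function.Exact (bdyIncl hd k) (toH d k) := by
  intro x
  rw [Submodule.mkQ_apply, Submodule.Quotient.mk_eq_zero]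
  exact ⟨fun hx => ⟨⟨_, hx⟩, rfl⟩, fun ⟨y, hy⟩ => hy ▸ y.2⟩

lemma bdyIncl_comp_rangeRestrict (hd : ∀ k, d k ∘ₗ d (k + 1) = 0) (k : ℕ) :
    bdyIncl hd k ∘ₗ (d k).rangeRestrict = toCyc hd k := rfl

/-- The retraction onto cycles determined by sections of the differentials. -/
def retract (t : ∀ k, LinearMap.range (d k) →ₗ[R] C (k + 1))
    (ht : ∀ k, (d k).rangeRestrict ∘ₗ t k = LinearMap.id) : ∀ k, C k →ₗ[R] cyc d k
  | 0 => LinearMap.id.codRestrict _ fun _ => Submodule.mem_top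
  | k + 1 => (LinearMap.id - t k ∘ₗ (d k).rangeRestrict).codRestrict _ fun x => by
      have := congrArg Subtype.val (LinearMap.congr_fun (ht k) ((d k).rangeRestrict x))
      change d k (t k _) = d k x at this
      change d k (x - t k _) = 0
      rw [map_sub, this, sub_self]

lemma comp_section {t : ∀ k, LinearMap.range (d k) →ₗ[R] C (k + 1)}
    (ht : ∀ k, (d k).rangeRestrict ∘ₗ t k = LinearMap.id) (k : ℕ) :
    d k ∘ₗ t k = (LinearMap.range (d k)).subtype :=
  LinearMap.ext fun x => congrArg Subtype.val (LinearMap.congr_fun (ht k) x)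

variable (t : ∀ k, LinearMap.range (d k) →ₗ[R] C (k + 1))
    (ht : ∀ k, (d k).rangeRestrict ∘ₗ t k = LinearMap.id)

lemma subtype_retract_zero : (cyc d 0).subtype ∘ₗ retract t ht 0 = LinearMap.id := rfl

lemma subtype_retract_succ (k : ℕ) : (cyc d (k + 1)).subtype ∘ₗ retract t ht (k + 1)
    = LinearMap.id - t k ∘ₗ (d k).rangeRestrict := rfl

lemma retract_subtype (k : ℕ) : retract t ht k ∘ₗ (cyc d k).subtype = LinearMap.id := by
  cases k with
  | zero => rfl
  | succ k =>
    ext x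
    have : (d k).rangeRestrict (x : C (k + 1)) = 0 := Subtype.ext x.2
    change (x : C (k + 1)) - t k ((d k).rangeRestrict x) = x
    rw [this, map_zero, sub_zero]

lemma retract_comp (hd : ∀ k, d k ∘ₗ d (k + 1) = 0) (k : ℕ) :
    retract t ht k ∘ₗ d k = bdyIncl hd k ∘ₗ (d k).rangeRestrict := by
  rw [bdyIncl_comp_rangeRestrict, ← subtype_comp_toCyc hd, ← LinearMap.comp_assoc, retract_subtype,
    LinearMap.id_comp]

lemma rangeRestrict_subtype (k : ℕ) : (d k).rangeRestrict ∘ₗ (cyc d (k + 1)).subtype = 0 :=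
  LinearMap.ext fun x => Subtype.ext x.2

lemma rangeRestrict_comp (hd : ∀ k, d k ∘ₗ d (k + 1) = 0) (k : ℕ) :
    (d k).rangeRestrict ∘ₗ d (k + 1) = 0 :=
  LinearMap.ext fun x => Subtype.ext (LinearMap.congr_fun (hd k) x)

lemma subtype_comp_rangeRestrict (k : ℕ) :
    (LinearMap.range (d k)).subtype ∘ₗ (d k).rangeRestrict = d k := rfl

lemma subtype_comp_bdyIncl (hd : ∀ k, d k ∘ₗ d (k + 1) = 0) (k : ℕ) :
    (cyc d k).subtype ∘ₗ bdyIncl hd k = (LinearMap.range (d k)).subtype := rfl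

end Cycles

/-! ### Exactness of tensor products in terms of elements -/

section TensorLemmas

variable {R : Type u} [CommRing R] {A B C A' B' C' : Type u} [AddCommGroup A] [AddCommGroup B]
  [AddCommGroup C] [AddCommGroup A'] [AddCommGroup B'] [AddCommGroup C'] [Module R A] [Module R B]
  [Module R C] [Module R A'] [Module R B'] [Module R C']

lemma map_map' (f : A →ₗ[R] B) (g : B →ₗ[R] C) (f' : A' →ₗ[R] B') (g' : B' →ₗ[R] C')
    (x : A ⊗[R] A') : map g g' (map f f' x) = map (g ∘ₗ f) (g' ∘ₗ f') x := by
  rw [map_comp, LinearMap.comp_apply]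

lemma map_id_injective [Module.Flat R C] {f : A →ₗ[R] B} (hf : Function.Injective f) :
    Function.Injective (map f (LinearMap.id : C →ₗ[R] C)) :=
  Module.Flat.rTensor_preserves_injective_linearMap f hf

lemma exists_of_map_id_eq_zero [Module.Flat R A'] {f : A →ₗ[R] B} {g : B →ₗ[R] C}
    (h : Function.Exact f g) {x : B ⊗[R] A'} (hx : map g LinearMap.id x = 0) :
    ∃ y : A ⊗[R] A', map f LinearMap.id y = x :=
  (Module.Flat.rTensor_exact A' h x).1 hx

lemma exists_of_map_id_eq_zero' {f : A →ₗ[R] B} {g : B →ₗ[R] C} (h : Function.Exact f g)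
    (hg : Function.Surjective g) {x : B ⊗[R] A'} (hx : map g LinearMap.id x = 0) :
    ∃ y : A ⊗[R] A', map f LinearMap.id y = x :=
  (rTensor_exact A' h hg x).1 hx

lemma exists_of_map_eq_zero {f : A →ₗ[R] B} {g : B →ₗ[R] C} (h : Function.Exact f g)
    (hg : Function.Surjective g) {f' : A' →ₗ[R] B'} {g' : B' →ₗ[R] C'} (h' : Function.Exact f' g')
    (hg' : Function.Surjective g') {x : B ⊗[R] B'} (hx : map g g' x = 0) :
    ∃ (y : A ⊗[R] B') (z : B ⊗[R] A'), x = map f LinearMap.id y + map LinearMap.id f' z := by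
  have hk := TensorProduct.map_ker h hg h' hg'
  have hx' : x ∈ LinearMap.ker (map g g') := hx
  rw [hk, Submodule.mem_sup] at hx'
  obtain ⟨_, ⟨z, rfl⟩, _, ⟨y, rfl⟩, rfl⟩ := hx'
  exact ⟨y, z, add_comm _ _⟩

end TensorLemmas

/-! ### Surjections with equal kernels -/

section EquivOfKerEq

variable {R : Type u} [CommRing R] {A B C : Type u} [AddCommMonoid A] [AddCommMonoid B]
  [AddCommMonoid C] [Module R A] [Module R B] [Module R C]

/-- Scalar multiplication by -1 provides the additive inverses, although only monoid structures are
given. -/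
lemma apply_eq_of_ker_le {f : A →ₗ[R] B} {g : A →ₗ[R] C}
    (h : LinearMap.ker f ≤ LinearMap.ker g) {a b : A} (hab : f a = f b) : g a = g b := by
  have h₁ : ∀ c : A, c + (-1 : R) • c = 0 := fun c => by
    rw [← one_smul R c, smul_smul, ← add_smul, mul_one, add_neg_cancel, zero_smul]
  have h₂ : g (a + (-1 : R) • b) = 0 := h <| by
    rw [LinearMap.mem_ker, map_add, hab, ← map_add, h₁, map_zero]
  calc g a = g (a + (b + (-1 : R) • b)) := by rw [h₁, add_zero]
    _ = g (a + (-1 : R) • b) + g b := by rw [← map_add, add_assoc, add_comm b]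
    _ = g b := by rw [h₂, zero_add]

/-- The linear map `B → C` induced by `g : A → C` along a surjection `f : A → B`. -/
noncomputable def descend {f : A →ₗ[R] B} {g : A →ₗ[R] C} (hf : Function.Surjective f)
    (h : LinearMap.ker f ≤ LinearMap.ker g) : B →ₗ[R] C where
  toFun b := g (Function.surjInv hf b)
  map_add' b c := by
    rw [← map_add]
    exact apply_eq_of_ker_le h (by simp only [map_add, Function.surjInv_eq])
  map_smul' r b := by
    rw [RingHom.id_apply, ← map_smul]
    exact apply_eq_of_ker_le h (by simp only [map_smul, Function.surjInv_eq])

lemma descend_apply {f : A →ₗ[R] B} {g : A →ₗ[R] C} (hf : Function.Surjective f)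
    (h : LinearMap.ker f ≤ LinearMap.ker g) (a : A) : descend hf h (f a) = g a :=
  apply_eq_of_ker_le h (Function.surjInv_eq hf _)

/-- Two surjections with the same kernel have isomorphic targets. -/
noncomputable def equivOfKerEq {f : A →ₗ[R] B} {g : A →ₗ[R] C} (hf : Function.Surjective f)
    (hg : Function.Surjective g) (h : LinearMap.ker f = LinearMap.ker g) : B ≃ₗ[R] C :=
  LinearEquiv.ofLinearMap (descend hf h.le) (descend hg h.ge)
    (LinearMap.ext fun c => by
      obtain ⟨a, rfl⟩ := hg c
      rw [LinearMap.comp_apply, descend_apply, descend_apply, LinearMap.id_apply])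
    (LinearMap.ext fun b => by
      obtain ⟨a, rfl⟩ := hf b
      rw [LinearMap.comp_apply, descend_apply, descend_apply, LinearMap.id_apply])

lemma equivOfKerEq_apply {f : A →ₗ[R] B} {g : A →ₗ[R] C} (hf : Function.Surjective f)
    (hg : Function.Surjective g) (h : LinearMap.ker f = LinearMap.ker g) (a : A) :
    equivOfKerEq hf hg h (f a) = g a :=
  descend_apply hf h.le a

end EquivOfKerEq

/-! ### Künneth theorem: sources of cycles in the tensor product -/

section Kunneth

variable {R : Type u} [CommRing R] {C N : ℕ → Type u} [∀ k, AddCommGroup (C k)]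
  [∀ k, Module R (C k)] [∀ k, AddCommGroup (N k)] [∀ k, Module R (N k)]

/-- Auxiliary data for the Künneth theorem: sections of the differentials of `N` onto their
images, signs, and a two-term resolution of the homology of `C` that maps to `C`. -/
structure KunnethData (d : ∀ k, C (k + 1) →ₗ[R] C k) (e : ∀ k, N (k + 1) →ₗ[R] N k) where
  hd : ∀ k, d k ∘ₗ d (k + 1) = 0
  he : ∀ k, e k ∘ₗ e (k + 1) = 0
  t : ∀ k, LinearMap.range (e k) →ₗ[R] N (k + 1)
  ht : ∀ k, (e k).rangeRestrict ∘ₗ t k = LinearMap.id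
  flat_cyc : ∀ k, Module.Flat R (cyc e k)
  flat_bdy : ∀ k, Module.Flat R (LinearMap.range (e k))
  s : ℕ → R
  s_mul_self : ∀ k, s k * s k = 1
  s_succ : ∀ k, s (k + 1) = - s k
  F : ℕ → Type u
  [acgF : ∀ k, AddCommGroup (F k)]
  [modF : ∀ k, Module R (F k)]
  φ₀ : ∀ k, F k →ₗ[R] cyc d k
  surj : ∀ k, Function.Surjective (φ₀ k)
  φ₁ : ∀ k, LinearMap.ker (toH d k ∘ₗ φ₀ k) →ₗ[R] C (k + 1)
  hφ : ∀ k, toCyc hd k ∘ₗ φ₁ k = φ₀ k ∘ₗ (LinearMap.ker (toH d k ∘ₗ φ₀ k)).subtype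

attribute [instance] KunnethData.acgF KunnethData.modF

variable (C N) in
/-- The total module of the tensor product in degree `n`, as a module of functions. -/
abbrev TotPi (R : Type u) [CommRing R] [∀ k, Module R (C k)] [∀ k, Module R (N k)] (n : ℕ) :
    Type u :=
  ∀ i : TotIdx n, C i.1.1 ⊗[R] N i.1.2

/-- The total differential. -/
noncomputable def totPiD (d : ∀ k, C (k + 1) →ₗ[R] C k) (e : ∀ k, N (k + 1) →ₗ[R] N k) (s : ℕ → R)
    (n : ℕ) : TotPi C N R (n + 1) →ₗ[R] TotPi C N R n :=
  LinearMap.pi fun i =>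
    map (d i.1.1) LinearMap.id ∘ₗ
        LinearMap.proj (⟨(i.1.1 + 1, i.1.2), by have := i.2; omega⟩ : TotIdx (n + 1))
      + s i.1.1 • (map LinearMap.id (e i.1.2) ∘ₗ
        LinearMap.proj (⟨(i.1.1, i.1.2 + 1), by have := i.2; omega⟩ : TotIdx (n + 1)))

lemma totPiD_apply (d : ∀ k, C (k + 1) →ₗ[R] C k) (e : ∀ k, N (k + 1) →ₗ[R] N k) (s : ℕ → R)
    (n : ℕ) (x : TotPi C N R (n + 1)) (k p : ℕ) (h : k + p + 1 = n) :
    totPiD d e s n x ⟨(k, p), h⟩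
      = map (d k) LinearMap.id (x ⟨(k + 1, p), by omega⟩)
        + s k • map LinearMap.id (e p) (x ⟨(k, p + 1), by omega⟩) := rfl

namespace KunnethData

variable {d : ∀ k, C (k + 1) →ₗ[R] C k} {e : ∀ k, N (k + 1) →ₗ[R] N k} (K : KunnethData d e)

/-- The relation module of the resolution. -/
abbrev G (k : ℕ) : Submodule R (K.F k) := LinearMap.ker (toH d k ∘ₗ K.φ₀ k)

lemma exact_G (k : ℕ) : Function.Exact (K.G k).subtype (toH d k ∘ₗ K.φ₀ k) :=
  LinearMap.exact_subtype_ker_map _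

lemma surj_toH (k : ℕ) : Function.Surjective (toH d k ∘ₗ K.φ₀ k) :=
  (Submodule.mkQ_surjective _).comp (K.surj k)

/-- Pairs in `G ⊗ Z_p` and `F ⊗ B_p` with the same image in `F ⊗ Z_p`. -/
noncomputable abbrev U (k p : ℕ) :
    Submodule R ((K.G k ⊗[R] cyc e p) × (K.F k ⊗[R] LinearMap.range (e p))) :=
  LinearMap.ker (map (K.G k).subtype LinearMap.id ∘ₗ LinearMap.fst R _ _
    - map LinearMap.id (bdyIncl K.he p) ∘ₗ LinearMap.snd R _ _)

lemma U_eq {k p : ℕ} (u : K.U k p) :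
    map (K.G k).subtype LinearMap.id u.1.1 = map LinearMap.id (bdyIncl K.he p) u.1.2 :=
  sub_eq_zero.1 u.2

/-- The kernel of `H_k ⊗ B_p → H_k ⊗ Z_p`. -/
noncomputable abbrev torKer (k p : ℕ) : Submodule R (Hmod d k ⊗[R] LinearMap.range (e p)) :=
  LinearMap.ker (map (LinearMap.id : Hmod d k →ₗ[R] Hmod d k) (bdyIncl K.he p))

/-- The projection of `U` to the kernel of `H_k ⊗ B_p → H_k ⊗ Z_p`. -/
noncomputable def toTorKer (k p : ℕ) : K.U k p →ₗ[R] K.torKer k p :=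
  (map (toH d k ∘ₗ K.φ₀ k) LinearMap.id ∘ₗ LinearMap.snd R _ _ ∘ₗ (K.U k p).subtype).codRestrict _
    fun u => by
      change map _ _ (map _ _ u.1.2) = 0
      rw [map_map', LinearMap.id_comp, LinearMap.comp_id]
      have h := congrArg (map (toH d k ∘ₗ K.φ₀ k) LinearMap.id) (K.U_eq u)
      rw [map_map', map_map', (K.exact_G k).linearMap_comp_eq_zero, map_zero_left,
        LinearMap.zero_apply, LinearMap.comp_id, LinearMap.id_comp] at h
      exact h.symm

lemma coe_toTorKer {k p : ℕ} (u : K.U k p) :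
    (K.toTorKer k p u : Hmod d k ⊗[R] LinearMap.range (e p))
      = map (toH d k ∘ₗ K.φ₀ k) LinearMap.id u.1.2 := rfl

/-- An element of F ⊗ B that dies in H ⊗ Z has an image in F ⊗ Z that comes from G ⊗ Z, by right
exactness. -/
lemma exists_U {k p : ℕ} (u : K.F k ⊗[R] LinearMap.range (e p))
    (hu : map (toH d k ∘ₗ K.φ₀ k) (bdyIncl K.he p) u = 0) : ∃ v : K.U k p, v.1.2 = u := by
  obtain ⟨v, hv⟩ := exists_of_map_id_eq_zero' (K.exact_G k) (K.surj_toH k)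
    (x := map LinearMap.id (bdyIncl K.he p) u) (by rw [map_map']; exact hu)
  exact ⟨⟨(v, u), sub_eq_zero.2 hv⟩, rfl⟩

lemma toTorKer_surjective (k p : ℕ) : Function.Surjective (K.toTorKer k p) := by
  rintro ⟨x, hx⟩
  have hid : Function.Surjective
      (LinearMap.id : LinearMap.range (e p) →ₗ[R] LinearMap.range (e p)) :=
    Function.surjective_id
  obtain ⟨u, rfl⟩ := TensorProduct.map_surjective (K.surj_toH k) hid x
  obtain ⟨v, rfl⟩ := K.exists_U u (by
    rw [LinearMap.mem_ker, map_map', LinearMap.id_comp, LinearMap.comp_id] at hx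
    exact hx)
  exact ⟨v, rfl⟩

/-- The second component comes from G ⊗ B by right exactness. The first is then forced, because
flatness of the cycles makes G ⊗ Z → F ⊗ Z injective. -/
lemma exists_of_toTorKer_eq_zero {k p : ℕ} {u : K.U k p} (hu : K.toTorKer k p u = 0) :
    ∃ v : K.G k ⊗[R] LinearMap.range (e p), u.1.1 = map LinearMap.id (bdyIncl K.he p) v ∧
      u.1.2 = map (K.G k).subtype LinearMap.id v := by
  have h0 := congrArg Subtype.val hu
  rw [coe_toTorKer] at h0
  obtain ⟨v, hv⟩ := exists_of_map_id_eq_zero' (K.exact_G k) (K.surj_toH k) h0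
  refine ⟨v, ?_, hv.symm⟩
  have := K.flat_cyc p
  apply map_id_injective (C := cyc e p) (K.G k).subtype_injective
  rw [U_eq, ← hv, map_map', map_map']
  rfl

/-- Sources of the two kinds of classes in degree `n`. -/
abbrev Src (n : ℕ) : Type u :=
  (∀ i : TotIdx n, cyc d i.1.1 ⊗[R] cyc e i.1.2) × (∀ j : TorIdx n, K.U j.1.1 j.1.2)

/-- The first component of an element of `U`. -/
noncomputable def Ufst (k p : ℕ) : K.U k p →ₗ[R] K.G k ⊗[R] cyc e p :=
  LinearMap.fst R (K.G k ⊗[R] cyc e p) (K.F k ⊗[R] LinearMap.range (e p)) ∘ₗ (K.U k p).subtype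

/-- The second component of an element of `U`. -/
noncomputable def Usnd (k p : ℕ) : K.U k p →ₗ[R] K.F k ⊗[R] LinearMap.range (e p) :=
  LinearMap.snd R (K.G k ⊗[R] cyc e p) (K.F k ⊗[R] LinearMap.range (e p)) ∘ₗ (K.U k p).subtype

/-- The contribution of `U_{k-1,p}` to the component at `(k, p)`. -/
noncomputable def partL {n : ℕ} : ∀ k p : ℕ, k + p + 1 = n →
    ((∀ j : TorIdx n, K.U j.1.1 j.1.2) →ₗ[R] C k ⊗[R] N p)
  | 0, _, _ => 0
  | k + 1, p, h => - K.s k • (map (K.φ₁ k) (cyc e p).subtype ∘ₗ K.Ufst k p ∘ₗ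
      LinearMap.proj (⟨(k, p), by omega⟩ : TorIdx n))

/-- The contribution of `U_{k,p-1}` to the component at `(k, p)`. -/
noncomputable def partR {n : ℕ} : ∀ k p : ℕ, k + p + 1 = n →
    ((∀ j : TorIdx n, K.U j.1.1 j.1.2) →ₗ[R] C k ⊗[R] N p)
  | _, 0, _ => 0
  | k, p + 1, h => map ((cyc d k).subtype ∘ₗ K.φ₀ k) (K.t p) ∘ₗ K.Usnd k p ∘ₗ
      LinearMap.proj (⟨(k, p), by omega⟩ : TorIdx n)

lemma partL_zero {n p : ℕ} (h : 0 + p + 1 = n) (u : ∀ j : TorIdx n, K.U j.1.1 j.1.2) :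
    K.partL 0 p h u = 0 := rfl

lemma partL_succ {n k p : ℕ} (h : k + 1 + p + 1 = n) (u : ∀ j : TorIdx n, K.U j.1.1 j.1.2) :
    K.partL (k + 1) p h u
      = - K.s k • map (K.φ₁ k) (cyc e p).subtype (u ⟨(k, p), by omega⟩).1.1 := rfl

lemma partR_zero {n k : ℕ} (h : k + 0 + 1 = n) (u : ∀ j : TorIdx n, K.U j.1.1 j.1.2) :
    K.partR k 0 h u = 0 := by
  cases k <;> rfl

lemma partR_succ {n k p : ℕ} (h : k + (p + 1) + 1 = n) (u : ∀ j : TorIdx n, K.U j.1.1 j.1.2) :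
    K.partR k (p + 1) h u
      = map ((cyc d k).subtype ∘ₗ K.φ₀ k) (K.t p) (u ⟨(k, p), by omega⟩).1.2 := by
  cases k <;> rfl

/-- The map from sources to the total module. -/
noncomputable def cycleMap (n : ℕ) : K.Src n →ₗ[R] TotPi C N R n :=
  LinearMap.pi fun i =>
    map (cyc d i.1.1).subtype (cyc e i.1.2).subtype ∘ₗ LinearMap.proj i ∘ₗ
        LinearMap.fst R (∀ i : TotIdx n, cyc d i.1.1 ⊗[R] cyc e i.1.2) _
      + (K.partL i.1.1 i.1.2 i.2 + K.partR i.1.1 i.1.2 i.2) ∘ₗ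
        LinearMap.snd R (∀ i : TotIdx n, cyc d i.1.1 ⊗[R] cyc e i.1.2) _

lemma cycleMap_apply {n : ℕ} (w : K.Src n) {k p : ℕ} (h : k + p + 1 = n) :
    K.cycleMap n w ⟨(k, p), h⟩ = map (cyc d k).subtype (cyc e p).subtype (w.1 ⟨(k, p), h⟩)
      + (K.partL k p h w.2 + K.partR k p h w.2) := rfl

lemma map_id_partR {n : ℕ} (u : ∀ j : TorIdx n, K.U j.1.1 j.1.2) {k p : ℕ} (h : k + 1 + p + 1 = n) :
    map (d k) LinearMap.id (K.partR (k + 1) p h u) = 0 := by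
  cases p with
  | zero => rw [partR_zero, map_zero]
  | succ p =>
    rw [partR_succ, map_map', ← LinearMap.comp_assoc, comp_cyc, LinearMap.zero_comp, map_zero_left,
      LinearMap.zero_apply]

lemma map_range_partL {n : ℕ} (u : ∀ j : TorIdx n, K.U j.1.1 j.1.2) {k p : ℕ}
    (h : k + (p + 1) + 1 = n) :
    map (LinearMap.id : C k →ₗ[R] C k) (e p).rangeRestrict (K.partL k (p + 1) h u) = 0 := by
  cases k with
  | zero => rw [partL_zero, map_zero]
  | succ k =>
    rw [partL_succ, map_smul, map_map', rangeRestrict_subtype, map_zero_right, LinearMap.zero_apply,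
      smul_zero]

/-- Mapping N_{p+1} to its boundaries kills all contributions of cycles and undoes the section `t`.
So the F ⊗ B component of a source can be read off, up to its image in C ⊗ B, from the cycle it
produces. -/
lemma map_range_cycleMap {n : ℕ} (w : K.Src n) {k p : ℕ} (h : k + (p + 1) + 1 = n) :
    map (LinearMap.id : C k →ₗ[R] C k) (e p).rangeRestrict (K.cycleMap n w ⟨(k, p + 1), h⟩)
      = map ((cyc d k).subtype ∘ₗ K.φ₀ k) LinearMap.id (w.2 ⟨(k, p), by omega⟩).1.2 := by
  rw [cycleMap_apply, map_add, map_add, map_range_partL, map_map', rangeRestrict_subtype,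
    map_zero_right, LinearMap.zero_apply, zero_add, zero_add, partR_succ, map_map', K.ht,
    LinearMap.id_comp]

lemma map_e_eq {k p : ℕ} (x : C k ⊗[R] N (p + 1)) :
    map (LinearMap.id : C k →ₗ[R] C k) (e p) x
      = map LinearMap.id (LinearMap.range (e p)).subtype
        (map LinearMap.id (e p).rangeRestrict x) := by
  rw [map_map', LinearMap.id_comp, subtype_comp_rangeRestrict]

/-- Both sides are images of the common element of F ⊗ Z under F → C. This is the cancellation
behind `totPiD_cycleMap`, the sign in `partL` being chosen accordingly. -/
lemma U_rel {k p : ℕ} (u : K.U k p) :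
    map (d k) LinearMap.id (map (K.φ₁ k) (cyc e p).subtype u.1.1)
      = map LinearMap.id (LinearMap.range (e p)).subtype
        (map ((cyc d k).subtype ∘ₗ K.φ₀ k) LinearMap.id u.1.2) := by
  have hu := congrArg (map ((cyc d k).subtype ∘ₗ K.φ₀ k) (cyc e p).subtype) (K.U_eq u)
  have hφ : d k ∘ₗ K.φ₁ k = ((cyc d k).subtype ∘ₗ K.φ₀ k) ∘ₗ (K.G k).subtype := by
    rw [LinearMap.comp_assoc, ← K.hφ k, ← LinearMap.comp_assoc, subtype_comp_toCyc]
  rw [map_map', map_map', ← hφ] at hu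
  rw [map_map', map_map']
  exact hu

lemma map_d_cycleMap {n : ℕ} (w : K.Src n) {k p : ℕ} (h : k + 1 + p + 1 = n) :
    map (d k) (LinearMap.id : N p →ₗ[R] N p) (K.cycleMap n w ⟨(k + 1, p), h⟩)
      = - K.s k • map (d k) LinearMap.id
        (map (K.φ₁ k) (cyc e p).subtype (w.2 ⟨(k, p), by omega⟩).1.1) := by
  rw [cycleMap_apply, map_add, map_add, map_id_partR, map_map', comp_cyc, map_zero_left,
    LinearMap.zero_apply, zero_add, add_zero, partL_succ, map_smul]

/-- The image of `cycleMap` consists of cycles. -/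
lemma totPiD_cycleMap {n : ℕ} (w : K.Src (n + 1)) :
    totPiD d e K.s n (K.cycleMap (n + 1) w) = 0 := by
  funext ⟨⟨k, p⟩, h⟩
  change k + p + 1 = n at h
  rw [totPiD_apply, map_e_eq, map_range_cycleMap, map_d_cycleMap, U_rel, neg_smul, neg_add_cancel]
  rfl

/-- After projection to C ⊗ B only the differential of C remains, so total boundaries become
boundaries of the complex C ⊗ B. -/
lemma map_range_totPiD {n : ℕ} (x : TotPi C N R (n + 1)) {k p : ℕ} (h : k + (p + 1) + 1 = n) :
    map (LinearMap.id : C k →ₗ[R] C k) (e p).rangeRestrict (totPiD d e K.s n x ⟨(k, p + 1), h⟩)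
      = map (d k) LinearMap.id
        (map LinearMap.id (e p).rangeRestrict (x ⟨(k + 1, p + 1), by omega⟩)) := by
  rw [totPiD_apply, map_add, map_smul, map_map', map_map', map_map', rangeRestrict_comp K.he,
    map_zero_right, LinearMap.zero_apply, smul_zero, add_zero]
  rfl

/-- Tensoring with a flat module preserves the kernel of d. -/
lemma exists_of_mem_cyc {W : Type u} [AddCommGroup W] [Module R W] [Module.Flat R W] {k : ℕ}
    {x : C k ⊗[R] W}
    (hx : x ∈ cyc (C := fun k => C k ⊗[R] W) (fun k => map (d k) LinearMap.id) k) :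
    ∃ y : cyc d k ⊗[R] W, map (cyc d k).subtype LinearMap.id y = x := by
  cases k with
  | zero =>
    exact TensorProduct.map_surjective (g := (cyc d 0).subtype)
      (g' := (LinearMap.id : W →ₗ[R] W)) (fun x => ⟨⟨x, Submodule.mem_top⟩, rfl⟩)
      Function.surjective_id x
  | succ k => exact exists_of_map_id_eq_zero (LinearMap.exact_subtype_ker_map (d k)) hx

/-- The classes of sources. -/
noncomputable def classMap (n : ℕ) : K.Src n →ₗ[R]
    (∀ i : TotIdx n, Hmod d i.1.1 ⊗[R] Hmod e i.1.2) × (∀ j : TorIdx n, K.torKer j.1.1 j.1.2) :=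
  LinearMap.prodMap
    (LinearMap.pi fun i => map (toH d i.1.1) (toH e i.1.2) ∘ₗ LinearMap.proj i)
    (LinearMap.pi fun j => K.toTorKer j.1.1 j.1.2 ∘ₗ LinearMap.proj j)

lemma classMap_surjective (n : ℕ) : Function.Surjective (K.classMap n) := by
  rintro ⟨x, y⟩
  have h₁ : ∀ i : TotIdx n, ∃ z, map (toH d i.1.1) (toH e i.1.2) z = x i := fun i =>
    TensorProduct.map_surjective (Submodule.mkQ_surjective _) (Submodule.mkQ_surjective _) _
  have h₂ : ∀ j : TorIdx n, ∃ u, K.toTorKer j.1.1 j.1.2 u = y j := fun j =>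
    K.toTorKer_surjective _ _ _
  choose z hz using h₁
  choose u hu using h₂
  exact ⟨(z, u), Prod.ext (funext hz) (funext hu)⟩

end KunnethData

end Kunneth

/-! ### Künneth theorem: which sources bound, and why they give all cycles -/

namespace KunnethData

variable {R : Type u} [CommRing R] {C N : ℕ → Type u} [∀ k, AddCommGroup (C k)]
  [∀ k, Module R (C k)] [∀ k, AddCommGroup (N k)] [∀ k, Module R (N k)]
  {d : ∀ k, C (k + 1) →ₗ[R] C k} {e : ∀ k, N (k + 1) →ₗ[R] N k} (K : KunnethData d e)

lemma cycleMap_snd_mem_range {n : ℕ} {u : ∀ j : TorIdx n, K.U j.1.1 j.1.2}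
    (hu : ∀ j, K.toTorKer j.1.1 j.1.2 (u j) = 0) :
    K.cycleMap n (0, u) ∈ LinearMap.range (totPiD d e K.s n) := by
  choose v hv₁ hv₂ using fun j => K.exists_of_toTorKer_eq_zero (hu j)
  -- The vanishing Tor class means that u comes from v in G ⊗ B. The bounding chain is φ₁ ⊗ t
  -- applied to v: d produces `partR`, and e produces `partL` by the alternation of the signs s.
  let x : ∀ k p : ℕ, k + p + 1 = n + 1 → C k ⊗[R] N p
    | 0, _, _ => 0
    | _ + 1, 0, _ => 0
    | k + 1, p + 1, h => map (K.φ₁ k) (K.t p) (v ⟨(k, p), by omega⟩)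
  refine ⟨fun i => x i.1.1 i.1.2 i.2, ?_⟩
  funext ⟨⟨k, p⟩, h⟩
  change k + p + 1 = n at h
  have hR : map (d k) LinearMap.id (x (k + 1) p (by omega)) = K.partR k p h u := by
    rcases p with _ | p
    · rw [partR_zero]
      exact map_zero _
    · have hφ : d k ∘ₗ K.φ₁ k = ((cyc d k).subtype ∘ₗ K.φ₀ k) ∘ₗ (K.G k).subtype := by
        rw [LinearMap.comp_assoc, ← K.hφ k, ← LinearMap.comp_assoc, subtype_comp_toCyc]
      rw [partR_succ, hv₂, map_map', map_map', hφ]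
      rfl
  have hL : K.s k • map LinearMap.id (e p) (x k (p + 1) (by omega)) = K.partL k p h u := by
    rcases k with _ | k
    · rw [partL_zero]
      exact (congrArg _ (map_zero _)).trans (smul_zero _)
    · rw [partL_succ, hv₁, map_map', map_map', comp_section K.ht, K.s_succ]
      rfl
  have h₀ : map (cyc d k).subtype (cyc e p).subtype
      ((0 : ∀ i : TotIdx n, cyc d i.1.1 ⊗[R] cyc e i.1.2) ⟨(k, p), h⟩) = 0 := map_zero _
  rw [totPiD_apply, cycleMap_apply, ← hR, ← hL, h₀, zero_add, add_comm]

lemma cycleMap_fst_mem_range {n : ℕ} {z : ∀ i : TotIdx n, cyc d i.1.1 ⊗[R] cyc e i.1.2}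
    (hz : ∀ i : TotIdx n, map (toH d i.1.1) (toH e i.1.2) (z i) = 0) :
    K.cycleMap n (z, 0) ∈ LinearMap.range (totPiD d e K.s n) := by
  choose y w hyw using fun i => exists_of_map_eq_zero (exact_toCyc K.hd _)
    (Submodule.mkQ_surjective _) (exact_bdyIncl K.he _) (Submodule.mkQ_surjective _) (hz i)
  -- The element z splits into a part with boundaries on the left and a part with boundaries on the
  -- right; `a` bounds the first and `b` the second. The factor s in `b` is cancelled because s
  -- squares to 1.
  let a : ∀ k p : ℕ, k + p + 1 = n + 1 → C k ⊗[R] N p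
    | 0, _, _ => 0
    | k + 1, p, h => map LinearMap.id (cyc e p).subtype (y ⟨(k, p), by omega⟩)
  let b : ∀ k p : ℕ, k + p + 1 = n + 1 → C k ⊗[R] N p
    | _, 0, _ => 0
    | k, p + 1, h => K.s k • map (cyc d k).subtype (K.t p) (w ⟨(k, p), by omega⟩)
  have ha₀ : ∀ p h, a 0 p h = 0 := fun _ _ => rfl
  have ha₁ : ∀ k p h, a (k + 1) p h
    = map LinearMap.id (cyc e p).subtype (y ⟨(k, p), by omega⟩) := fun _ _ _ => rfl
  have hb₀ : ∀ k h, b k 0 h = 0 := fun k h => by cases k <;> rfl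
  have hb₁ : ∀ k p h, b k (p + 1) h
    = K.s k • map (cyc d k).subtype (K.t p) (w ⟨(k, p), by omega⟩) := fun k _ _ => by
      cases k <;> rfl
  refine ⟨fun i => a i.1.1 i.1.2 i.2 + b i.1.1 i.1.2 i.2, ?_⟩
  funext ⟨⟨k, p⟩, h⟩
  change k + p + 1 = n at h
  have ha : ∀ h', map LinearMap.id (e p) (a k (p + 1) h') = 0 := fun h' => by
    rcases k with _ | k
    · rw [ha₀ _ h', map_zero]
    · rw [ha₁ _ _ h', map_map', comp_cyc, map_zero_right, LinearMap.zero_apply]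
  have hb : ∀ h', map (d k) LinearMap.id (b (k + 1) p h') = 0 := fun h' => by
    rcases p with _ | p
    · rw [hb₀ _ h', map_zero]
    · rw [hb₁ _ _ h', map_smul, map_map', comp_cyc, map_zero_left, LinearMap.zero_apply, smul_zero]
  rw [totPiD_apply, cycleMap_apply, map_zero, map_zero, add_zero, add_zero]
  change map (d k) LinearMap.id (a (k + 1) p (by omega) + b (k + 1) p (by omega))
    + K.s k • map LinearMap.id (e p) (a k (p + 1) (by omega) + b k (p + 1) (by omega))
      = map (cyc d k).subtype (cyc e p).subtype (z ⟨(k, p), h⟩)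
  rw [hyw, map_add, map_add, ha, hb, ha₁ _ _ (by omega), hb₁ _ _ (by omega), add_zero, zero_add,
    map_smul, smul_smul, K.s_mul_self, one_smul, map_add, map_map', map_map', map_map', map_map',
    comp_section K.ht, subtype_comp_toCyc, subtype_comp_bdyIncl]
  rfl

/-- In C ⊗ B the cycle becomes a d-boundary. Flatness of B transfers this to Z ⊗ B, with Z the
cycles of C, so the class in H ⊗ B is zero. -/
lemma toTorKer_eq_zero_of_mem_range {n : ℕ} {w : K.Src n}
    (hw : K.cycleMap n w ∈ LinearMap.range (totPiD d e K.s n)) (j : TorIdx n) :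
    K.toTorKer j.1.1 j.1.2 (w.2 j) = 0 := by
  obtain ⟨x, hx⟩ := hw
  obtain ⟨⟨k, p⟩, h⟩ := j
  change k + p + 1 + 1 = n at h
  have h₁ := K.map_range_totPiD x (k := k) (p := p) (by omega)
  rw [hx, map_range_cycleMap] at h₁
  have := K.flat_bdy p
  have h₂ : map (K.φ₀ k) LinearMap.id (w.2 ⟨(k, p), h⟩).1.2
      = map (toCyc K.hd k) LinearMap.id
        (map LinearMap.id (e p).rangeRestrict (x ⟨(k + 1, p + 1), by omega⟩)) := by
    apply map_id_injective (C := LinearMap.range (e p)) (cyc d k).subtype_injective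
    rw [map_map', map_map', subtype_comp_toCyc, LinearMap.id_comp]
    exact h₁
  apply Subtype.ext
  rw [coe_toTorKer, ← LinearMap.id_comp (LinearMap.id : LinearMap.range (e p) →ₗ[R] _), ← map_map',
    h₂, map_map', (exact_toCyc K.hd k).linearMap_comp_eq_zero, map_zero_left]
  rfl

lemma map_toH_eq_zero_of_mem_range {n : ℕ} {z : ∀ i : TotIdx n, cyc d i.1.1 ⊗[R] cyc e i.1.2}
    (hz : K.cycleMap n (z, 0) ∈ LinearMap.range (totPiD d e K.s n)) (i : TotIdx n) :
    map (toH d i.1.1) (toH e i.1.2) (z i) = 0 := by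
  obtain ⟨x, hx⟩ := hz
  obtain ⟨⟨k, p⟩, h⟩ := i
  change k + p + 1 = n at h
  have := K.flat_bdy p
  have := K.flat_cyc p
  -- With no Tor part, the image in C ⊗ B of a bounding chain is a d-cycle, hence comes from cycles
  -- tensored with B.
  obtain ⟨w, hw⟩ := exists_of_mem_cyc (d := d) (k := k)
    (x := map LinearMap.id (e p).rangeRestrict (x ⟨(k, p + 1), by omega⟩)) (by
      cases k with
      | zero => exact Submodule.mem_top
      | succ k =>
        have h₁ := K.map_range_totPiD x (k := k) (p := p) (by omega)
        rw [hx, map_range_cycleMap] at h₁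
        exact h₁.symm.trans (map_zero _))
  have hk := congrFun hx ⟨(k, p), h⟩
  rw [totPiD_apply, cycleMap_apply, map_zero, map_zero, add_zero, add_zero] at hk
  -- Retracting N_p onto its cycles turns the bounding equation into one between cycles, where both
  -- terms vanish in homology.
  have hk' := congrArg (map (LinearMap.id : C k →ₗ[R] C k) (retract K.t K.ht p)) hk
  rw [map_add, map_smul, map_map', map_map', map_map', retract_comp K.t K.ht K.he,
    retract_subtype, LinearMap.id_comp, LinearMap.id_comp,
    ← LinearMap.id_comp (LinearMap.id : C k →ₗ[R] C k), ← map_map', ← hw, map_map'] at hk'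
  have hz : z ⟨(k, p), h⟩ = map (toCyc K.hd k) (retract K.t K.ht p) (x ⟨(k + 1, p), by omega⟩)
      + K.s k • map LinearMap.id (bdyIncl K.he p) w := by
    apply map_id_injective (C := cyc e p) (cyc d k).subtype_injective
    rw [map_add, map_smul, map_map', map_map', subtype_comp_toCyc]
    exact hk'.symm
  change map (toH d k) (toH e p) (z ⟨(k, p), h⟩) = 0
  rw [hz, map_add, map_smul, map_map', map_map', (exact_toCyc K.hd k).linearMap_comp_eq_zero,
    (exact_bdyIncl K.he p).linearMap_comp_eq_zero, map_zero_left, map_zero_right,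
    LinearMap.zero_apply, LinearMap.zero_apply, smul_zero, add_zero]

/-- The Tor part is treated first: once it vanishes its cycle bounds and can be removed, and the
test for the tensor part assumes that it is absent. -/
lemma mem_range_iff {n : ℕ} (w : K.Src n) :
    K.cycleMap n w ∈ LinearMap.range (totPiD d e K.s n) ↔ K.classMap n w = 0 := by
  obtain ⟨z, u⟩ := w
  have hw : K.cycleMap n (z, u) = K.cycleMap n (z, 0) + K.cycleMap n (0, u) := by
    rw [← map_add, Prod.mk_add_mk, add_zero, zero_add]
  constructor
  · intro h
    have hu := K.toTorKer_eq_zero_of_mem_range h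
    rw [hw] at h
    have hz := K.map_toH_eq_zero_of_mem_range
      ((Submodule.add_mem_iff_left _ (K.cycleMap_snd_mem_range hu)).1 h)
    exact Prod.ext (funext hz) (funext hu)
  · intro h
    rw [hw]
    exact Submodule.add_mem _ (K.cycleMap_fst_mem_range (congrFun (congrArg Prod.fst h)))
      (K.cycleMap_snd_mem_range (congrFun (congrArg Prod.snd h)))

variable (d e) in
lemma eq_zero_of_mem_cyc {s : ℕ → R} {n : ℕ} {x : TotPi C N R n}
    (hx : x ∈ cyc (C := fun n => TotPi C N R n) (totPiD d e s) n) {k p : ℕ}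
    (h : k + p + 1 + 1 = n) :
    map (d k) LinearMap.id (x ⟨(k + 1, p), by omega⟩)
      + s k • map LinearMap.id (e p) (x ⟨(k, p + 1), by omega⟩) = 0 := by
  cases n with
  | zero => omega
  | succ n => exact congrFun (LinearMap.mem_ker.1 hx) ⟨(k, p), by omega⟩

lemma cycleMap_mem_cyc {n : ℕ} (w : K.Src n) :
    K.cycleMap n w ∈ cyc (C := fun n => TotPi C N R n) (totPiD d e K.s) n := by
  cases n with
  | zero => exact Submodule.mem_top
  | succ n => exact K.totPiD_cycleMap w

lemma map_rangeRestrict_mem_cyc {n : ℕ} {x : TotPi C N R n}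
    (hx : x ∈ cyc (C := fun n => TotPi C N R n) (totPiD d e K.s) n) {k p : ℕ}
    (h : k + (p + 1) + 1 = n) :
    map (LinearMap.id : C k →ₗ[R] C k) (e p).rangeRestrict (x ⟨(k, p + 1), h⟩)
      ∈ cyc (C := fun k => C k ⊗[R] LinearMap.range (e p)) (fun k => map (d k) LinearMap.id) k := by
  cases k with
  | zero => exact Submodule.mem_top
  | succ k =>
    have h₁ := congrArg (map (LinearMap.id : C k →ₗ[R] C k) (e p).rangeRestrict)
      (eq_zero_of_mem_cyc d e hx (k := k) (p := p + 1) (by omega))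
    rw [map_add, map_smul, map_map', map_map', rangeRestrict_comp K.he, map_zero_right,
      LinearMap.zero_apply, smul_zero, add_zero, map_zero, LinearMap.id_comp,
      LinearMap.comp_id] at h₁
    change map (d k) LinearMap.id (map LinearMap.id (e p).rangeRestrict _) = 0
    rw [map_map', LinearMap.id_comp, LinearMap.comp_id]
    exact h₁

/-- Every cycle has the same image in `C ⊗ B` as an element coming from the resolution. -/
lemma exists_U_of_mem_cyc {n : ℕ} {x : TotPi C N R n}
    (hx : x ∈ cyc (C := fun n => TotPi C N R n) (totPiD d e K.s) n) {k p : ℕ}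
    (h : k + (p + 1) + 1 = n) :
    ∃ u : K.U k p, map ((cyc d k).subtype ∘ₗ K.φ₀ k) LinearMap.id u.1.2
      = map (LinearMap.id : C k →ₗ[R] C k) (e p).rangeRestrict (x ⟨(k, p + 1), h⟩) := by
  have := K.flat_bdy p
  have := K.flat_cyc p
  obtain ⟨w, hw⟩ := exists_of_mem_cyc (K.map_rangeRestrict_mem_cyc hx h)
  have hid : Function.Surjective
      (LinearMap.id : LinearMap.range (e p) →ₗ[R] LinearMap.range (e p)) :=
    Function.surjective_id
  obtain ⟨u, rfl⟩ := TensorProduct.map_surjective (K.surj k) hid w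
  rw [map_map', LinearMap.id_comp] at hw
  obtain ⟨v, hv⟩ := K.exists_U u (by
    -- The cycle condition at (k, p), retracted to the cycles of N_p, shows that the image of u
    -- among products of cycles is a boundary on the left, hence zero in H ⊗ Z.
    have h₁ := congrArg (map (LinearMap.id : C k →ₗ[R] C k) (retract K.t K.ht p))
      (eq_zero_of_mem_cyc d e hx (k := k) (p := p) (by omega))
    rw [map_add, map_smul, map_map', map_map' _ _ (e p), retract_comp K.t K.ht K.he,
      ← map_map' LinearMap.id LinearMap.id, ← hw, map_map', map_zero, LinearMap.id_comp,
      LinearMap.id_comp, LinearMap.comp_id,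
      LinearMap.comp_id] at h₁
    have h₂ : K.s k • map (K.φ₀ k) (bdyIncl K.he p) u
        = - map (toCyc K.hd k) (retract K.t K.ht p) (x ⟨(k + 1, p), by omega⟩) := by
      apply map_id_injective (C := cyc e p) (cyc d k).subtype_injective
      rw [map_smul, map_neg, map_map', map_map', subtype_comp_toCyc, LinearMap.id_comp,
        LinearMap.id_comp]
      exact (neg_eq_of_add_eq_zero_right h₁).symm
    have h₃ := congrArg (fun y => K.s k • map (toH d k) LinearMap.id y) h₂
    simp only [map_smul, map_neg, map_map', (exact_toCyc K.hd k).linearMap_comp_eq_zero,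
      map_zero_left, LinearMap.zero_apply, neg_zero, smul_zero, smul_smul, K.s_mul_self,
      one_smul, LinearMap.id_comp] at h₃
    exact h₃)
  exact ⟨v, by rw [hv, hw]⟩

/-- If all projections to C ⊗ B vanish, every component lies in C ⊗ Z. The cycle condition then
involves only d, and flatness of Z makes each component a sum of products of cycles. -/
lemma exists_cycleMap_eq_of_map_eq_zero {n : ℕ} {x : TotPi C N R n}
    (hx : x ∈ cyc (C := fun n => TotPi C N R n) (totPiD d e K.s) n)
    (h₀ : ∀ k p (h : k + (p + 1) + 1 = n),
      map (LinearMap.id : C k →ₗ[R] C k) (e p).rangeRestrict (x ⟨(k, p + 1), h⟩) = 0) :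
    ∃ z, K.cycleMap n (z, 0) = x := by
  have h₁ : ∀ k p (h : k + p + 1 = n),
      map (LinearMap.id : C k →ₗ[R] C k) ((cyc e p).subtype ∘ₗ retract K.t K.ht p) (x ⟨(k, p), h⟩)
        = x ⟨(k, p), h⟩ := by
    intro k p h
    cases p with
    | zero =>
      rw [subtype_retract_zero, map_id, LinearMap.id_apply]
    | succ p =>
      have h₂ := congrArg (map (LinearMap.id : C k →ₗ[R] C k) (K.t p)) (h₀ k p h)
      rw [map_map', map_zero, LinearMap.id_comp] at h₂
      have h₃ : map (LinearMap.id : C k →ₗ[R] C k) (LinearMap.id - K.t p ∘ₗ (e p).rangeRestrict)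
          = map LinearMap.id LinearMap.id
            - map LinearMap.id (K.t p ∘ₗ (e p).rangeRestrict) := by
        rw [eq_sub_iff_add_eq, ← map_add_right, sub_add_cancel]
      rw [subtype_retract_succ, h₃, LinearMap.sub_apply, h₂, sub_zero, map_id,
        LinearMap.id_apply]
  have h₂ : ∀ i : TotIdx n, ∃ z, map (cyc d i.1.1).subtype (cyc e i.1.2).subtype z = x i := by
    rintro ⟨⟨k, p⟩, h⟩
    change k + p + 1 = n at h
    have := K.flat_cyc p
    obtain ⟨z, hz⟩ := exists_of_mem_cyc (d := d) (k := k)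
      (x := map (LinearMap.id : C k →ₗ[R] C k) (retract K.t K.ht p) (x ⟨(k, p), h⟩)) (by
        cases k with
        | zero => exact Submodule.mem_top
        | succ k =>
          have h₃ := eq_zero_of_mem_cyc d e hx (k := k) (p := p) (by omega)
          rw [map_e_eq, h₀, map_zero, smul_zero, add_zero] at h₃
          have h₄ := congrArg (map (LinearMap.id : C k →ₗ[R] C k) (retract K.t K.ht p)) h₃
          rw [map_map', map_zero, LinearMap.id_comp, LinearMap.comp_id] at h₄
          change map (d k) LinearMap.id (map LinearMap.id (retract K.t K.ht p) _) = 0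
          rw [map_map', LinearMap.id_comp, LinearMap.comp_id]
          exact h₄)
    refine ⟨z, ?_⟩
    have h₃ := congrArg (map (LinearMap.id : C k →ₗ[R] C k) (cyc e p).subtype) hz
    rw [map_map', map_map', LinearMap.id_comp, LinearMap.comp_id, LinearMap.comp_id, h₁] at h₃
    exact h₃
  choose z hz using h₂
  refine ⟨z, ?_⟩
  funext ⟨⟨k, p⟩, h⟩
  rw [cycleMap_apply, map_zero, map_zero, add_zero, add_zero]
  exact hz _

/-- Subtracting a cycle built from U removes all projections to C ⊗ B. -/
lemma exists_cycleMap_eq {n : ℕ} {x : TotPi C N R n}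
    (hx : x ∈ cyc (C := fun n => TotPi C N R n) (totPiD d e K.s) n) :
    ∃ w, K.cycleMap n w = x := by
  choose u hu using fun j : TorIdx n => K.exists_U_of_mem_cyc hx (k := j.1.1) (p := j.1.2)
    (by have := j.2; omega)
  obtain ⟨z, hz⟩ := K.exists_cycleMap_eq_of_map_eq_zero
    (Submodule.sub_mem _ hx (K.cycleMap_mem_cyc (0, u))) (by
      intro k p h
      rw [Pi.sub_apply, map_sub, map_range_cycleMap, sub_eq_zero]
      exact (hu ⟨(k, p), by omega⟩).symm)
  refine ⟨(z, u), ?_⟩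
  have hw : K.cycleMap n (z, u) = K.cycleMap n (z, 0) + K.cycleMap n (0, u) := by
    rw [← map_add, Prod.mk_add_mk, add_zero, zero_add]
  rw [hw, hz, sub_add_cancel]

/-- The map from sources to cycles of the total complex. -/
noncomputable def toTotCyc (n : ℕ) :
    K.Src n →ₗ[R] cyc (C := fun n => TotPi C N R n) (totPiD d e K.s) n :=
  (K.cycleMap n).codRestrict _ K.cycleMap_mem_cyc

lemma toTotCyc_surjective (n : ℕ) : Function.Surjective (K.toTotCyc n) := by
  rintro ⟨x, hx⟩
  obtain ⟨w, hw⟩ := K.exists_cycleMap_eq hx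
  exact ⟨w, Subtype.ext hw⟩

/-- The homology class of the cycle given by a source. -/
noncomputable def toTotH (n : ℕ) :
    K.Src n →ₗ[R] Hmod (C := fun n => TotPi C N R n) (totPiD d e K.s) n :=
  toH (C := fun n => TotPi C N R n) (totPiD d e K.s) n ∘ₗ K.toTotCyc n

lemma toTotH_surjective (n : ℕ) : Function.Surjective (K.toTotH n) :=
  (Submodule.mkQ_surjective _).comp (K.toTotCyc_surjective n)

lemma ker_toTotH (n : ℕ) : LinearMap.ker (K.toTotH n) = LinearMap.ker (K.classMap n) := by
  ext w
  rw [LinearMap.mem_ker, LinearMap.mem_ker, ← K.mem_range_iff]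
  exact Submodule.Quotient.mk_eq_zero _

/-- **Künneth theorem**: the homology of the total complex. -/
noncomputable def kunnethEquiv (n : ℕ) :
    Hmod (C := fun n => TotPi C N R n) (totPiD d e K.s) n ≃ₗ[R]
      (∀ i : TotIdx n, Hmod d i.1.1 ⊗[R] Hmod e i.1.2) × (∀ j : TorIdx n, K.torKer j.1.1 j.1.2) :=
  equivOfKerEq (A := K.Src n) (B := Hmod (C := fun n => TotPi C N R n) (totPiD d e K.s) n)
    (C := (∀ i : TotIdx n, Hmod d i.1.1 ⊗[R] Hmod e i.1.2) × (∀ j : TorIdx n, K.torKer j.1.1 j.1.2))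
    (f := K.toTotH n) (g := K.classMap n) (K.toTotH_surjective n) (K.classMap_surjective n)
    (K.ker_toTotH n)

lemma kunnethEquiv_apply (n : ℕ) (w : K.Src n) :
    K.kunnethEquiv n (K.toTotH n w) = K.classMap n w :=
  equivOfKerEq_apply (A := K.Src n) (B := Hmod (C := fun n => TotPi C N R n) (totPiD d e K.s) n)
    (C := (∀ i : TotIdx n, Hmod d i.1.1 ⊗[R] Hmod e i.1.2) × (∀ j : TorIdx n, K.torKer j.1.1 j.1.2))
    (f := K.toTotH n) (g := K.classMap n) (K.toTotH_surjective n) (K.classMap_surjective n)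
    (K.ker_toTotH n) w

end KunnethData

/-! ### Categorical homology as cycles modulo boundaries -/

section Homology

open CategoryTheory

variable {R : Type u} [CommRing R]

lemma iCycles_injective (K : ChainComplex (ModuleCat.{u} R) ℕ) (n : ℕ) :
    Function.Injective (K.iCycles n) :=
  (ModuleCat.mono_iff_injective _).1 inferInstance

lemma homologyπ_surjective (K : ChainComplex (ModuleCat.{u} R) ℕ) (n : ℕ) :
    Function.Surjective (K.homologyπ n) :=
  (ModuleCat.epi_iff_surjective _).1 inferInstance

lemma exact_iCycles (K : ChainComplex (ModuleCat.{u} R) ℕ) {i j : ℕ}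
    (h : (ComplexShape.down ℕ).next i = j) : Function.Exact (K.iCycles i) (K.d i j) :=
  (ShortComplex.ShortExact.moduleCat_exact_iff_function_exact _).1
    (ShortComplex.exact_of_f_is_kernel (ShortComplex.mk _ _ (K.iCycles_d i j))
      (K.cyclesIsKernel i j h))

lemma exact_toCycles (K : ChainComplex (ModuleCat.{u} R) ℕ) (n : ℕ) :
    Function.Exact (K.toCycles (n + 1) n) (K.homologyπ n) :=
  (ShortComplex.ShortExact.moduleCat_exact_iff_function_exact _).1
    (ShortComplex.exact_of_g_is_cokernel (ShortComplex.mk _ _ (K.toCycles_comp_homologyπ (n + 1) n))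
      (K.homologyIsCokernel (n + 1) n (by simp)))

lemma homologyπ_eq_zero_iff (K : ChainComplex (ModuleCat.{u} R) ℕ) (n : ℕ) (c : K.cycles n) :
    K.homologyπ n c = 0 ↔ ∃ x, K.d (n + 1) n x = K.iCycles n c := by
  rw [exact_toCycles K n c]
  have h : ∀ x, K.iCycles n (K.toCycles (n + 1) n x) = K.d (n + 1) n x := fun x => by
    rw [← ConcreteCategory.comp_apply, K.toCycles_i]
  refine exists_congr fun x => ?_
  rw [← h, (iCycles_injective K n).eq_iff]

variable {C : ℕ → Type u} [∀ k, AddCommGroup (C k)] [∀ k, Module R (C k)]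
  {d : ∀ k, C (k + 1) →ₗ[R] C k}
  (hd : ∀ k, d k ∘ₗ d (k + 1) = 0)

/-- The chain complex of a sequence of modules. -/
noncomputable abbrev cx : ChainComplex (ModuleCat.{u} R) ℕ :=
  ChainComplex.of (fun k => ModuleCat.of R (C k)) (fun k => ModuleCat.ofHom (d k))
    fun k => ModuleCat.hom_ext (hd k)

lemma cx_d_apply (k : ℕ) (x : C (k + 1)) : (cx hd).d (k + 1) k x = d k x :=
  ConcreteCategory.congr_hom
    (ChainComplex.of_d (fun k => ModuleCat.of R (C k)) (fun k => ModuleCat.ofHom (d k)) k) x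

lemma range_iCycles (n : ℕ) : LinearMap.range ((cx hd).iCycles n).hom = cyc d n := by
  ext x
  cases n with
  | zero =>
    have h := exact_iCycles (cx hd) (i := 0) (j := 0) (by simp)
    refine ⟨fun _ => Submodule.mem_top, fun _ => (h x).1 ?_⟩
    -- The index following 0 is again 0, and the differential there is zero, so in degree 0
    -- everything is a cycle.
    rw [(cx hd).shape 0 0 (by simp)]
    rfl
  | succ n =>
    have h := exact_iCycles (cx hd) (i := n + 1) (j := n) (by simp)
    refine (h x).symm.trans ?_
    rw [cx_d_apply]
    rfl

/-- Cycles of the chain complex as elements. -/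
noncomputable def cyclesToCyc (n : ℕ) : (cx hd).cycles n →ₗ[R] cyc d n :=
  LinearMap.codRestrict _ ((cx hd).iCycles n).hom fun c => by
    rw [← range_iCycles hd]
    exact ⟨c, rfl⟩

lemma cyclesToCyc_surjective (n : ℕ) : Function.Surjective (cyclesToCyc hd n) := by
  rintro ⟨x, hx⟩
  rw [← range_iCycles hd] at hx
  obtain ⟨c, hc⟩ := hx
  exact ⟨c, Subtype.ext hc⟩

/-- The homology of the chain complex of a sequence of modules. -/
noncomputable def homologyEquiv (n : ℕ) : (cx hd).homology n ≃ₗ[R] Hmod d n :=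
  equivOfKerEq (f := ((cx hd).homologyπ n).hom) (g := toH d n ∘ₗ cyclesToCyc hd n)
    (homologyπ_surjective _ n)
    ((Submodule.mkQ_surjective _).comp (cyclesToCyc_surjective hd n)) (by
      ext c
      refine (homologyπ_eq_zero_iff _ n c).trans
        (Iff.trans ?_ (Submodule.Quotient.mk_eq_zero _).symm)
      exact exists_congr fun x => by rw [cx_d_apply]; rfl)

lemma homologyEquiv_apply (n : ℕ) (c : (cx hd).cycles n) :
    homologyEquiv hd n ((cx hd).homologyπ n c) = toH d n (cyclesToCyc hd n c) :=
  equivOfKerEq_apply (f := ((cx hd).homologyπ n).hom) (g := toH d n ∘ₗ cyclesToCyc hd n) _ _ _ c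

end Homology

/-! ### Tor_1 from a two-term projective resolution -/

section TorOne

open CategoryTheory

variable {R : Type u} [CommRing R]

/-- If the differential `K_{n+2} → K_{n+1}` vanishes, then `H_{n+1}` is the kernel of
`K_{n+1} → K_n`. -/
noncomputable def homologyEquivKer (K : ChainComplex (ModuleCat.{u} R) ℕ) {n : ℕ}
    (h : K.d (n + 2) (n + 1) = 0) :
    K.homology (n + 1) ≃ₗ[R] LinearMap.ker (K.d (n + 1) n).hom :=
  have hex := exact_iCycles K (i := n + 1) (j := n) (by simp)
  equivOfKerEq (f := (K.homologyπ (n + 1)).hom)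
    (g := (K.iCycles (n + 1)).hom.codRestrict (LinearMap.ker (K.d (n + 1) n).hom)
      fun c => (hex _).2 ⟨c, rfl⟩)
    (homologyπ_surjective K _)
    (by
      rintro ⟨x, hx⟩
      obtain ⟨c, hc⟩ := (hex x).1 hx
      exact ⟨c, Subtype.ext hc⟩)
    (by
      ext c
      refine (homologyπ_eq_zero_iff K (n + 1) c).trans (Iff.trans ?_ Subtype.ext_iff.symm)
      rw [h]
      exact ⟨fun ⟨x, hx⟩ => hx.symm, fun hc => ⟨0, hc.symm⟩⟩)

variable {B Z N : Type u} [AddCommGroup B] [AddCommGroup Z] [AddCommGroup N] [Module R B]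
  [Module R Z] [Module R N]

/-- The terms of a two-term complex. -/
def twoTermX (R : Type u) [CommRing R] (B Z : Type u) [AddCommGroup B] [AddCommGroup Z]
    [Module R B] [Module R Z] : ℕ → ModuleCat.{u} R
  | 0 => ModuleCat.of R Z
  | 1 => ModuleCat.of R B
  | _ + 2 => ModuleCat.of R PUnit

/-- The differential of a two-term complex. -/
def twoTermD (ι : B →ₗ[R] Z) : ∀ n, twoTermX R B Z (n + 1) ⟶ twoTermX R B Z n
  | 0 => ModuleCat.ofHom ι
  | _ + 1 => 0

/-- The complex `0 → B → Z`. -/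
noncomputable def twoTerm (ι : B →ₗ[R] Z) : ChainComplex (ModuleCat.{u} R) ℕ :=
  ChainComplex.of (twoTermX R B Z) (twoTermD ι) fun _ => Limits.zero_comp

lemma twoTerm_d (ι : B →ₗ[R] Z) (n : ℕ) : (twoTerm ι).d (n + 1) n = twoTermD ι n :=
  ChainComplex.of_d (twoTermX R B Z) (twoTermD ι) n

lemma twoTerm_d_comp {ι : B →ₗ[R] Z} {π : Z →ₗ[R] N} (hex : Function.Exact ι π) :
    (twoTerm ι).d 1 0 ≫ ModuleCat.ofHom π = 0 := by
  rw [twoTerm_d]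
  exact ModuleCat.hom_ext hex.linearMap_comp_eq_zero

/-- The two-term projective resolution given by a short exact sequence. -/
noncomputable def twoTermResolution [Module.Projective R B] [Module.Projective R Z]
    {ι : B →ₗ[R] Z} {π : Z →ₗ[R] N} (hι : Function.Injective ι) (hex : Function.Exact ι π)
    (hπ : Function.Surjective π) : ProjectiveResolution (ModuleCat.of R N) where
  complex := twoTerm ι
  projective
    | 0 => (IsProjective.iff_projective Z).1 inferInstance
    | 1 => (IsProjective.iff_projective B).1 inferInstance
    | _ + 2 => (IsProjective.iff_projective PUnit.{u + 1}).1 inferInstance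
  π := ((twoTerm ι).toSingle₀Equiv _).symm ⟨ModuleCat.ofHom π, twoTerm_d_comp hex⟩
  quasiIso := ⟨fun
    | 0 => by
      rw [ChainComplex.quasiIsoAt₀_iff, ShortComplex.quasiIso_iff_of_zeros' _ rfl rfl rfl]
      have hf : ∀ z, ((((twoTerm ι).toSingle₀Equiv (ModuleCat.of R N)).symm
          ⟨ModuleCat.ofHom π, twoTerm_d_comp hex⟩).f 0) z = π z := fun z =>
        ConcreteCategory.congr_hom
          (ChainComplex.toSingle₀Equiv_symm_apply_f_zero _ (twoTerm_d_comp hex)) z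
      constructor
      · rw [ShortComplex.ShortExact.moduleCat_exact_iff_function_exact]
        intro z
        refine (Eq.congr_left (hf z)).trans ((hex z).trans (exists_congr fun b => ?_))
        exact Eq.congr_left (ConcreteCategory.congr_hom (twoTerm_d ι 0) b).symm
      · rw [ModuleCat.epi_iff_surjective]
        exact fun x => (hπ x).imp fun z hz => (hf z).trans hz
    | 1 => by
      rw [quasiIsoAt_iff_exactAt' (hL := ChainComplex.exactAt_succ_single_obj ..),
          HomologicalComplex.exactAt_iff' _ 2 1 0 (by simp) (by simp),
          ShortComplex.moduleCat_exact_iff]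
      intro b hb
      refine ⟨0, (map_zero _).trans (hι ?_)⟩
      exact (map_zero ι).trans (hb.symm.trans (ConcreteCategory.congr_hom (twoTerm_d ι 0) b))
    | n + 2 => by
      rw [quasiIsoAt_iff_exactAt' (hL := ChainComplex.exactAt_succ_single_obj ..),
          HomologicalComplex.exactAt_iff' _ (n + 3) (n + 2) (n + 1) (by simp) (by simp),
          ShortComplex.moduleCat_exact_iff]
      exact fun b _ => ⟨0, rfl⟩⟩

/-- `Tor₁(H, N)` is the kernel of `H ⊗ B → H ⊗ Z` for a presentation of `N` by projective
modules. -/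
noncomputable def torEquiv [Module.Projective R B] [Module.Projective R Z]
    {ι : B →ₗ[R] Z} {π : Z →ₗ[R] N} (hι : Function.Injective ι) (hex : Function.Exact ι π)
    (hπ : Function.Surjective π) (H : Type u) [AddCommGroup H] [Module R H] :
    ((Tor (ModuleCat.{u} R) 1).obj (ModuleCat.of R H)).obj (ModuleCat.of R N) ≃ₗ[R]
      LinearMap.ker (map (LinearMap.id : H →ₗ[R] H) ι) :=
  ((twoTermResolution hι hex hπ).isoLeftDerivedObj
    ((MonoidalCategory.tensoringLeft _).obj (ModuleCat.of R H)) 1).toLinearEquiv ≪≫ₗ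
  homologyEquivKer _ (by
    have h := congrArg ((MonoidalCategory.tensoringLeft _).obj (ModuleCat.of R H)).map
      (twoTerm_d ι 1)
    exact h.trans (Functor.map_zero _ _ _)) ≪≫ₗ
  LinearEquiv.ofEq _ _ (by
    have h := congrArg ((MonoidalCategory.tensoringLeft _).obj (ModuleCat.of R H)).map
      (twoTerm_d ι 0)
    exact congrArg (fun f => LinearMap.ker (ModuleCat.Hom.hom f)) h)

end TorOne

/-! ### Submodules of projective modules over hereditary rings -/

section Hereditary

variable {R : Type u} [CommRing R]

lemma exists_injective_embedding (A : Type u) [AddCommGroup A] [Module R A] :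
    ∃ E : ModuleCat.{u} R, Module.Injective R E ∧ ∃ i : A →ₗ[R] E, Function.Injective i := by
  obtain ⟨J, hJ, f, hf⟩ := (CategoryTheory.EnoughInjectives.presentation (ModuleCat.of R A))
  exact ⟨J, (Module.injective_iff_injective_object R J).2 hJ, f.hom,
    (ModuleCat.mono_iff_injective _).1 hf⟩

/-- If all ideals are projective, then quotients of injective modules are injective. -/
lemma injective_of_surjective (h : ∀ I : Ideal R, Module.Projective R I) {E Q : Type u}
    [AddCommGroup E] [AddCommGroup Q] [Module R E] [Module R Q] [hE : Module.Injective R E]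
    (π : E →ₗ[R] Q) (hπ : Function.Surjective π) : Module.Injective R Q := by
  refine Module.Baer.injective fun I g => ?_
  -- Baer's criterion: lift through π since the ideal is projective, then extend since E is
  -- injective.
  obtain ⟨l, hl⟩ := Module.projective_lifting_property π g hπ
  obtain ⟨L, hL⟩ := hE.out I.subtype I.subtype_injective l
  refine ⟨π ∘ₗ L, fun x hx => ?_⟩
  rw [← hl, LinearMap.comp_apply, LinearMap.comp_apply, ← hL]
  rfl

/-- If all ideals are projective, then so are all submodules of projective modules. -/
lemma projective_submodule (h : ∀ I : Ideal R, Module.Projective R I) {P : Type u}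
    [AddCommGroup P] [Module R P] [Module.Projective R P] (S : Submodule R P) :
    Module.Projective R S := by
  refine .of_lifting_property'' fun f hf => ?_
  obtain ⟨E, hE, i, hi⟩ := exists_injective_embedding (R := R) (S →₀ R)
  -- Embedding the free cover of S in an injective E makes S embed in E / K. As E / K is again
  -- injective, this map extends to P, and by projectivity of P it lifts to E.
  let K := (LinearMap.ker f).map i
  have hQ := injective_of_surjective h K.mkQ K.mkQ_surjective
  have hker : LinearMap.ker f ≤ LinearMap.ker (K.mkQ ∘ₗ i) := fun a ha =>
    (Submodule.Quotient.mk_eq_zero _).2 ⟨a, ha, rfl⟩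
  obtain ⟨G, hG⟩ := hQ.out S.subtype S.subtype_injective (descend hf hker)
  obtain ⟨L, hL⟩ := Module.projective_lifting_property K.mkQ G K.mkQ_surjective
  -- Modulo K the lift agrees with the embedding of S, so on S it takes values in the image of the
  -- free cover and yields a section of f.
  have key : ∀ s : S, ∃ a, i a = L s ∧ f a = s := fun s => by
    obtain ⟨a, rfl⟩ := hf s
    have h₁ : K.mkQ (L (f a : S)) = K.mkQ (i a) := by
      rw [← LinearMap.comp_apply, hL]
      exact (hG _).trans (descend_apply hf hker a)
    obtain ⟨b, hb, hb'⟩ := (Submodule.Quotient.eq _).1 h₁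
    refine ⟨a + b, by rw [map_add, hb', add_sub_cancel], ?_⟩
    rw [map_add, LinearMap.mem_ker.1 hb, add_zero]
  choose l hl₁ hl₂ using key
  refine ⟨⟨⟨l, fun x y => hi ?_⟩, fun r x => hi ?_⟩, LinearMap.ext hl₂⟩
  · simp only [map_add, hl₁, Submodule.coe_add]
  · simp only [map_smul, hl₁, Submodule.coe_smul, RingHom.id_apply]

lemma projective_ideal [IsDomain R] [IsPrincipalIdealRing R] (I : Ideal R) :
    Module.Projective R I :=
  inferInstance

end Hereditary

/-! ### Künneth data over a ring with projective ideals -/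

section KunnethPID

variable {R : Type u} [CommRing R] {C N : ℕ → Type u} [∀ k, AddCommGroup (C k)]
  [∀ k, Module R (C k)] [∀ k, AddCommGroup (N k)] [∀ k, Module R (N k)]
  {d : ∀ k, C (k + 1) →ₗ[R] C k} {e : ∀ k, N (k + 1) →ₗ[R] N k}

/-- Boundaries and cycles of N are submodules of projectives, hence projective. Nothing is asked of
the modules C: only a free cover of their cycles and its relation module enter. -/
lemma exists_kunnethData (hI : ∀ I : Ideal R, Module.Projective R I)
    [∀ k, Module.Projective R (N k)] (hd : ∀ k, d k ∘ₗ d (k + 1) = 0)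
    (he : ∀ k, e k ∘ₗ e (k + 1) = 0) {s : ℕ → R} (hs : ∀ k, s k * s k = 1)
    (hs' : ∀ k, s (k + 1) = - s k) : ∃ K : KunnethData d e, K.s = s := by
  have hbdy : ∀ k, Module.Projective R (LinearMap.range (e k)) := fun k =>
    projective_submodule hI _
  have hcyc : ∀ k, Module.Projective R (cyc e k) := fun k => projective_submodule hI _
  have ht : ∀ k, ∃ t : LinearMap.range (e k) →ₗ[R] N (k + 1),
      (e k).rangeRestrict ∘ₗ t = LinearMap.id := fun k =>
    Module.projective_lifting_property _ _ (e k).surjective_rangeRestrict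
  choose t ht using ht
  let φ₀ : ∀ k, (cyc d k →₀ R) →ₗ[R] cyc d k := fun k => Finsupp.linearCombination R id
  have hφ : ∀ k, ∃ φ₁ : LinearMap.ker (toH d k ∘ₗ φ₀ k) →ₗ[R] C (k + 1),
      toCyc hd k ∘ₗ φ₁ = φ₀ k ∘ₗ (LinearMap.ker (toH d k ∘ₗ φ₀ k)).subtype := fun k => by
    have := projective_submodule hI (LinearMap.ker (toH d k ∘ₗ φ₀ k))
    -- A relation maps to a cycle that bounds; the relation module is projective, so bounding chains
    -- can be chosen linearly.
    obtain ⟨φ₁, h⟩ := Module.projective_lifting_property (toCyc hd k).rangeRestrict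
      ((φ₀ k ∘ₗ (LinearMap.ker (toH d k ∘ₗ φ₀ k)).subtype).codRestrict
        (LinearMap.range (toCyc hd k)) fun x => (exact_toCyc hd k _).1 x.2)
      (toCyc hd k).surjective_rangeRestrict
    exact ⟨φ₁, LinearMap.ext fun x => congrArg Subtype.val (LinearMap.congr_fun h x)⟩
  choose φ₁ hφ using hφ
  exact ⟨{
    hd := hd
    he := he
    t := t
    ht := ht
    flat_cyc := fun k => inferInstance
    flat_bdy := fun k => inferInstance
    s := s
    s_mul_self := hs
    s_succ := hs'
    F := fun k => cyc d k →₀ R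
    φ₀ := φ₀
    surj := fun k => Finsupp.linearCombination_surjective R Function.surjective_id
    φ₁ := φ₁
    hφ := hφ }, rfl⟩

end KunnethPID

/-! ### Isomorphic complexes have isomorphic homology -/

section HmodCongr

variable {R : Type u} [CommRing R] {C C' : ℕ → Type u} [∀ k, AddCommGroup (C k)]
  [∀ k, Module R (C k)] [∀ k, AddCommGroup (C' k)] [∀ k, Module R (C' k)]
  {d : ∀ k, C (k + 1) →ₗ[R] C k} {d' : ∀ k, C' (k + 1) →ₗ[R] C' k}

lemma mem_cyc_iff (E : ∀ k, C k ≃ₗ[R] C' k) (hE : ∀ k x, E k (d k x) = d' k (E (k + 1) x)) (k : ℕ)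
    (x : C k) : E k x ∈ cyc d' k ↔ x ∈ cyc d k := by
  cases k with
  | zero => exact ⟨fun _ => Submodule.mem_top, fun _ => Submodule.mem_top⟩
  | succ k =>
    change d' k (E (k + 1) x) = 0 ↔ d k x = 0
    rw [← hE, LinearEquiv.map_eq_zero_iff]

variable (E : ∀ k, C k ≃ₗ[R] C' k) (hE : ∀ k x, E k (d k x) = d' k (E (k + 1) x))

/-- An isomorphism of complexes, on cycles. -/
noncomputable def cycMap (k : ℕ) : cyc d k →ₗ[R] cyc d' k :=
  ((E k).toLinearMap ∘ₗ (cyc d k).subtype).codRestrict _ fun x => (mem_cyc_iff E hE k x).2 x.2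

lemma cycMap_surjective (k : ℕ) : Function.Surjective (cycMap E hE k) := by
  rintro ⟨y, hy⟩
  obtain ⟨x, rfl⟩ := (E k).surjective y
  exact ⟨⟨x, (mem_cyc_iff E hE k x).1 hy⟩, rfl⟩

/-- Isomorphic complexes have isomorphic homology. -/
noncomputable def hmodCongr (k : ℕ) : Hmod d k ≃ₗ[R] Hmod d' k :=
  equivOfKerEq (f := toH d k) (g := toH d' k ∘ₗ cycMap E hE k) (Submodule.mkQ_surjective _)
    ((Submodule.mkQ_surjective _).comp (cycMap_surjective E hE k)) (by
      ext x
      refine (Submodule.Quotient.mk_eq_zero _).trans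
        (Iff.trans ?_ (Submodule.Quotient.mk_eq_zero _).symm)
      constructor
      · rintro ⟨y, hy⟩
        exact ⟨E (k + 1) y, by rw [← hE, hy]; rfl⟩
      · rintro ⟨y, hy⟩
        obtain ⟨y, rfl⟩ := (E (k + 1)).surjective y
        rw [← hE] at hy
        exact ⟨y, (E k).injective hy⟩)

lemma hmodCongr_apply (k : ℕ) (x : cyc d k) :
    hmodCongr E hE k (toH d k x) = toH d' k (cycMap E hE k x) :=
  equivOfKerEq_apply (f := toH d k) (g := toH d' k ∘ₗ cycMap E hE k) _ _ _ x

end HmodCongr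

/-! ### The total complex as a product of tensor products -/

section TotalComparison

variable {R X M : Type u} [CommRing R] [AddCommGroup M] [Module R M]

/-- CN_p is free on the sequences without repetition. -/
instance (p : ℕ) : Module.Projective R (Norm R X p) := by
  have h : IsCompl (degen R X R (p + 1)) (Finsupp.supported R R {x : Fin (p + 1) → X | IsRep x}ᶜ) :=
    ⟨Finsupp.disjoint_supported_supported disjoint_compl_right,
      Finsupp.codisjoint_supported_supported isCompl_compl.codisjoint⟩
  exact .of_equiv (Submodule.quotientEquivOfIsCompl _ _ h ≪≫ₗ
    Finsupp.supportedEquivFinsupp _).symm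

lemma totIncl_apply_ne {n : ℕ} {i j : TotIdx n} (h : i ≠ j) (w : Bi R X M i.1.1 i.1.2) :
    totIncl R X M i w j = 0 :=
  DirectSum.of_eq_of_ne _ _ _ h.symm

lemma totIncl_apply_self {n : ℕ} (i : TotIdx n) (w : Bi R X M i.1.1 i.1.2) :
    totIncl R X M i w i = w :=
  DirectSum.of_eq_same (β := fun i : TotIdx n => Bi R X M i.1.1 i.1.2) i w

/-- The signs of the total differential. -/
def totSign (R : Type*) [CommRing R] (σ : ℤˣ) (k : ℕ) : R := ((σ * (-1) ^ (k + 1) : ℤˣ) : ℤ)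

lemma totSign_mul_self (σ : ℤˣ) (k : ℕ) : totSign R σ k * totSign R σ k = 1 := by
  rw [totSign, ← Int.cast_mul, ← Units.val_mul, Int.units_mul_self, Units.val_one, Int.cast_one]

lemma totSign_succ (σ : ℤˣ) (k : ℕ) : totSign R σ (k + 1) = - totSign R σ k := by
  rw [totSign, totSign, pow_succ (-1 : ℤˣ) (k + 1), mul_neg_one, mul_neg, Units.val_neg,
    Int.cast_neg]

/-- `totD` describes where a summand goes, `totPiD` what a component receives, namely from (k + 1,
p) and (k, p + 1). The map a ⊗ b ↦ a ⊗ ∂b keeps k, so the same sign appears in both descriptions. -/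
lemma totD_apply [Spindle X] (A : SpindleAction R X M) (σ : ℤˣ) (n : ℕ) (z : TotMod R X M (n + 1)) :
    (⇑(totD A σ n z) : TotPi (Chain X M) (Norm R X) R n)
      = totPiD (rackD A) (normD R X) (totSign R σ) n ⇑z := by
  funext ⟨⟨k, p⟩, h⟩
  change k + p + 1 = n at h
  rw [totPiD_apply]
  induction z using DirectSum.induction_on with
  | zero =>
    rw [map_zero]
    change 0 = map _ _ 0 + _ • map _ _ 0
    rw [map_zero, map_zero, smul_zero, add_zero]
  | add x y hx hy =>
    rw [map_add]
    change totD A σ n x _ + totD A σ n y _ = map _ _ (x _ + y _) + _ • map _ _ (x _ + y _)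
    rw [hx, hy, map_add, map_add, smul_add, add_add_add_comm]
  | of j w =>
    obtain ⟨⟨k', p'⟩, h'⟩ := j
    have h'' : k' + p' + 1 = n + 1 := h'
    change totD A σ n (totIncl R X M ⟨(k', p'), h''⟩ w) _
      = map _ _ (totIncl R X M ⟨(k', p'), h''⟩ w _)
        + _ • map _ _ (totIncl R X M ⟨(k', p'), h''⟩ w _)
    rw [totD_totIncl, units_smul_eq (R := R)]
    change totD₁ A k' p' h'' w _ + totSign R σ k' • totD₂ R X M k' p' h'' w _ = _
    have h₁ : totD₁ A k' p' h'' w ⟨(k, p), h⟩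
        = map (rackD A k) LinearMap.id
          (totIncl R X M ⟨(k', p'), h''⟩ w ⟨(k + 1, p), by omega⟩) := by
      rcases k' with _ | k'
      · rw [totIncl_apply_ne (by simp), map_zero]
        rfl
      · change totIncl R X M ⟨(k', p'), _⟩ ((rackD A k').rTensor _ w) _ = _
        by_cases hkp : k' = k ∧ p' = p
        · obtain ⟨rfl, rfl⟩ := hkp
          rw [totIncl_apply_self, totIncl_apply_self]
          rfl
        · rw [totIncl_apply_ne (by simpa using hkp), totIncl_apply_ne (by simpa using hkp),
            map_zero]
    have h₂ : totSign R σ k' • totD₂ R X M k' p' h'' w ⟨(k, p), h⟩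
        = totSign R σ k • map LinearMap.id (normD R X p)
          (totIncl R X M ⟨(k', p'), h''⟩ w ⟨(k, p + 1), by omega⟩) := by
      rcases p' with _ | p'
      · rw [totIncl_apply_ne (by simp), map_zero, smul_zero]
        cases k' <;> exact smul_zero _
      · have h₃ : totD₂ R X M k' (p' + 1) h'' w
            = totIncl R X M ⟨(k', p'), by omega⟩ ((normD R X p').lTensor _ w) := by
          cases k' <;> rfl
        rw [h₃]
        by_cases hkp : k' = k ∧ p' = p
        · obtain ⟨rfl, rfl⟩ := hkp
          rw [totIncl_apply_self, totIncl_apply_self]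
          rfl
        · rw [totIncl_apply_ne (by simpa using hkp), totIncl_apply_ne (by simpa using hkp),
            map_zero, smul_zero, smul_zero]
    rw [h₁, h₂]

end TotalComparison

/-- The final clause determines f through T alone, so its values can be checked in the product
decomposition. -/
lemma exists_splitting {R : Type*} [CommRing R] {H A B A' B' : Type*} [AddCommMonoid H]
    [AddCommMonoid A] [AddCommMonoid B] [AddCommMonoid A'] [AddCommMonoid B'] [Module R H]
    [Module R A] [Module R B] [Module R A'] [Module R B'] (T : H ≃ₗ[R] A × B) (P : A' ≃ₗ[R] A)
    (Q : B' ≃ₗ[R] B) : ∃ (f : A' →ₗ[R] H) (g : H →ₗ[R] B') (s : B' →ₗ[R] H),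
      Function.Injective f ∧ Function.Exact f g ∧ Function.Surjective g ∧ g ∘ₗ s = LinearMap.id ∧
      ∀ a h, T h = (P a, 0) → f a = h := by
  have hs : ∀ y, Q.symm (T (T.symm (0, Q y))).2 = y := fun y => by
    rw [T.apply_symm_apply, Q.symm_apply_apply]
  refine ⟨T.symm.toLinearMap ∘ₗ LinearMap.inl R _ _ ∘ₗ P.toLinearMap,
    Q.symm.toLinearMap ∘ₗ LinearMap.snd R _ _ ∘ₗ T.toLinearMap,
    T.symm.toLinearMap ∘ₗ LinearMap.inr R _ _ ∘ₗ Q.toLinearMap,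
    T.symm.injective.comp (LinearMap.inl_injective.comp P.injective), fun x => ⟨fun h => ?_, ?_⟩,
    fun y => ⟨_, hs y⟩, LinearMap.ext hs, fun a h hT => T.symm_apply_eq.2 hT.symm⟩
  · have h₁ : (T x).2 = 0 := (LinearEquiv.map_eq_zero_iff Q.symm).1 h
    refine ⟨P.symm (T x).1, ?_⟩
    change T.symm (P (P.symm (T x).1), 0) = x
    rw [P.apply_symm_apply, T.symm_apply_eq]
    exact Prod.ext rfl h₁.symm
  · rintro ⟨y, rfl⟩
    change Q.symm (T (T.symm (P y, 0))).2 = 0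
    rw [T.apply_symm_apply, map_zero]

/-! ### Assembling the split exact sequence -/

section Splitting

variable {R X M : Type u} [CommRing R] [Spindle X] [AddCommGroup M] [Module R M]

instance (n : ℕ) : Fintype (TorIdx n) :=
  Fintype.subtype ((Finset.range (n + 1) ×ˢ Finset.range (n + 1)).filter
    fun a => a.1 + a.2 + 1 + 1 = n) fun a => by
      simp only [Finset.mem_filter, Finset.mem_product, Finset.mem_range]
      omega

lemma rackD_comp (A : SpindleAction R X M) (k : ℕ) : rackD A k ∘ₗ rackD A (k + 1) = 0 :=
  LinearMap.ext (rackD_rackD A k)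

lemma normD_comp (R X : Type u) [CommRing R] [Spindle X] (p : ℕ) :
    normD R X p ∘ₗ normD R X (p + 1) = 0 :=
  LinearMap.ext (normD_normD p)

lemma degenD_comp (A : SpindleAction R X M) (n : ℕ) : degenD A n ∘ₗ degenD A (n + 1) = 0 :=
  LinearMap.ext fun c => Subtype.ext (rackD_rackD A (n + 1) c.1)

/-- The homology of the augmented complex. -/
noncomputable def augHomologyEquiv (A : SpindleAction R X M) (k : ℕ) :
    augHomology A k ≃ₗ[R] Hmod (rackD A) k :=
  homologyEquiv (rackD_comp A) k

/-- The homology of the normalized complex. -/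
noncomputable def normHomologyEquiv (R X : Type u) [CommRing R] [Spindle X] (p : ℕ) :
    normHomology R X p ≃ₗ[R] Hmod (normD R X) p :=
  homologyEquiv (normD_comp R X) p

/-- `𝓔` as an isomorphism from the product of the summands of the total complex. -/
noncomputable def EPi (R X M : Type u) [CommRing R] [Spindle X] [AddCommGroup M] [Module R M]
    (σ : ℤˣ) (n : ℕ) : TotPi (Chain X M) (Norm R X) R n ≃ₗ[R] degen R X M (n + 1) :=
  (DirectSum.linearEquivFunOnFintype R (TotIdx n) fun i => Bi R X M i.1.1 i.1.2).symm ≪≫ₗ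
    LinearEquiv.ofBijective (EMap R X M σ n) ⟨EMap_injective σ n, EMap_surjective σ n⟩

lemma EPi_coe (σ : ℤˣ) (n : ℕ) (z : TotMod R X M n) : EPi R X M σ n ⇑z = EMap R X M σ n z :=
  congrArg (EMap R X M σ n) ((DirectSum.linearEquivFunOnFintype R (TotIdx n)
    fun i => Bi R X M i.1.1 i.1.2).symm_apply_apply z)

lemma EPi_totPiD (A : SpindleAction R X M) {σ : ℤˣ} {s : ℕ → R} (hs : s = totSign R σ) (n : ℕ)
    (x : TotPi (Chain X M) (Norm R X) R (n + 1)) :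
    EPi R X M σ n (totPiD (rackD A) (normD R X) s n x)
      = degenD A n (EPi R X M σ (n + 1) x) := by
  subst hs
  obtain ⟨z, rfl⟩ := (DirectSum.linearEquivFunOnFintype R (TotIdx (n + 1))
    fun i => Bi R X M i.1.1 i.1.2).surjective x
  have h := EPi_coe σ (n + 1) z
  have h' := totD_apply A σ n z
  refine (congrArg (EPi R X M σ n) h'.symm).trans ?_
  rw [EPi_coe, EMap_totD]
  exact congrArg (degenD A n) h.symm

/-- The homology of the degenerate complex in terms of the total complex. -/
noncomputable def degenHomologyEquiv (A : SpindleAction R X M) {σ : ℤˣ} {s : ℕ → R}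
    (hs : s = totSign R σ) (n : ℕ) :
    degenHomology A n ≃ₗ[R]
      Hmod (C := TotPi (Chain X M) (Norm R X) R) (totPiD (rackD A) (normD R X) s) n :=
  homologyEquiv (degenD_comp A) n ≪≫ₗ (hmodCongr (EPi R X M σ) (EPi_totPiD A hs) n).symm

lemma degenHomologyEquiv_apply (A : SpindleAction R X M) {σ : ℤˣ} {s : ℕ → R}
    (hs : s = totSign R σ) (n : ℕ)
    (c : (degenComplex A).cycles n)
    (x : cyc (C := TotPi (Chain X M) (Norm R X) R) (totPiD (rackD A) (normD R X) s) n)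
    (h : (degenComplex A).iCycles n c = EPi R X M σ n x.1) :
    degenHomologyEquiv A hs n ((degenComplex A).homologyπ n c)
      = toH (C := TotPi (Chain X M) (Norm R X) R)
        (totPiD (rackD A) (normD R X) s) n x := by
  refine (congrArg (hmodCongr (EPi R X M σ) (EPi_totPiD A hs) n).symm
    (homologyEquiv_apply (degenD_comp A) n c)).trans ?_
  rw [LinearEquiv.symm_apply_eq, hmodCongr_apply]
  exact congrArg _ (Subtype.ext h)

open CategoryTheory in
/-- `Tor₁` of the homology modules as a kernel. -/
noncomputable def torHomologyEquiv (hI : ∀ I : Ideal R, Module.Projective R I)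
    (A : SpindleAction R X M) (K : KunnethData (rackD A) (normD R X)) (k p : ℕ) :
    ((Tor (ModuleCat.{u} R) 1).obj (augHomology A k)).obj (normHomology R X p) ≃ₗ[R]
      K.torKer k p :=
  have := projective_submodule hI (LinearMap.range (normD R X p))
  have := projective_submodule hI (cyc (normD R X) p)
  (((Tor (ModuleCat.{u} R) 1).mapIso
      (augHomologyEquiv A k).toModuleIso).app _ ≪≫
    ((Tor (ModuleCat.{u} R) 1).obj _).mapIso
      (normHomologyEquiv R X p).toModuleIso).toLinearEquiv ≪≫ₗ
    torEquiv (ι := bdyIncl K.he p) (π := toH (normD R X) p) (Submodule.inclusion_injective _)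
      (exact_bdyIncl K.he p) (Submodule.mkQ_surjective _) (Hmod (rackD A) k)

/-- The tensor part as a product. -/
noncomputable def tensorPartEquiv (A : SpindleAction R X M) (n : ℕ) :
    TensorPart A n ≃ₗ[R] ∀ i : TotIdx n, Hmod (rackD A) i.1.1 ⊗[R] Hmod (normD R X) i.1.2 :=
  DirectSum.linearEquivFunOnFintype R (TotIdx n)
      (fun i => augHomology A i.1.1 ⊗[R] normHomology R X i.1.2) ≪≫ₗ
    LinearEquiv.piCongrRight fun i =>
      TensorProduct.congr (augHomologyEquiv A i.1.1) (normHomologyEquiv R X i.1.2)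

lemma tensorPartEquiv_tensorIncl (A : SpindleAction R X M) {n : ℕ} (i : TotIdx n)
    (a : augHomology A i.1.1) (b : normHomology R X i.1.2) :
    tensorPartEquiv A n (tensorIncl A i (a ⊗ₜ b))
      = Pi.single i (augHomologyEquiv A i.1.1 a ⊗ₜ normHomologyEquiv R X i.1.2 b) := by
  rw [tensorPartEquiv, LinearEquiv.trans_apply, DirectSum.linearEquivFunOnFintype_lof]
  funext j
  rw [LinearEquiv.piCongrRight_apply]
  obtain rfl | h := eq_or_ne j i
  · rw [Pi.single_eq_same, Pi.single_eq_same, TensorProduct.congr_tmul]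
  · rw [Pi.single_eq_of_ne h, Pi.single_eq_of_ne h, map_zero]

/-- The torsion part as a product. -/
noncomputable def torPartEquiv (hI : ∀ I : Ideal R, Module.Projective R I)
    (A : SpindleAction R X M) (K : KunnethData (rackD A) (normD R X)) (n : ℕ) :
    TorPart A n ≃ₗ[R] ∀ j : TorIdx n, K.torKer j.1.1 j.1.2 :=
  DirectSum.linearEquivFunOnFintype R (TorIdx n) (fun j =>
      ((CategoryTheory.Tor (ModuleCat.{u} R) 1).obj (augHomology A j.1.1)).obj
        (normHomology R X j.1.2)) ≪≫ₗ
    LinearEquiv.piCongrRight fun j => torHomologyEquiv hI A K j.1.1 j.1.2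

lemma cycleMap_single {A : SpindleAction R X M} (K : KunnethData (rackD A) (normD R X)) {n : ℕ}
    (i : TotIdx n) (z : cyc (rackD A) i.1.1 ⊗[R] cyc (normD R X) i.1.2) :
    K.cycleMap n (Pi.single i z, 0)
      = ⇑(totIncl R X M i
        (map (cyc (rackD A) i.1.1).subtype (cyc (normD R X) i.1.2).subtype z)) := by
  funext j
  obtain ⟨⟨k, p⟩, h⟩ := j
  rw [K.cycleMap_apply, map_zero, map_zero, add_zero, add_zero]
  obtain rfl | h := eq_or_ne i ⟨(k, p), h⟩
  · rw [totIncl_apply_self]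
    exact congrArg _ (Pi.single_eq_same _ _)
  · rw [totIncl_apply_ne h]
    exact (congrArg _ (Pi.single_eq_of_ne h.symm _)).trans (map_zero _)

lemma classMap_single {A : SpindleAction R X M} (K : KunnethData (rackD A) (normD R X)) {n : ℕ}
    (i : TotIdx n) (a : cyc (rackD A) i.1.1) (b : cyc (normD R X) i.1.2) :
    K.classMap n (Pi.single i (a ⊗ₜ b), 0)
      = (Pi.single i (toH (rackD A) i.1.1 a ⊗ₜ toH (normD R X) i.1.2 b), 0) := by
  refine Prod.ext (funext fun j => ?_) (funext fun j => map_zero (K.toTorKer _ _))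
  change map _ _ ((Pi.single i (a ⊗ₜ b) :
    ∀ i : TotIdx n, cyc (rackD A) i.1.1 ⊗[R] cyc (normD R X) i.1.2) j)
      = (Pi.single i (toH (rackD A) i.1.1 a ⊗ₜ toH (normD R X) i.1.2 b) :
        ∀ i : TotIdx n, Hmod (rackD A) i.1.1 ⊗[R] Hmod (normD R X) i.1.2) j
  obtain rfl | h := eq_or_ne j i
  · rw [Pi.single_eq_same, Pi.single_eq_same, map_tmul]
  · rw [Pi.single_eq_of_ne h, Pi.single_eq_of_ne h, map_zero]

/-- The homology of the degenerate complex as a product. -/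
noncomputable def degenHomologyProd (A : SpindleAction R X M) {σ : ℤˣ}
    (K : KunnethData (rackD A) (normD R X)) (hK : K.s = totSign R σ) (n : ℕ) :
    degenHomology A n ≃ₗ[R]
      (∀ i : TotIdx n, Hmod (rackD A) i.1.1 ⊗[R] Hmod (normD R X) i.1.2) ×
        (∀ j : TorIdx n, K.torKer j.1.1 j.1.2) :=
  degenHomologyEquiv A hK n ≪≫ₗ K.kunnethEquiv n

/-- The cycle 𝓔(a ⊗ b) comes from the source with the single entry a ⊗ b and no Tor part, and
`classMap` sends this source to the product of the two classes. -/
lemma degenHomologyProd_apply (A : SpindleAction R X M) {σ : ℤˣ}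
    (K : KunnethData (rackD A) (normD R X)) (hK : K.s = totSign R σ) (n : ℕ) (i : TotIdx n)
    (a : (augComplex A).cycles i.1.1) (b : (normComplex R X).cycles i.1.2)
    (c : (degenComplex A).cycles n)
    (h : (degenComplex A).iCycles n c = EMap R X M σ n (totIncl R X M i
      ((augComplex A).iCycles i.1.1 a ⊗ₜ[R] (normComplex R X).iCycles i.1.2 b))) :
    degenHomologyProd A K hK n ((degenComplex A).homologyπ n c)
      = (tensorPartEquiv A n (tensorIncl A i
        ((augComplex A).homologyπ i.1.1 a ⊗ₜ[R] (normComplex R X).homologyπ i.1.2 b)), 0) := by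
  have ha : augHomologyEquiv A i.1.1 ((augComplex A).homologyπ i.1.1 a)
      = toH (rackD A) i.1.1 (cyclesToCyc (rackD_comp A) i.1.1 a) :=
    homologyEquiv_apply (rackD_comp A) _ a
  have hb : normHomologyEquiv R X i.1.2 ((normComplex R X).homologyπ i.1.2 b)
      = toH (normD R X) i.1.2 (cyclesToCyc (normD_comp R X) i.1.2 b) :=
    homologyEquiv_apply (normD_comp R X) _ b
  rw [tensorPartEquiv_tensorIncl, ha, hb]
  have hc : degenHomologyEquiv A hK n ((degenComplex A).homologyπ n c) = K.toTotH n (Pi.single i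
      (cyclesToCyc (rackD_comp A) i.1.1 a ⊗ₜ cyclesToCyc (normD_comp R X) i.1.2 b), 0) := by
    refine degenHomologyEquiv_apply A hK n c (K.toTotCyc n _) ?_
    change _ = EPi R X M σ n (K.cycleMap n _)
    rw [cycleMap_single, EPi_coe, map_tmul, h]
    rfl
  exact (congrArg (K.kunnethEquiv n) hc).trans
    ((K.kunnethEquiv_apply n _).trans (classMap_single K i _ _))

end Splitting

end SpindleHomology

theorem theorem7p1 {R X M : Type u} [CommRing R] [Spindle X] [AddCommGroup M] [Module R M]
    (A : SpindleAction R X M) (σ : ℤˣ) :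
    (∃ Φ : SpindleHomology.totComplex A σ ≅ SpindleHomology.degenComplex A,
      (∀ n, Φ.hom.f n = ModuleCat.ofHom (SpindleHomology.EMap R X M σ n)) ∧
      ∀ p n, (SpindleHomology.totFilt R X M p n).map (SpindleHomology.EMap R X M σ n)
        = SpindleHomology.degenFilt R X M p n) ∧
    (IsDomain R → IsPrincipalIdealRing R → ∀ n,
      ∃ (f : SpindleHomology.TensorPart A n →ₗ[R] SpindleHomology.degenHomology A n)
        (g : SpindleHomology.degenHomology A n →ₗ[R] SpindleHomology.TorPart A n)
        (s : SpindleHomology.TorPart A n →ₗ[R] SpindleHomology.degenHomology A n),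
        Function.Injective f ∧ Function.Exact f g ∧ Function.Surjective g ∧
        g ∘ₗ s = LinearMap.id ∧
        ∀ (i : SpindleHomology.TotIdx n)
          (a : (SpindleHomology.augComplex A).cycles i.1.1)
          (b : (SpindleHomology.normComplex R X).cycles i.1.2)
          (c : (SpindleHomology.degenComplex A).cycles n),
          (SpindleHomology.degenComplex A).iCycles n c
              = SpindleHomology.EMap R X M σ n (SpindleHomology.totIncl R X M i
                  ((SpindleHomology.augComplex A).iCycles i.1.1 a ⊗ₜ[R]
                    (SpindleHomology.normComplex R X).iCycles i.1.2 b)) →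
          f (SpindleHomology.tensorIncl A i
              ((SpindleHomology.augComplex A).homologyπ i.1.1 a ⊗ₜ[R]
                (SpindleHomology.normComplex R X).homologyπ i.1.2 b))
            = (SpindleHomology.degenComplex A).homologyπ n c) := by
  refine ⟨⟨SpindleHomology.EIso A σ, SpindleHomology.EIso_hom_f A σ,
    SpindleHomology.map_EMap_totFilt σ⟩, fun _ _ n => ?_⟩
  -- The signs of the Künneth data must be those of the total complex, so that 𝓔 carries its
  -- homology to that of the degenerate complex.
  obtain ⟨K, hK⟩ := SpindleHomology.exists_kunnethData (s := SpindleHomology.totSign R σ)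
    SpindleHomology.projective_ideal (SpindleHomology.rackD_comp A)
    (SpindleHomology.normD_comp R X) (SpindleHomology.totSign_mul_self σ)
    (SpindleHomology.totSign_succ σ)
  obtain ⟨f, g, s, hf, hfg, hg, hgs, h⟩ := SpindleHomology.exists_splitting
    (SpindleHomology.degenHomologyProd A K hK n) (SpindleHomology.tensorPartEquiv A n)
    (SpindleHomology.torPartEquiv SpindleHomology.projective_ideal A K n)
  exact ⟨f, g, s, hf, hfg, hg, hgs, fun i a b c hc =>
    h _ _ (SpindleHomology.degenHomologyProd_apply A K hK n i a b c hc)⟩
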